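/- **Setting.** Let $k$ be a finite field of characteristic $\neq 2$ with $q$ elements, $\mathcal O=k[[\varpi]]$, $F=k((\varpi))$ with valuation $v$, and $r\ge 0$ an integer. Let $T_r$, $N_r$, $W_r\subset GL_r(F)$ be the diagonal matrices, the upper triangular unipotent matrices and the permutation matrices. For $g\in GL_r(F)$ write $g=n\,B(g)\,n'$ with $n,n'\in N_r$, $B(g)\in T_rW_r$ (Bruhat decomposition; $B(g)$ is unique). Let $\zeta:k^*\to\{\pm1\}$, $\zeta(\lambda)=\lambda^{(q-1)/2}$. **Determinant lines.** For a finite-dimensional $V$ put $\bigwedge V=\bigwedge^{\dim V}V$. For a short exact sequence $0\to V\to V''\to V'\to 0$ use the isomorphism $\bigwedge V'\otimes\bigwedge V\cong\bigwedge V''$, $(v_1'\wedge\dots\wedge v_n')\otimes(v_1\wedge\dots\wedge v_m)\mapsto\tilde v_1'\wedge\dots\wedge\tilde v_n'\wedge v_1\wedge\dots\wedge v_m$ (quotient first, $\tilde v'_i$ lifting $v'_i$). For lattices $A,B\subset F^r$ put $(A|B)=(\bigwedge A/A\cap B)^*\otimes\bigwedge B/A\cap B$. For any lattice $M\subset A\cap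 B$ these isomorphisms identify $(A|B)=(\bigwedge A/M)^*\otimes\bigwedge B/M$ (inserting $n^*\otimes n$ for a basis $n$ of $\bigwedge (A\cap B)/M$), and contracting $\bigwedge B/M$ with its dual, for $M=A\cap B\cap C$, gives $\beta:(A|B)\otimes(B|C)\to(A|C)$. For $g\in GL_r(F)$ put $D_g=(\mathcal O^r|g\mathcal O^r)$. The extension $\tilde G_r'$ of Arbarello–De Concini–Kac is the set of pairs $(g,v)$, $g\in GL_r(F)$, $v\in D_g\setminus\{0\}$, with multiplication $*$ given by $D_g\otimes D_{g'}\xrightarrow{\ g\ }(\mathcal O^r|g\mathcal O^r)\otimes(g\mathcal O^r|gg'\mathcal O^r)\xrightarrow{\beta}D_{gg'}$; here $D_1=k$. **The geometric extension.** $\tilde G_{r,\mathrm{geo}}=\det^*\tilde G_1'-\tilde G_r'$ (Baer difference) is the set of pairs $(g,x)$, $x\in\Delta_g\setminus\{0\}$, $\Delta_g=D_{\det g}\otimes D_g^{\otimes-1}$, with $(g,a\otimes b^{-1})(g',a'\otimes b'^{-1})=(gg',(a*a')\otimes(b*b')^{-1})$; here $\Delta_1=k$. **The section.** For $n\in N_r$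 choose a lattice $L$ with $nL=L$ and a nonzero $v\in(\mathcal O^r|L)$; let $\mathfrak d_n\in D_n$ be $\beta(v\otimes n(v^{-1}))$, with $v^{-1}\in(L|\mathcal O^r)$ the inverse of $v$, and $\delta_n=1\otimes\mathfrak d_n^{-1}\in\Delta_n$. For $t=\mathrm{diag}(t_1,\dots,t_r)\in T_r$ and $w\in W_r$ choose an even $m\ge 0$ with $\varpi^m\mathcal O^r\subset\mathcal O^r\cap t\mathcal O^r$; let $\mathfrak d_{tw}\in D_{tw}=D_t$ be $$\Big(\bigwedge_{i=1}^r\bigwedge_{j=0}^{m-1}\varpi^je_i\Big)^*\otimes\bigwedge_{i=1}^r\bigwedge_{j=v(t_i)}^{m-1}\varpi^je_i\ \in\ \Big(\bigwedge\mathcal O^r/\varpi^m\mathcal O^r\Big)^*\otimes\bigwedge t\mathcal O^r/\varpi^m\mathcal O^r$$ (factors in lexicographic order of $(i,j)$), and $$\delta_{tw}=(-1)^{\sum_{i=1}^r(r-i)v(t_i)}\,(\mathfrak d_{t_r}*\mathfrak d_{t_{r-1}}*\cdots*\mathfrak d_{t_1})\otimes\mathfrak d_{tw}^{-1}\in\Delta_{tw},$$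 with $\mathfrak d_{t_i}\in D_{t_i}$ the elements for $GL_1$ and $D_{\det(tw)}=D_{\det t}$. For $g=n(tw)n'$ let $s_{\mathrm{geo}}(g)=(g,\delta_g)=(n,\delta_n)(tw,\delta_{tw})(n',\delta_{n'})$. **Kazhdan–Patterson cocycles.** Let $\{\cdot,\cdot\}:F^*\times F^*\to A$ be a map to an abelian group. A KP cocycle for $\{\cdot,\cdot\}$ is a map $\chi:GL_r(F)^2\to A$ with $\chi(g',g'')\chi(gg',g'')^{-1}\chi(g,g'g'')\chi(g,g')^{-1}=1$ and, for all $t,t'\in T_r$, $w,w'\in W_r$, $n,n'\in N_r$, $g,g'\in GL_r(F)$ and all matrices $\alpha$ of transpositions $(\ell,\ell+1)$: 1. $\chi(t,t')=\prod_{i<j}\{t_i,t_j'\}$; 2. $\chi(w,w')=1$; 3. $\chi(t,w)=1$; 4. $\chi(\alpha,t)=\{t_\ell,t_{\ell+1}\}^{-1}\{-1,t_\ell/t_{\ell+1}\}\{-1,\det t\}$; 5. $\chi(ng,g'n')=\chi(g,g')$; 6. $\chi(t,g)=\chi(t,B(g))$; 7. $\chi(\alpha,g)=\chi(B(\alpha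 g)B(g)^{-1},B(g))$. Let $\{f,g\}=(-1)^{v(f)v(g)}\frac{f^{v(g)}}{g^{v(f)}}(0)\in k^*$ be the tame symbol and $[f,g]\in\{\pm1\}$ the quadratic Hilbert symbol of $F$. For a 2-cocycle $\chi$ with values in $A$, the associated extension is $GL_r(F)\times A$ with the law $(g,z)(g',z')=(gg',zz'\chi(g,g'))$. **Theorem.** (a) For every $s\ge 0$, $\tilde G_s'$ is a central extension of $GL_s(F)$ by $k^*$; $\tilde G_{r,\mathrm{geo}}$ is a central extension of $GL_r(F)$ by $k^*$. The element $\delta_g$ exists and does not depend on the choices, so $s_{\mathrm{geo}}$ is a well-defined section of $\tilde G_{r,\mathrm{geo}}\to GL_r(F)$. (b) There is a unique KP cocycle $\chi$ for the tame symbol $\{\cdot,\cdot\}$. Define $\chi_{\mathrm{geo}}:GL_r(F)^2\to k^*$ by $s_{\mathrm{geo}}(g)s_{\mathrm{geo}}(g')=\chi_{\mathrm{geo}}(g,g')\,s_{\mathrm{geo}}(gg')$. Then $\chi_{\mathrm{geo}}$ is the KP cocycle for the symbol $\{\cdot,\cdot\}^{-1}$, that is, it satisfies the cocycle identity and (1)–(7)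 for $(f,g)\mapsto\{f,g\}^{-1}$, and $\chi_{\mathrm{geo}}(g,g')=\chi(g,g')^{-1}$ for all $g,g'$. (c) The Kazhdan–Patterson extension $\tilde G_{r,KP}$ (by $k^*$) associated with $\chi$ is a central extension, and is isomorphic as a group over $GL_r(F)$ to $\tilde G_{r,\mathrm{geo}}$: there is an isomorphism $\tilde G_{r,KP}\to\tilde G_{r,\mathrm{geo}}$ over $GL_r(F)$ which sends $(g,1)$ to $s_{\mathrm{geo}}(g)$ and which is $z\mapsto z^{-1}$ on $k^*$. (d) There is a unique KP cocycle $\chi_2$ for the Hilbert symbol, and $\chi_2(g,g')=\zeta(\chi_{\mathrm{geo}}(g,g'))$ for all $g,g'$. The associated Kazhdan–Patterson cover of $GL_r(F)$ by $\{\pm1\}$ is a central extension, and is the pushout of $\tilde G_{r,\mathrm{geo}}$ by $\zeta:k^*\to\{\pm1\}$. -/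

import Mathlib

open scoped TensorProduct LaurentSeries

namespace KPGeo

/-! ### Top exterior powers of vector spaces -/

section Top

universe u v

/-- The determinant line `⋀ V = ⋀^{dim V} V`. -/
noncomputable abbrev TopExt (k : Type u) [Field k] (V : Type v) [AddCommGroup V] [Module k V] :
    Submodule k (ExteriorAlgebra k V) :=
  ⋀[k]^(Module.finrank k V) V

variable {k : Type u} [Field k] {V V' V'' W : Type v}
  [AddCommGroup V] [Module k V] [AddCommGroup V'] [Module k V']
  [AddCommGroup V''] [Module k V''] [AddCommGroup W] [Module k W]

theorem map_mem_pow (f : V →ₗ[k] W) {n : ℕ} {x : ExteriorAlgebra k V} (hx : x ∈ ⋀[k]^n V) :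
    ExteriorAlgebra.map f x ∈ ⋀[k]^n W := by
  have h : (⋀[k]^n V).map (ExteriorAlgebra.map f).toLinearMap ≤ ⋀[k]^n W := by
    rw [Submodule.map_pow]
    refine pow_le_pow_left' ?_ n
    rintro _ ⟨_, ⟨y, rfl⟩, rfl⟩
    exact ⟨f y, by simp⟩
  exact h ⟨x, hx, rfl⟩

theorem mem_topExt {n : ℕ} {x : ExteriorAlgebra k V} (hx : x ∈ ⋀[k]^n V)
    (h : n = Module.finrank k V) : x ∈ TopExt k V := by
  subst h; exact hx

/-- Functoriality of `V ↦ ⋀ V` for linear isomorphisms. -/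
noncomputable def TopExt.congr (e : V ≃ₗ[k] W) : TopExt k V ≃ₗ[k] TopExt k W :=
  { (ExteriorAlgebra.map e.toLinearMap).toLinearMap.restrict
      (p := TopExt k V) (q := TopExt k W)
      fun _ hx => mem_topExt (map_mem_pow e.toLinearMap hx) e.finrank_eq with
    invFun := fun y => ⟨ExteriorAlgebra.map e.symm.toLinearMap y.1,
      mem_topExt (map_mem_pow e.symm.toLinearMap y.2) e.symm.finrank_eq⟩
    left_inv := fun x => Subtype.ext (by
      have := DFunLike.congr_fun
        (ExteriorAlgebra.map_comp_map (R := k) e.toLinearMap e.symm.toLinearMap) x.1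
      have h : e.symm.toLinearMap ∘ₗ e.toLinearMap = LinearMap.id := by ext; simp
      rw [h, ExteriorAlgebra.map_id] at this
      exact this)
    right_inv := fun x => Subtype.ext (by
      have := DFunLike.congr_fun
        (ExteriorAlgebra.map_comp_map (R := k) e.symm.toLinearMap e.toLinearMap) x.1
      have h : e.toLinearMap ∘ₗ e.symm.toLinearMap = LinearMap.id := by ext; simp
      rw [h, ExteriorAlgebra.map_id] at this
      exact this) }

theorem finrank_topExt [FiniteDimensional k V] : Module.finrank k (TopExt k V) = 1 := by
  rw [exteriorPower.finrank_eq, Nat.choose_self]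

theorem iMulti_ne_zero {n : ℕ} {v : Fin n → V} (hv : LinearIndependent k v) :
    ExteriorAlgebra.ιMulti k n v ≠ 0 := by
  intro h0
  obtain ⟨g, hg⟩ := (Finsupp.linearCombination k v).exists_leftInverse_of_injective
    (LinearMap.ker_eq_bot.2 hv)
  have h1 := congrArg (ExteriorAlgebra.liftAlternating (R := k) (M := V) (N := k)
    (Function.update 0 n ((Pi.basisFun k (Fin n)).det.compLinearMap
      ((Finsupp.linearEquivFunOnFinite k k (Fin n)).toLinearMap ∘ₗ g)))) h0
  rw [ExteriorAlgebra.liftAlternating_apply_ιMulti, map_zero, Function.update_self] at h1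
  have h2 : (fun i => ((Finsupp.linearEquivFunOnFinite k k (Fin n)).toLinearMap ∘ₗ g) (v i))
      = Pi.basisFun k (Fin n) := by
    funext i
    have := DFunLike.congr_fun hg (Finsupp.single i 1)
    simp only [LinearMap.comp_apply, Finsupp.linearCombination_single, one_smul,
      LinearMap.id_apply] at this
    simp [this]
  rw [AlternatingMap.compLinearMap_apply] at h1
  rw [h2, Module.Basis.det_self] at h1
  exact one_ne_zero h1

variable (i : V →ₗ[k] V'') (p : V'' →ₗ[k] V')

/-- For an exact sequence `0 → V → V'' → V' → 0`, the canonical isomorphism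
`⋀ V' ⊗ ⋀ V ≃ ⋀ V''` sending `(v'₁ ∧ … ∧ v'ₙ) ⊗ (v₁ ∧ … ∧ vₘ)` to
`ṽ'₁ ∧ … ∧ ṽ'ₙ ∧ v₁ ∧ … ∧ vₘ` (quotient factor first), where `ṽ'ⱼ` is a lift of `v'ⱼ`; the lifts are
taken through an auxiliary linear section of `p`, on which the result does not depend. -/
noncomputable def wedgeLin (hi : Function.Injective i) (hp : Function.Surjective p)
    (hex : LinearMap.range i = LinearMap.ker p) [FiniteDimensional k V''] :
    TopExt k V' →ₗ[k] TopExt k V →ₗ[k] TopExt k V'' :=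
  LinearMap.mk₂ k
    (fun x y => ⟨ExteriorAlgebra.map
        (Classical.choose (p.exists_rightInverse_of_surjective (LinearMap.range_eq_top.2 hp))) x.1
        * ExteriorAlgebra.map i y.1, by
      have h : Module.finrank k V'' = Module.finrank k V' + Module.finrank k V := by
        rw [← p.finrank_range_add_finrank_ker, LinearMap.range_eq_top.2 hp, finrank_top, ← hex,
          LinearMap.finrank_range_of_inj hi]
      exact mem_topExt (SetLike.mul_mem_graded (A := fun n : ℕ => ⋀[k]^n V'')
        (map_mem_pow _ x.2) (map_mem_pow _ y.2)) h.symm⟩)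
    (fun _ _ _ => Subtype.ext (by simp [add_mul]))
    (fun _ _ _ => Subtype.ext (by simp))
    (fun _ _ _ => Subtype.ext (by simp [mul_add]))
    (fun _ _ _ => Subtype.ext (by simp))

theorem wedgeLin_ne_zero (hi : Function.Injective i) (hp : Function.Surjective p)
    (hex : LinearMap.range i = LinearMap.ker p) [FiniteDimensional k V''] :
    ∃ x y, wedgeLin i p hi hp hex x y ≠ 0 := by
  have hV : FiniteDimensional k V := FiniteDimensional.of_injective i hi
  have hV' : FiniteDimensional k V' := Module.Finite.of_surjective p hp
  set s := Classical.choose (p.exists_rightInverse_of_surjective (LinearMap.range_eq_top.2 hp))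
    with hs
  have hps : p ∘ₗ s = LinearMap.id :=
    Classical.choose_spec (p.exists_rightInverse_of_surjective (LinearMap.range_eq_top.2 hp))
  let b := Module.finBasis k V
  let c := Module.finBasis k V'
  refine ⟨exteriorPower.ιMulti k _ c, exteriorPower.ιMulti k _ b, fun h => ?_⟩
  have h1 := congrArg Subtype.val h
  simp only [wedgeLin, LinearMap.mk₂_apply, exteriorPower.ιMulti_apply_coe,
    ExteriorAlgebra.map_apply_ιMulti, ExteriorAlgebra.ιMulti_mul_ιMulti] at h1
  refine iMulti_ne_zero (k := k) ?_ h1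
  rw [Fintype.linearIndependent_iff]
  intro a ha
  rw [Fin.sum_univ_add] at ha
  simp only [Fin.append_left, Fin.append_right, Function.comp_apply] at ha
  have hpi : ∀ y, p (i y) = 0 := fun y => by
    have : i y ∈ LinearMap.ker p := hex ▸ LinearMap.mem_range_self i y
    exact this
  have hpc : ∀ y, p (s y) = y := fun y => DFunLike.congr_fun hps y
  have h2 := congrArg p ha
  simp only [map_add, map_sum, map_smul, map_zero] at h2
  simp only [hpi, smul_zero, Finset.sum_const_zero, add_zero] at h2
  have h3 : ∀ j, a (Fin.castAdd _ j) = 0 := by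
    refine Fintype.linearIndependent_iff.1 c.linearIndependent _ ?_
    rw [← h2]
    exact Finset.sum_congr rfl fun j _ => by rw [← hs, hpc]
  simp only [h3, zero_smul, Finset.sum_const_zero, zero_add] at ha
  have h4 : ∀ j, a (Fin.natAdd _ j) = 0 := by
    refine Fintype.linearIndependent_iff.1 b.linearIndependent _ (hi ?_)
    rw [map_zero, ← ha, map_sum]
    simp
  exact fun j => Fin.addCases h3 h4 j

/-- The isomorphism `⋀ V' ⊗ ⋀ V ≃ ⋀ V''` of a short exact sequence. -/
noncomputable def wedgeEquiv (hi : Function.Injective i) (hp : Function.Surjective p)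
    (hex : LinearMap.range i = LinearMap.ker p) [FiniteDimensional k V''] :
    TopExt k V' ⊗[k] TopExt k V ≃ₗ[k] TopExt k V'' :=
  LinearEquiv.ofBijective (TensorProduct.lift (wedgeLin i p hi hp hex)) (by
    have hV : FiniteDimensional k V := FiniteDimensional.of_injective i hi
    have hV' : FiniteDimensional k V' := Module.Finite.of_surjective p hp
    have hd : Module.finrank k (TopExt k V' ⊗[k] TopExt k V)
        = Module.finrank k (TopExt k V'') := by
      rw [Module.finrank_tensorProduct, finrank_topExt, finrank_topExt, finrank_topExt]
    have hsurj : Function.Surjective (TensorProduct.lift (wedgeLin i p hi hp hex)) := by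
      obtain ⟨x, y, hxy⟩ := wedgeLin_ne_zero i p hi hp hex
      intro z
      obtain ⟨c, hc⟩ := exists_smul_eq_of_finrank_eq_one (finrank_topExt (k := k) (V := V'')) hxy z
      exact ⟨c • (x ⊗ₜ y), by simp [hc]⟩
    exact ⟨(LinearMap.injective_iff_surjective_of_finrank_eq_finrank (K := k)
      (V := TopExt k V' ⊗[k] TopExt k V) (V₂ := TopExt k V'') hd
      (f := TensorProduct.lift (wedgeLin i p hi hp hex))).2 hsurj, hsurj⟩)

end Top

/-! ### Relative determinant lines `(A|B)` -/

section Rel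

universe u v

variable {k : Type u} [Field k] {U : Type v} [AddCommGroup U] [Module k U]

/-- The quotient `A / A ∩ M`. -/
abbrev SubQ (A M : Submodule k U) : Type v := A ⧸ M.submoduleOf A

theorem SubQ.le_comap {A A' M M' : Submodule k U} (hA : A ≤ A') (hM : M ≤ M') :
    M.submoduleOf A ≤ (M'.submoduleOf A').comap (Submodule.inclusion hA) :=
  fun _ hx => hM hx

/-- The map `A / A ∩ M → A' / A' ∩ M'` induced by `A ⊆ A'`, `M ⊆ M'`. -/
def SubQ.incl {A A' M M' : Submodule k U} (hA : A ≤ A') (hM : M ≤ M') :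
    SubQ A M →ₗ[k] SubQ A' M' :=
  Submodule.mapQ _ _ (Submodule.inclusion hA) (SubQ.le_comap hA hM)

theorem SubQ.incl_injective {A A' : Submodule k U} (M : Submodule k U) (hA : A ≤ A') :
    Function.Injective (SubQ.incl (M := M) (M' := M) hA le_rfl) := by
  rw [← LinearMap.ker_eq_bot, LinearMap.ker_eq_bot']
  intro x
  induction x using Submodule.Quotient.induction_on with
  | _ x =>
    intro hx
    have hx' : (Submodule.Quotient.mk (Submodule.inclusion hA x) : SubQ A' M) = 0 := hx
    rw [Submodule.Quotient.mk_eq_zero] at hx'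
    exact (Submodule.Quotient.mk_eq_zero _).2 hx'

/-- The isomorphism `A / A ∩ M ≃ A' / A' ∩ M'` induced by a linear automorphism `e` of the ambient
space with `e A = A'`, `e M = M'`. -/
noncomputable def SubQ.congr (e : U ≃ₗ[k] U) {A A' M M' : Submodule k U}
    (hA : A.map e.toLinearMap = A') (hM : M.map e.toLinearMap = M') :
    SubQ A M ≃ₗ[k] SubQ A' M' :=
  Submodule.Quotient.equiv _ _ ((e.submoduleMap A).trans (LinearEquiv.ofEq _ _ hA)) (by
    subst hA hM
    ext ⟨x, hx⟩
    obtain ⟨y, hy, rfl⟩ := hx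
    constructor
    · rintro ⟨z, hz, hzx⟩
      exact ⟨z.1, hz, congrArg Subtype.val hzx⟩
    · rintro ⟨z, hz, hzx⟩
      have hzy : z = y := e.injective hzx
      subst hzy
      exact ⟨⟨z, hy⟩, hz, rfl⟩)

/-- The set of nonzero elements of the line
`(A|B) = (⋀ A/A∩B)^* ⊗ ⋀ (B/A∩B) = Hom (⋀ A/A∩B, ⋀ B/A∩B)`. -/
abbrev Rel (A B : Submodule k U) : Type _ :=
  TopExt k (SubQ A B) ≃ₗ[k] TopExt k (SubQ B A)

/-- Multiplication of an element of `(A|B)` by a nonzero scalar. -/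
noncomputable def Rel.smul {A B : Submodule k U} (z : kˣ) (x : Rel A B) : Rel A B :=
  x.trans (LinearEquiv.smulOfUnit z)

/-- The isomorphism `(A|B) → (eA|eB)` induced by a linear automorphism `e`. -/
noncomputable def Rel.map (e : U ≃ₗ[k] U) {A A' B B' : Submodule k U}
    (hA : A.map e.toLinearMap = A') (hB : B.map e.toLinearMap = B') (x : Rel A B) : Rel A' B' :=
  (TopExt.congr (SubQ.congr e hA hB)).symm.trans
    (x.trans (TopExt.congr (SubQ.congr e hB hA)))

/-- Transport along an equality of subspaces. -/
def Rel.cast {A B B' : Submodule k U} (h : B = B') (x : Rel A B) : Rel A B' := h ▸ x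

/-- For `M ⊆ A ∩ B`: the isomorphism `⋀ (A/A∩B) ⊗ ⋀ (A∩B/M) ≃ ⋀ (A/M)`. -/
noncomputable def wedgeSub (A B M : Submodule k U) (hM : M ≤ A ⊓ B)
    (hf : FiniteDimensional k (SubQ A M)) :
    TopExt k (SubQ A B) ⊗[k] TopExt k (SubQ (A ⊓ B) M) ≃ₗ[k] TopExt k (SubQ A M) :=
  wedgeEquiv (SubQ.incl inf_le_left le_rfl) (SubQ.incl le_rfl (hM.trans inf_le_right))
    (SubQ.incl_injective M inf_le_left)
    (by
      intro y
      induction y using Submodule.Quotient.induction_on with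
      | _ y => exact ⟨Submodule.Quotient.mk y, rfl⟩)
    (by
      ext y
      induction y using Submodule.Quotient.induction_on with
      | _ y =>
        have h0 : Submodule.Quotient.mk y ∈ LinearMap.ker (SubQ.incl (le_refl A)
            (hM.trans inf_le_right) : SubQ A M →ₗ[k] SubQ A B) ↔ (y : U) ∈ B :=
          (Submodule.Quotient.mk_eq_zero (B.submoduleOf A) (x := y))
        rw [h0]
        constructor
        · rintro ⟨x, hx⟩
          induction x using Submodule.Quotient.induction_on with
          | _ x =>
            have h2 : (x : U) - y ∈ M :=
              (Submodule.Quotient.eq (M.submoduleOf A) (x := Submodule.inclusion inf_le_left x)).1 hx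
            have h3 : (y : U) = x - (x - y) := by abel
            rw [h3]
            exact B.sub_mem x.2.2 (hM h2).2
        · intro hy
          exact ⟨Submodule.Quotient.mk ⟨y.1, y.2, hy⟩, rfl⟩)

/-- For `M ⊆ A ∩ B`: the isomorphism `⋀ (B/A∩B) ⊗ ⋀ (A∩B/M) ≃ ⋀ (B/M)`. -/
noncomputable def wedgeSub' (A B M : Submodule k U) (hM : M ≤ A ⊓ B)
    (hf : FiniteDimensional k (SubQ B M)) :
    TopExt k (SubQ B A) ⊗[k] TopExt k (SubQ (A ⊓ B) M) ≃ₗ[k] TopExt k (SubQ B M) :=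
  (TensorProduct.congr (LinearEquiv.refl k _)
    (TopExt.congr (SubQ.congr (LinearEquiv.refl k U)
      (by rw [inf_comm]; exact Submodule.map_id _) (Submodule.map_id _)))).trans
    (wedgeSub B A M (inf_comm A B ▸ hM) hf)

/-- For `M ⊆ A ∩ B`: the canonical isomorphism from `(A|B)` to `(⋀ A/M)^* ⊗ ⋀ (B/M)`,
`a^* ⊗ b ↦ (a ∧ n)^* ⊗ (b ∧ n)` with `n` any basis of `⋀ (A∩B/M)`. -/
noncomputable def Rel.stab {A B : Submodule k U} (M : Submodule k U) (hM : M ≤ A ⊓ B)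
    (hA : FiniteDimensional k (SubQ A M)) (hB : FiniteDimensional k (SubQ B M)) (x : Rel A B) :
    TopExt k (SubQ A M) ≃ₗ[k] TopExt k (SubQ B M) :=
  (wedgeSub A B M hM hA).symm.trans
    ((TensorProduct.congr x (LinearEquiv.refl k _)).trans (wedgeSub' A B M hM hB))

theorem finrank_inf {A B : Submodule k U} (M : Submodule k U)
    (hA : FiniteDimensional k (SubQ A M)) :
    Module.finrank k (TopExt k (SubQ (A ⊓ B) M)) = Module.finrank k k := by
  have : FiniteDimensional k (SubQ (A ⊓ B) M) :=
    FiniteDimensional.of_injective _ (SubQ.incl_injective M (inf_le_left : A ⊓ B ≤ A))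
  rw [finrank_topExt, Module.finrank_self]

/-- The line `⋀ (A∩B/M)` has a trivialisation. -/
noncomputable def trivLine {A B : Submodule k U} (M : Submodule k U)
    (hA : FiniteDimensional k (SubQ A M)) : TopExt k (SubQ (A ⊓ B) M) ≃ₗ[k] k :=
  have : FiniteDimensional k (SubQ (A ⊓ B) M) :=
    FiniteDimensional.of_injective _ (SubQ.incl_injective M (inf_le_left : A ⊓ B ≤ A))
  LinearEquiv.ofFinrankEq _ _ (finrank_inf M hA)

/-- The inverse of `Rel.stab`: remove the common factor `⋀ (A∩B/M)`. A trivialisation of that line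
is used, on which the result does not depend. -/
noncomputable def Rel.destab {A B : Submodule k U} (M : Submodule k U) (hM : M ≤ A ⊓ B)
    (hA : FiniteDimensional k (SubQ A M)) (hB : FiniteDimensional k (SubQ B M))
    (y : TopExt k (SubQ A M) ≃ₗ[k] TopExt k (SubQ B M)) : Rel A B :=
  let tens (P : Submodule k U) (Q : Submodule k U) :
      TopExt k (SubQ P Q) ≃ₗ[k] TopExt k (SubQ P Q) ⊗[k] TopExt k (SubQ (A ⊓ B) M) :=
    (TensorProduct.rid k _).symm.trans 
      (TensorProduct.congr (LinearEquiv.refl k _) (trivLine M hA).symm)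
  (tens A B).trans ((wedgeSub A B M hM hA).trans
    (y.trans ((wedgeSub' A B M hM hB).symm.trans (tens B A).symm)))

/-- The contraction `(A|B) ⊗ (B|C) → (A|C)` on nonzero elements: pass to
`M = A ∩ B ∩ C`, contract `⋀ (B/M)` with its dual (i.e. compose the homomorphisms), and come back. -/
noncomputable def Rel.comp {A B C : Submodule k U}
    (hA : FiniteDimensional k (SubQ A (A ⊓ B ⊓ C))) (hB : FiniteDimensional k (SubQ B (A ⊓ B ⊓ C)))
    (hC : FiniteDimensional k (SubQ C (A ⊓ B ⊓ C))) (x : Rel A B) (y : Rel B C) : Rel A C :=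
  Rel.destab (A ⊓ B ⊓ C) (le_inf (inf_le_left.trans inf_le_left) inf_le_right) hA hC
    ((Rel.stab (A ⊓ B ⊓ C) inf_le_left hA hB x).trans
      (Rel.stab (A ⊓ B ⊓ C) (le_inf (inf_le_left.trans inf_le_right) inf_le_right) hB hC y))

end Rel

/-! ### Lattices in `F^r`, where `F = k((ϖ))` -/

section Lattice

universe u

/-- The valuation `v` on `F^×`. -/
noncomputable def val {k : Type u} [Field k] (f : k⸨X⸩ˣ) : ℤ := HahnSeries.order (f : k⸨X⸩)

variable (k : Type u) [Field k] (r : ℕ)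

/-- The `k`-subspace `ϖ^m O^r` of `F^r`, where `O = k[[ϖ]]`. -/
def pLat (m : ℤ) : Submodule k (Fin r → k⸨X⸩) where
  carrier := {x | ∀ i, ∀ n < m, HahnSeries.coeff (x i) n = 0}
  add_mem' hx hy i n hn := by simp [hx i n hn, hy i n hn]
  zero_mem' i n hn := by simp
  smul_mem' c x hx i n hn := by simp [hx i n hn]

/-- The standard lattice `O^r`. -/
abbrev stdLat : Submodule k (Fin r → k⸨X⸩) := pLat k r 0

variable {k r}

theorem mul_smul_series (c : k) (x y : k⸨X⸩) : x * (c • y) = c • (x * y) := by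
  rw [← HahnSeries.C_mul_eq_smul, ← HahnSeries.C_mul_eq_smul, mul_left_comm]

/-- The action of `g ∈ GL_r(F)` on `F^r`, as a `k`-linear automorphism. -/
noncomputable def glEquiv (g : GL (Fin r) k⸨X⸩) : (Fin r → k⸨X⸩) ≃ₗ[k] (Fin r → k⸨X⸩) where
  toFun x := Matrix.mulVec g.val x
  map_add' x y := Matrix.mulVec_add _ x y
  map_smul' c x := by
    funext i
    simp only [Matrix.mulVec, dotProduct, Pi.smul_apply, RingHom.id_apply, mul_smul_series,
      Finset.smul_sum]
  invFun x := Matrix.mulVec g⁻¹.val x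
  left_inv x := by beta_reduce; rw [Matrix.mulVec_mulVec, Units.inv_mul, Matrix.one_mulVec]
  right_inv x := by beta_reduce; rw [Matrix.mulVec_mulVec, Units.mul_inv, Matrix.one_mulVec]

/-- The subspace `g A`. -/
noncomputable def act (g : GL (Fin r) k⸨X⸩) (A : Submodule k (Fin r → k⸨X⸩)) :
    Submodule k (Fin r → k⸨X⸩) := A.map (glEquiv g).toLinearMap

theorem act_mul (g h : GL (Fin r) k⸨X⸩) (A : Submodule k (Fin r → k⸨X⸩)) :
    (act h A).map (glEquiv g).toLinearMap = act (g * h) A := by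
  have h1 : (glEquiv g).toLinearMap ∘ₗ (glEquiv h).toLinearMap = (glEquiv (g * h)).toLinearMap :=
    LinearMap.ext fun x => Matrix.mulVec_mulVec x g.val h.val
  rw [act, act, ← Submodule.map_comp, h1]

theorem act_one (A : Submodule k (Fin r → k⸨X⸩)) : act 1 A = A := by
  have : (glEquiv (1 : GL (Fin r) k⸨X⸩)).toLinearMap = LinearMap.id :=
    LinearMap.ext fun x => Matrix.one_mulVec x
  rw [act, this, Submodule.map_id]

theorem act_std_le (g : GL (Fin r) k⸨X⸩) : ∃ N : ℕ, act g (stdLat k r) ≤ pLat k r (-N) := by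
  have hb : ∃ N : ℕ, ∀ i j, -(N : ℤ) ≤ HahnSeries.order (g.val i j) := by
    refine ⟨Finset.univ.sup fun i => Finset.univ.sup fun j =>
      (HahnSeries.order (g.val i j)).natAbs, fun i j => ?_⟩
    have h1 : (HahnSeries.order (g.val i j)).natAbs ≤ Finset.univ.sup fun j =>
      (HahnSeries.order (g.val i j)).natAbs :=
      Finset.le_sup (f := fun j => (HahnSeries.order (g.val i j)).natAbs) (Finset.mem_univ j)
    have h2 := Finset.le_sup (f := fun i => Finset.univ.sup fun j =>
      (HahnSeries.order (g.val i j)).natAbs) (Finset.mem_univ i)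
    omega
  obtain ⟨N, hN⟩ := hb
  refine ⟨N, ?_⟩
  intro y hy i n hn
  obtain ⟨x, hx, rfl⟩ := Submodule.mem_map.1 hy
  change HahnSeries.coeff (∑ j, g.val i j * x j) n = 0
  rw [HahnSeries.coeff_sum]
  refine Finset.sum_eq_zero fun j _ => ?_
  rw [HahnSeries.coeff_mul]
  refine Finset.sum_eq_zero fun ab hab => ?_
  rw [Finset.mem_antidiagonal] at hab
  obtain ⟨ha, hb, hab⟩ := hab
  have h1 := HahnSeries.order_le_of_coeff_ne_zero ha
  have h2 := hN i j
  rw [hx j ab.2 (by omega), mul_zero]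

theorem finite_subQ_pLat (g : GL (Fin r) k⸨X⸩) (m : ℤ) :
    FiniteDimensional k (SubQ (act g (stdLat k r)) (pLat k r m)) := by
  obtain ⟨N, hN⟩ := act_std_le g
  let c : (Fin r → k⸨X⸩) →ₗ[k] (Fin r → Fin (m + N).toNat → k) :=
    { toFun := fun x i j => HahnSeries.coeff (x i) (-N + j)
      map_add' := fun x y => by ext; simp
      map_smul' := fun a x => by ext; simp }
  have hc : (pLat k r m).submoduleOf (act g (stdLat k r))
      = LinearMap.ker (c ∘ₗ (act g (stdLat k r)).subtype) := by
    ext ⟨x, hx⟩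
    rw [LinearMap.mem_ker]
    constructor
    · intro h
      funext i j
      have hj := j.2
      exact h i _ (by omega)
    · intro h i n hn
      by_cases h1 : n < -N
      · exact hN hx i n h1
      · have h2 := congrFun (congrFun h i) ⟨(n + N).toNat, by omega⟩
        have h3 : (-N + ((n + N).toNat : ℤ)) = n := by omega
        have h4 : HahnSeries.coeff (x i) (-N + ((n + N).toNat : ℤ)) = 0 := h2
        rwa [h3] at h4
  have hW : FiniteDimensional k (Fin r → Fin (m + N).toNat → k) := inferInstance
  have hR := FiniteDimensional.finiteDimensional_submodule
    (LinearMap.range (c ∘ₗ (act g (stdLat k r)).subtype))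
  exact Module.Finite.equiv
    ((Submodule.quotEquivOfEq _ _ hc).trans (LinearMap.quotKerEquivRange _)).symm

theorem finite_subQ_act (g h : GL (Fin r) k⸨X⸩) :
    FiniteDimensional k (SubQ (act g (stdLat k r)) (act h (stdLat k r))) := by
  have h1 := finite_subQ_pLat (h⁻¹ * g) (0 : ℤ)
  have h2 : (act (h⁻¹ * g) (stdLat k r)).map (glEquiv h).toLinearMap = act g (stdLat k r) := by
    rw [act_mul, mul_inv_cancel_left]
  exact Module.Finite.equiv (SubQ.congr (glEquiv h) h2 rfl)

theorem finite_subQ_inf {U : Type u} [AddCommGroup U] [Module k U] {A B C : Submodule k U}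
    (hB : FiniteDimensional k (SubQ A B)) (hC : FiniteDimensional k (SubQ A C)) :
    FiniteDimensional k (SubQ A (B ⊓ C)) := by
  refine FiniteDimensional.of_injective
    ((SubQ.incl (le_refl A) (inf_le_left : B ⊓ C ≤ B)).prod
      (SubQ.incl (le_refl A) (inf_le_right : B ⊓ C ≤ C))) ?_
  rw [← LinearMap.ker_eq_bot, LinearMap.ker_eq_bot']
  intro x
  induction x using Submodule.Quotient.induction_on with
  | _ x =>
    intro hx
    have h1 := congrArg Prod.fst hx
    have h2 := congrArg Prod.snd hx
    exact (Submodule.Quotient.mk_eq_zero _).2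
      ⟨(Submodule.Quotient.mk_eq_zero (B.submoduleOf A) (x := x)).1 h1,
        (Submodule.Quotient.mk_eq_zero (C.submoduleOf A) (x := x)).1 h2⟩

/-- `Rel.comp` for three lattices `f O^r`, `g O^r`, `h O^r`. -/
noncomputable def Rel.compLat {A B C : Submodule k (Fin r → k⸨X⸩)}
    (hA : ∃ f, A = act f (stdLat k r)) (hB : ∃ g, B = act g (stdLat k r))
    (hC : ∃ h, C = act h (stdLat k r)) (x : Rel A B) (y : Rel B C) : Rel A C :=
  have key : ∀ {P Q : Submodule k (Fin r → k⸨X⸩)}, (∃ f, P = act f (stdLat k r)) →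
      (∃ g, Q = act g (stdLat k r)) → FiniteDimensional k (SubQ P Q) := by
    rintro _ _ ⟨f, rfl⟩ ⟨g, rfl⟩
    exact finite_subQ_act f g
  Rel.comp (finite_subQ_inf (finite_subQ_inf (key hA hA) (key hA hB)) (key hA hC))
    (finite_subQ_inf (finite_subQ_inf (key hB hA) (key hB hB)) (key hB hC))
    (finite_subQ_inf (finite_subQ_inf (key hC hA) (key hC hB)) (key hC hC)) x y

end Lattice

/-! ### Matrices -/

section Matrices

universe u

variable {R : Type u} [Field R] {r : ℕ}

/-- The diagonal matrix `diag(t_1, …, t_r)`. -/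
def diagGL (t : Fin r → Rˣ) : GL (Fin r) R where
  val := Matrix.diagonal fun i => (t i : R)
  inv := Matrix.diagonal fun i => ((t i)⁻¹ : Rˣ)
  val_inv := by simp [Matrix.diagonal_mul_diagonal]
  inv_val := by simp [Matrix.diagonal_mul_diagonal]

/-- The permutation matrix sending `e_i` to `e_{w(i)}`. -/
def permGL (w : Equiv.Perm (Fin r)) : GL (Fin r) R where
  val := Matrix.of fun a b => if a = w b then 1 else 0
  inv := Matrix.of fun a b => if b = w a then 1 else 0
  val_inv := by
    ext a b
    simp only [Matrix.mul_apply, Matrix.of_apply, Matrix.one_apply, ite_mul, one_mul, zero_mul]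
    rw [Finset.sum_eq_single (w.symm a)] <;> aesop
  inv_val := by
    ext a b
    simp only [Matrix.mul_apply, Matrix.of_apply, Matrix.one_apply, ite_mul, one_mul, zero_mul]
    rw [Finset.sum_eq_single (w a)] <;> aesop

/-- The group `N_r` of upper triangular unipotent matrices. -/
def IsUnip (n : GL (Fin r) R) : Prop :=
  (∀ i, n.val i i = 1) ∧ ∀ i j, j < i → n.val i j = 0

/-- `m = B(g)`: the `T_r W_r`-part of `g` in the Bruhat decomposition `g = n m n'`. -/
def IsBruhat (g m : GL (Fin r) R) : Prop :=
  (∃ t w, m = diagGL t * permGL w) ∧ ∃ n n', IsUnip n ∧ IsUnip n' ∧ g = n * m * n'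

/-- `det g`, seen as an element of `GL_1`. -/
def detGL1 (g : GL (Fin r) R) : GL (Fin 1) R := diagGL fun _ => Matrix.GeneralLinearGroup.det g

theorem diagGL_mul (t t' : Fin r → Rˣ) : diagGL (fun i => t i * t' i) = diagGL t * diagGL t' := by
  apply Units.ext
  simp [diagGL, Matrix.diagonal_mul_diagonal]

theorem detGL1_mul (g h : GL (Fin r) R) : detGL1 (g * h) = detGL1 g * detGL1 h := by
  rw [detGL1, map_mul]
  exact diagGL_mul _ _

theorem detGL1_one : detGL1 (1 : GL (Fin r) R) = 1 := by
  apply Units.ext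
  simp [detGL1, diagGL]

end Matrices

/-! ### The Arbarello–De Concini–Kac extension `G̃'_r` -/

section ACK

universe u

/-- The elements `(g, v)` of `G̃'_r`: `g ∈ GL_r(F)` and `v` a nonzero element of the line
`D_g = (O^r | g O^r)`. -/
structure ACK (k : Type u) [Field k] (r : ℕ) where
  g : GL (Fin r) k⸨X⸩
  v : Rel (stdLat k r) (act g (stdLat k r))

variable {k : Type u} [Field k] {r : ℕ}

/-- The multiplication of `G̃'_r`, through `D_g ⊗ D_{g'} → (O^r|gO^r) ⊗ (gO^r|gg'O^r) → D_{gg'}`. -/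
noncomputable instance : Mul (ACK k r) where
  mul a b :=
    { g := a.g * b.g
      v := Rel.compLat ⟨1, (act_one _).symm⟩ ⟨a.g, rfl⟩ ⟨a.g * b.g, rfl⟩ a.v
        (Rel.map (glEquiv a.g) rfl (act_mul a.g b.g (stdLat k r)) b.v) }

/-- Multiplication of an element of `D_g` by a nonzero scalar. -/
noncomputable def ACK.smul (z : kˣ) (a : ACK k r) : ACK k r := ⟨a.g, Rel.smul z a.v⟩

/-- The neutral element: `g = 1` and the canonical basis of `(O^r|O^r) = k`. -/
noncomputable def ACK.one (k : Type u) [Field k] (r : ℕ) : ACK k r :=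
  ⟨1, Rel.cast (act_one (stdLat k r)).symm (LinearEquiv.refl k _)⟩

/-- The embedding `k^* → G̃'_r`. -/
noncomputable def ACK.incl (k : Type u) [Field k] (r : ℕ) (z : kˣ) : ACK k r :=
  ACK.smul z (ACK.one k r)

theorem Rel.map_scalar {U : Type u} [AddCommGroup U] [Module k U] (e : U ≃ₗ[k] U)
    {A A' B B' : Submodule k U} (hA : A.map e.toLinearMap = A') (hB : B.map e.toLinearMap = B')
    (z : kˣ) (x : Rel A B) : Rel.map e hA hB (Rel.smul z x) = Rel.smul z (Rel.map e hA hB x) := by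
  ext1 t
  simp only [Rel.map, Rel.smul, LinearEquiv.trans_apply]
  exact map_smul _ (z : k) _

theorem Rel.stab_scalar {U : Type u} [AddCommGroup U] [Module k U] {A B : Submodule k U}
    (M : Submodule k U) (hM : M ≤ A ⊓ B)
    (hA : FiniteDimensional k (SubQ A M)) (hB : FiniteDimensional k (SubQ B M)) (z : kˣ)
    (x : Rel A B) :
    Rel.stab M hM hA hB (Rel.smul z x)
      = (Rel.stab M hM hA hB x).trans (LinearEquiv.smulOfUnit z) := by
  have h : (TensorProduct.congr (Rel.smul z x) (LinearEquiv.refl k (TopExt k (SubQ (A ⊓ B) M))))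
      = (TensorProduct.congr x (LinearEquiv.refl k _)).trans (LinearEquiv.smulOfUnit z) := by
    apply LinearEquiv.toLinearMap_injective
    exact TensorProduct.ext' fun a b => rfl
  ext1 t
  simp only [Rel.stab, h, LinearEquiv.trans_apply]
  exact map_smul _ (z : k) _

theorem Rel.destab_scalar {U : Type u} [AddCommGroup U] [Module k U] {A B : Submodule k U}
    (M : Submodule k U) (hM : M ≤ A ⊓ B)
    (hA : FiniteDimensional k (SubQ A M)) (hB : FiniteDimensional k (SubQ B M)) (z : kˣ)
    (y : TopExt k (SubQ A M) ≃ₗ[k] TopExt k (SubQ B M)) :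
    Rel.destab M hM hA hB (y.trans (LinearEquiv.smulOfUnit z))
      = Rel.smul z (Rel.destab M hM hA hB y) := by
  ext1 t
  simp only [Rel.destab, Rel.smul, LinearEquiv.trans_apply]
  refine (congrArg _ (map_smul (wedgeSub' A B M hM hB).symm (z : k) _)).trans ?_
  exact map_smul _ (z : k) _

theorem Rel.comp_scalar {U : Type u} [AddCommGroup U] [Module k U] {A B C : Submodule k U}
    (hA : FiniteDimensional k (SubQ A (A ⊓ B ⊓ C))) (hB : FiniteDimensional k (SubQ B (A ⊓ B ⊓ C)))
    (hC : FiniteDimensional k (SubQ C (A ⊓ B ⊓ C))) (z w : kˣ) (x : Rel A B) (y : Rel B C) :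
    Rel.comp hA hB hC (Rel.smul z x) (Rel.smul w y)
      = Rel.smul (z * w) (Rel.comp hA hB hC x y) := by
  rw [Rel.comp, Rel.stab_scalar, Rel.stab_scalar, Rel.comp, ← Rel.destab_scalar]
  congr 1
  ext1 t
  simp only [LinearEquiv.trans_apply]
  refine (congrArg _ (map_smul _ (z : k) _)).trans ?_
  refine (smul_smul (w : k) (z : k) _).trans ?_
  rw [mul_comm]
  rfl

theorem ACK.smul_mul_smul (z w : kˣ) (a b : ACK k r) :
    ACK.smul z a * ACK.smul w b = ACK.smul (z * w) (a * b) := by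
  change ACK.mk _ _ = ACK.mk _ _
  congr 1
  change Rel.compLat _ _ _ (Rel.smul z a.v) (Rel.map _ _ _ (Rel.smul w b.v)) = _
  refine (congrArg (Rel.compLat _ _ _ (Rel.smul z a.v)) ?_).trans
    (Rel.comp_scalar _ _ _ z w a.v (Rel.map (glEquiv a.g) rfl (act_mul a.g b.g (stdLat k r)) b.v))
  exact Rel.map_scalar (glEquiv a.g) rfl (act_mul a.g b.g (stdLat k r)) w b.v

/-! ### The geometric extension `G̃_{r,geo} = det^* G̃'_1 - G̃'_r` -/

/-- The fibre product of `det^* G̃'_1` and `G̃'_r` over `GL_r(F)`: pairs `(a, b)` with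
`a ∈ D_{det g} - 0` and `b ∈ D_g - 0`. -/
abbrev GeoPre (k : Type u) [Field k] (r : ℕ) : Type _ :=
  {p : ACK k 1 × ACK k r // p.1.g = detGL1 p.2.g}

/-- `(a, b)` and `(a', b')` define the same element `a ⊗ b⁻¹ = a' ⊗ b'⁻¹` of
`Δ_g = D_{det g} ⊗ D_g^{⊗ -1}` if and only if `(a', b') = (z a, z b)` for some `z ∈ k^*`. -/
def geoRel (p q : GeoPre k r) : Prop :=
  ∃ z : kˣ, q.1.1 = ACK.smul z p.1.1 ∧ q.1.2 = ACK.smul z p.1.2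

/-- The geometric extension `G̃_{r,geo}`, the Baer difference of `det^* G̃'_1` and `G̃'_r`. Its
elements are the `(g, a ⊗ b⁻¹)` with `g ∈ GL_r(F)`, and `a ⊗ b⁻¹` a nonzero element of
`Δ_g = D_{det g} ⊗ D_g^{⊗ -1}`. -/
def Geo (k : Type u) [Field k] (r : ℕ) : Type u := Quot (geoRel (k := k) (r := r))

/-- The element `a ⊗ b⁻¹`. -/
def Geo.mk (p : GeoPre k r) : Geo k r := Quot.mk _ p

/-- The multiplication `(a, b)(a', b') = (aa', bb')` on the fibre product. -/
noncomputable def GeoPre.mul (p q : GeoPre k r) : GeoPre k r :=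
  ⟨(p.1.1 * q.1.1, p.1.2 * q.1.2), by
    change p.1.1.g * q.1.1.g = detGL1 (p.1.2.g * q.1.2.g)
    rw [p.2, q.2, detGL1_mul]⟩

/-- The multiplication `(a ⊗ b⁻¹)(a' ⊗ b'⁻¹) = aa' ⊗ (bb')⁻¹`. -/
noncomputable instance : Mul (Geo k r) where
  mul x y := Quot.map₂ (r := geoRel) (s := geoRel) (t := geoRel) GeoPre.mul
    (by
      rintro p q q' ⟨z, h1, h2⟩
      have h := fun n => ACK.smul_mul_smul (r := n) (1 : kˣ) z
      have h' : ∀ n (a : ACK k n), ACK.smul 1 a = a := fun n a => by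
        cases a
        simp only [ACK.smul, ACK.mk.injEq, true_and, heq_eq_eq]
        ext1 t
        exact one_smul k _
      simp only [h', one_mul] at h
      exact ⟨z, by simp only [GeoPre.mul, h1, h], by simp only [GeoPre.mul, h2, h]⟩)
    (by
      rintro p p' q ⟨z, h1, h2⟩
      have h := fun n (a b : ACK k n) => ACK.smul_mul_smul z (1 : kˣ) a b
      have h' : ∀ n (a : ACK k n), ACK.smul 1 a = a := fun n a => by
        cases a
        simp only [ACK.smul, ACK.mk.injEq, true_and, heq_eq_eq]
        ext1 t
        exact one_smul k _
      simp only [h', mul_one] at h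
      exact ⟨z, by simp only [GeoPre.mul, h1, h], by simp only [GeoPre.mul, h2, h]⟩) x y

/-- The projection `G̃_{r,geo} → GL_r(F)`. -/
def Geo.proj (x : Geo k r) : GL (Fin r) k⸨X⸩ :=
  Quot.lift (fun p : GeoPre k r => p.1.2.g) (by rintro p q ⟨z, -, h⟩; simp [h, ACK.smul]) x

/-- The embedding `k^* → G̃_{r,geo}`, `z ↦ z` in `Δ_1 = k`. -/
noncomputable def Geo.incl (k : Type u) [Field k] (r : ℕ) (z : kˣ) : Geo k r :=
  Geo.mk ⟨(ACK.incl k 1 z, ACK.one k r), detGL1_one.symm⟩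

end ACK

/-! ### The section `s_geo` -/

section Section

universe u

variable {k : Type u} [Field k] {r : ℕ}

/-- `x = (n, 𝔡_n)` for the splitting of `G̃'_r` over `N_r`: for a lattice `L` with `nL = L`, `𝔡_n`
corresponds to `1` under `D_n = (O^r|L) ⊗ (L|nL) ⊗ (nL|nO^r) = (L|nL) = k`, i.e.
`𝔡_n = v ⊗ n(v⁻¹)` for any nonzero `v ∈ (O^r|L)`. -/
def IsUnipLift (n : GL (Fin r) k⸨X⸩) (x : ACK k r) : Prop :=
  ∃ hx : x.g = n, ∃ h : GL (Fin r) k⸨X⸩,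
    ∃ hL : (act h (stdLat k r)).map (glEquiv n).toLinearMap = act h (stdLat k r),
    ∃ v : Rel (stdLat k r) (act h (stdLat k r)),
      x.v = Rel.compLat ⟨1, (act_one _).symm⟩ ⟨h, rfl⟩ ⟨x.g, rfl⟩ v
        (Rel.map (glEquiv n) hL (by rw [hx]; rfl) v.symm)

/-- The vectors `ϖ^j e_i`, `i = 1, …, r`, `v_i ≤ j < m`, ordered lexicographically in `(i, j)`. -/
noncomputable def monoList (k : Type u) [Field k] {r : ℕ} (v : Fin r → ℤ) (m : ℤ) :
    List (Fin r → k⸨X⸩) :=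
  (List.finRange r).flatMap fun i =>
    (List.range (m - v i).toNat).map fun j : ℕ =>
      Pi.single i (HahnSeries.single (v i + (j : ℤ)) (1 : k))

open Classical in
/-- The class in `A / A ∩ M` of an element of `A` (and `0` outside of `A`). -/
noncomputable def toSubQ {U : Type u} [AddCommGroup U] [Module k U] (A M : Submodule k U) (x : U) :
    SubQ A M :=
  if h : x ∈ A then Submodule.Quotient.mk ⟨x, h⟩ else 0

/-- The exterior product, in the exterior algebra of `A / A ∩ M`, of a list of elements of `A`. -/
noncomputable def wedgeList {U : Type u} [AddCommGroup U] [Module k U] (A M : Submodule k U)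
    (l : List U) : ExteriorAlgebra k (SubQ A M) :=
  (l.map fun x => ExteriorAlgebra.ι k (toSubQ A M x)).prod

/-- `x = (tw, 𝔡_{tw})`, where `𝔡_{tw} = (⋀_i ⋀_{0 ≤ j < m} ϖ^j e_i)^* ⊗ ⋀_i ⋀_{v(t_i) ≤ j < m} ϖ^j e_i`
in `D_{tw} = (⋀ O^r/ϖ^m O^r)^* ⊗ ⋀ (tw O^r/ϖ^m O^r)`, for an even `m` with
`ϖ^m O^r ⊆ O^r ∩ tw O^r`. -/
def IsTorusLift (t : Fin r → k⸨X⸩ˣ) (w : Equiv.Perm (Fin r)) (x : ACK k r) : Prop :=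
  x.g = diagGL t * permGL w ∧
  ∃ m : ℕ, Even m ∧ ∃ hM : pLat k r m ≤ stdLat k r ⊓ act x.g (stdLat k r),
    ∃ hA : FiniteDimensional k (SubQ (stdLat k r) (pLat k r m)),
    ∃ hB : FiniteDimensional k (SubQ (act x.g (stdLat k r)) (pLat k r m)),
    ∀ X : TopExt k (SubQ (stdLat k r) (pLat k r m)),
      (X : ExteriorAlgebra k _) = wedgeList (stdLat k r) (pLat k r m) (monoList k (fun _ => 0) m) →
      (Rel.stab (pLat k r m) hM hA hB x.v X : ExteriorAlgebra k _)
        = wedgeList (act x.g (stdLat k r)) (pLat k r m) (monoList k (fun i => val (t i)) m)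

/-- `x = (tw, δ_{tw})`. Here `δ_{tw} : D_{tw} = D_t → D_{det t} = D_{det tw}` is the composite of
`D_t = ⊗ D_{t_i}`, of the multiplication of `𝔡_{t_r}, …, 𝔡_{t_1}` in this order, and of the sign
`(-1)^{∑ (r-i) v(t_i)}`; it maps `𝔡_{tw}` to this sign times the product `𝔡_{t_r} ⋯ 𝔡_{t_1}`. -/
def IsGeoTorusLift (t : Fin r → k⸨X⸩ˣ) (w : Equiv.Perm (Fin r)) (x : Geo k r) : Prop :=
  ∃ p : GeoPre k r, x = Geo.mk p ∧ IsTorusLift t w p.1.2 ∧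
    ∃ d : Fin r → ACK k 1, (∀ i, IsTorusLift (fun _ => t i) 1 (d i)) ∧
      let D : ACK k 1 := (List.ofFn d).foldr (fun a acc => acc * a) (ACK.one k 1)
      ∃ h : act D.g (stdLat k 1) = act p.1.1.g (stdLat k 1),
        p.1.1.v = Rel.cast h
          (Rel.smul ((-1 : kˣ) ^ (∑ i : Fin r, ((r : ℤ) - 1 - (i : ℤ)) * val (t i))) D.v)

/-- `x = (n, δ_n)` with `δ_n = 1 ⊗ 𝔡_n⁻¹` in `Δ_n = D_1 ⊗ D_n^{⊗ -1}`, for `n ∈ N_r`. -/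
def IsGeoUnipLift (n : GL (Fin r) k⸨X⸩) (x : Geo k r) : Prop :=
  ∃ p : GeoPre k r, x = Geo.mk p ∧ p.1.1 = ACK.one k 1 ∧ IsUnipLift n p.1.2

/-- `x = (g, δ_g)`, where `δ_g = δ_n δ_{tw} δ_{n'}` for a Bruhat decomposition `g = n (tw) n'`. -/
def IsGeoLift (g : GL (Fin r) k⸨X⸩) (x : Geo k r) : Prop :=
  ∃ n n' t w x₁ x₀ x₂, IsUnip n ∧ IsUnip n' ∧ g = n * (diagGL t * permGL w) * n' ∧
    IsGeoUnipLift n x₁ ∧ IsGeoTorusLift t w x₀ ∧ IsGeoUnipLift n' x₂ ∧ x = x₁ * x₀ * x₂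

/-- The section `s_geo(g) = (g, δ_g)` of `G̃_{r,geo} → GL_r(F)`. -/
noncomputable def sGeo (g : GL (Fin r) k⸨X⸩) : Geo k r :=
  @Classical.epsilon _ ⟨Geo.incl k r 1⟩ (IsGeoLift g)

end Section

/-! ### Symbols and the Kazhdan–Patterson cocycle -/

section Cocycle

universe u

variable {k : Type u} [Field k]

theorem tame_aux (f : k⸨X⸩ˣ) : HahnSeries.leadingCoeff (f : k⸨X⸩) ≠ 0 :=
  HahnSeries.leadingCoeff_ne_zero.2 f.ne_zero

/-- `(f / ϖ^{v(f)})(0)`. -/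
noncomputable def lc (f : k⸨X⸩ˣ) : kˣ := Units.mk0 _ (tame_aux f)

/-- The tame symbol `{f, g} = (-1)^{v(f)v(g)} (f^{v(g)} / g^{v(f)})(0)`. -/
noncomputable def tame (f g : k⸨X⸩ˣ) : kˣ :=
  (-1) ^ (val f * val g) * (lc f ^ val g / lc g ^ val f)

open Classical in
/-- The quadratic Hilbert symbol: `1` if `z² = f x² + g y²` has a nontrivial solution in `F`, and
`-1` otherwise. -/
noncomputable def hilbert (f g : k⸨X⸩ˣ) : ℤˣ :=
  if ∃ x y z : k⸨X⸩, (x ≠ 0 ∨ y ≠ 0 ∨ z ≠ 0) ∧ z ^ 2 = (f : k⸨X⸩) * x ^ 2 + (g : k⸨X⸩) * y ^ 2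
  then 1 else -1

/-- The Kazhdan–Patterson 2-cocycle `χ` of `GL_r(F)` with values in `A`, attached to a symbol
`{·,·} : F^× × F^× → A`. -/
structure IsKPCocycle {R : Type u} [Field R] {r : ℕ} {A : Type*} [CommGroup A] (sym : Rˣ → Rˣ → A)
    (χ : GL (Fin r) R → GL (Fin r) R → A) : Prop where
  cocycle : ∀ g g' g'', χ g' g'' * (χ (g * g') g'')⁻¹ * χ g (g' * g'') * (χ g g')⁻¹ = 1
  torus_torus : ∀ t t', χ (diagGL t) (diagGL t')
    = ∏ i : Fin r, ∏ j ∈ Finset.univ.filter (fun j => i < j), sym (t i) (t' j)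
  weyl_weyl : ∀ w w', χ (permGL w) (permGL w') = 1
  torus_weyl : ∀ t w, χ (diagGL t) (permGL w) = 1
  refl_torus : ∀ (l : ℕ) (hl : l + 1 < r) (t : Fin r → Rˣ),
    χ (permGL (Equiv.swap ⟨l, by omega⟩ ⟨l + 1, hl⟩)) (diagGL t)
      = (sym (t ⟨l, by omega⟩) (t ⟨l + 1, hl⟩))⁻¹
        * sym (-1) (t ⟨l, by omega⟩ / t ⟨l + 1, hl⟩) * sym (-1) (∏ i, t i)
  unip : ∀ n n', IsUnip n → IsUnip n' → ∀ g g', χ (n * g) (g' * n') = χ g g'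
  torus_bruhat : ∀ t g m, IsBruhat g m → χ (diagGL t) g = χ (diagGL t) m
  refl_bruhat : ∀ (l : ℕ) (hl : l + 1 < r) (g m m' : GL (Fin r) R), IsBruhat g m →
    IsBruhat (permGL (Equiv.swap ⟨l, by omega⟩ ⟨l + 1, hl⟩) * g) m' →
    χ (permGL (Equiv.swap ⟨l, by omega⟩ ⟨l + 1, hl⟩)) g = χ (m' * m⁻¹) m

end Cocycle

/-! ### Central extensions -/

section Extensions

variable {A E G : Type*} [CommGroup A] [Group G] [Mul E]

/-- `1 → A → E → G → 1` is a central extension; in particular the multiplication of `E` is a group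
law. -/
structure IsCentralExtension (ι : A → E) (π : E → G) : Prop where
  assoc : ∀ x y z : E, x * y * z = x * (y * z)
  one_mul : ∀ x, ι 1 * x = x
  inv_mul : ∀ x, ∃ y, y * x = ι 1
  incl_mul : ∀ a b, ι (a * b) = ι a * ι b
  incl_injective : Function.Injective ι
  central : ∀ a x, ι a * x = x * ι a
  proj_mul : ∀ x y, π (x * y) = π x * π y
  proj_surjective : Function.Surjective π
  exact : ∀ x, π x = 1 ↔ ∃ a, x = ι a

/-- `1 → A' → E' → G → 1` is the pushout of `1 → A → E → G → 1` by `f : A → A'`, i.e. `E'` is the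
quotient of `E × A'` by the relations `(ι(z) x, a) ∼ (x, f(z) a)`. -/
def IsPushout {A' E' : Type*} [CommGroup A'] [Mul E'] (f : A →* A') (ι : A → E) (π : E → G)
    (ι' : A' → E') (π' : E' → G) : Prop :=
  ∃ P : E × A' →ₙ* E', Function.Surjective P ∧
    (∀ x y a b, P (x, a) = P (y, b) ↔ ∃ z, y = ι z * x ∧ a = f z * b) ∧
    (∀ a, P (ι 1, a) = ι' a) ∧ ∀ x a, π' (P (x, a)) = π x

/-- The product `G × A` with the law `(g, z)(g', z') = (gg', zz'χ(g, g'))`. -/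
@[ext]
structure Twisted (χ : G → G → A) where
  g : G
  z : A

instance (χ : G → G → A) : Mul (Twisted χ) where
  mul x y := ⟨x.g * y.g, x.z * y.z * χ x.g y.g⟩

/-- The embedding `z ↦ (1, z)`. -/
def Twisted.incl (χ : G → G → A) (z : A) : Twisted χ := ⟨1, z⟩

end Extensions

end KPGeo

/-! All identities in determinant lines become identities between scalars. Once frames of A/M and
B/M are chosen for some M ⊂ A ∩ B, an element of (A|B) is its coefficient in these frames
(`Rel.Sends`). Transport by g keeps the coefficient, inversion inverts it, and contraction
multiplies coefficients when the middle frames agree. Because the quotient factor stands first,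
shrinking M appends the same vectors at the right end of both frames and costs no sign. This gives
the group law of the determinant extension, and commutators in it become determinants of explicit
monomial bases.

The section is then understood on three kinds of elements.

Unipotent elements have order a power of p = char k, while k^* has no p-torsion, so a unipotent
element has at most one lift of p-power order. The prescribed lift v ⊗ n(v⁻¹) is conjugate to the
canonical lift of an element of GL_r(O), hence has p-power order. Independence of choices,
multiplicativity on N_r and compatibility with conjugation all follow from this uniqueness
(`isGeoUnipLift_iff`, `unipLift_mul`, `conj_unipLift`).

On the torus, units contribute powers of leading coefficients and powers of the uniformizer
contribute signs from reordering monomials. In the Baer difference the diagonal terms cancel against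
those of the determinant, and the normalising scalar `torCoeff` leaves the inverse tame symbol over
pairs i < j (`torGeo_mul`). Permutation matrices lift through the splitting over GL_r(O), and a
simple reflection commutes with the torus up to an explicit scalar (`weylGeo_swap_mul_torGeo`).

The rank one relation between a simple reflection and its root subgroup holds in GL_r(O) by the
splitting, and for every parameter after multiplication by torus elements
(`weylGeo_swap_mul_unipLift`). With the Bruhat decomposition these facts give well-definedness of
the section and all the Kazhdan–Patterson properties (`IsGeoLift.unique`, `isKPCocycle_of_sGeo`).

Uniqueness is formal: the quotient of two such cocycles belongs to the trivial symbol, and it is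
trivial because torus, unipotent group and simple reflections generate GL_r(F)
(`IsKPCocycle.eq_one`). The cocycle of the tame symbol is the inverse of the geometric one, and that
of the Hilbert symbol is its image by ζ, since the Hilbert symbol is ζ of the tame symbol
(`hilbert_eq`). -/

namespace KPGeo

/-! ### Exterior products of lists of vectors, and frames of quotients -/

section Wedge

universe u

variable {k : Type u} [Field k]

theorem ι_mul_prod {V : Type u} [AddCommGroup V] [Module k V] (v : V) (l : List V) :
    ExteriorAlgebra.ι k v * (l.map (ExteriorAlgebra.ι k)).prod
      = (-1 : k) ^ l.length • ((l.map (ExteriorAlgebra.ι k)).prod * ExteriorAlgebra.ι k v) := by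
  induction l with
  | nil => simp
  | cons x l ih =>
    have h : ExteriorAlgebra.ι k v * ExteriorAlgebra.ι k x
        = - (ExteriorAlgebra.ι k x * ExteriorAlgebra.ι k v) :=
      eq_neg_of_add_eq_zero_left (ExteriorAlgebra.ι_add_mul_swap v x)
    rw [List.map_cons, List.prod_cons, ← mul_assoc, h, neg_mul, mul_assoc, ih, List.length_cons,
      pow_succ, mul_neg_one, neg_smul, mul_smul_comm, mul_assoc]

theorem prod_mul_prod_comm {V : Type u} [AddCommGroup V] [Module k V] (l l' : List V) :
    (l.map (ExteriorAlgebra.ι k)).prod * (l'.map (ExteriorAlgebra.ι k)).prod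
      = (-1 : k) ^ (l.length * l'.length) •
        ((l'.map (ExteriorAlgebra.ι k)).prod * (l.map (ExteriorAlgebra.ι k)).prod) := by
  induction l with
  | nil => simp
  | cons x l ih =>
    rw [List.map_cons, List.prod_cons, mul_assoc, ih, mul_smul_comm, ← mul_assoc, ι_mul_prod,
      smul_mul_assoc, smul_smul, mul_assoc, List.length_cons, add_mul, one_mul, pow_add]

/-- A correction term `i v` can be moved past the other factors, up to sign, until it meets `ω`,
which kills it. Hence the choice of lifts is irrelevant in front of a top class of the subspace. -/
theorem prod_mul_congr {V V' : Type u} [AddCommGroup V] [Module k V] [AddCommGroup V'] [Module k V']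
    (i : V →ₗ[k] V') (ω : ExteriorAlgebra k V') (hω : ∀ v, ExteriorAlgebra.ι k (i v) * ω = 0)
    {l l' : List V'} (h : List.Forall₂ (fun x y => ∃ v, x = i v + y) l l') :
    (l.map (ExteriorAlgebra.ι k)).prod * ω = (l'.map (ExteriorAlgebra.ι k)).prod * ω := by
  induction h with
  | nil => rfl
  | @cons x y l l' hxy _ ih =>
    obtain ⟨v, rfl⟩ := hxy
    rw [List.map_cons, List.prod_cons, List.map_cons, List.prod_cons, mul_assoc, ih, map_add,
      add_mul, ← mul_assoc, ι_mul_prod, smul_mul_assoc, mul_assoc, hω, mul_zero, smul_zero,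
      zero_add, mul_assoc]

/-- The product lies in degree dim V + 1, where the exterior power vanishes. -/
theorem ι_mul_top {V : Type u} [AddCommGroup V] [Module k V] [FiniteDimensional k V]
    {y : ExteriorAlgebra k V} (hy : y ∈ TopExt k V) (v : V) : ExteriorAlgebra.ι k v * y = 0 := by
  have h1 : ExteriorAlgebra.ι k v * y ∈ ⋀[k]^(Module.finrank k V + 1) V := by
    change _ ∈ (LinearMap.range (ExteriorAlgebra.ι k : V →ₗ[k] _)) ^ (Module.finrank k V + 1)
    rw [pow_succ']
    exact Submodule.mul_mem_mul (LinearMap.mem_range_self _ v) hy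
  have h2 : Module.finrank k (⋀[k]^(Module.finrank k V + 1) V) = 0 := by
    rw [exteriorPower.finrank_eq, Nat.choose_succ_self]
  have h3 := Submodule.finrank_eq_zero.1 h2
  rw [h3] at h1
  exact h1

variable {U : Type u} [AddCommGroup U] [Module k U]

theorem toSubQ_of_mem {A : Submodule k U} (M : Submodule k U) {x : U} (h : x ∈ A) :
    toSubQ A M x = Submodule.Quotient.mk ⟨x, h⟩ := dif_pos h

theorem toSubQ_add {A : Submodule k U} (M : Submodule k U) {x y : U} (hx : x ∈ A) (hy : y ∈ A) :
    toSubQ A M (x + y) = toSubQ A M x + toSubQ A M y := by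
  rw [toSubQ_of_mem M hx, toSubQ_of_mem M hy, toSubQ_of_mem M (A.add_mem hx hy)]
  rfl

theorem toSubQ_smul {A : Submodule k U} (M : Submodule k U) (c : k) {x : U} (hx : x ∈ A) :
    toSubQ A M (c • x) = c • toSubQ A M x := by
  rw [toSubQ_of_mem M hx, toSubQ_of_mem M (A.smul_mem c hx)]
  rfl

theorem toSubQ_eq_zero {A M : Submodule k U} {x : U} (hx : x ∈ A) :
    toSubQ A M x = 0 ↔ x ∈ M := by
  rw [toSubQ_of_mem M hx, Submodule.Quotient.mk_eq_zero]
  rfl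

theorem exists_toSubQ {A M : Submodule k U} (x : SubQ A M) : ∃ y ∈ A, toSubQ A M y = x := by
  induction x using Submodule.Quotient.induction_on with
  | _ x => exact ⟨x, x.2, toSubQ_of_mem M x.2⟩

theorem wedgeList_eq (A M : Submodule k U) (l : List U) :
    wedgeList A M l = ((l.map (toSubQ A M)).map (ExteriorAlgebra.ι k)).prod := by
  rw [wedgeList, List.map_map]
  rfl

theorem wedgeList_append (A M : Submodule k U) (l l' : List U) :
    wedgeList A M (l ++ l') = wedgeList A M l * wedgeList A M l' := by
  simp [wedgeList]

theorem wedgeList_append_comm (A M : Submodule k U) (l l' : List U) :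
    wedgeList A M (l ++ l') = (-1 : k) ^ (l.length * l'.length) • wedgeList A M (l' ++ l) := by
  rw [wedgeList_append, wedgeList_append]
  simp only [wedgeList_eq]
  rw [prod_mul_prod_comm]
  simp

theorem wedgeList_mem (A M : Submodule k U) (l : List U) :
    wedgeList A M l ∈ ⋀[k]^l.length (SubQ A M) := by
  rw [wedgeList_eq]
  change _ ∈ (LinearMap.range (ExteriorAlgebra.ι k : _ →ₗ[k] _)) ^ l.length
  induction l with
  | nil => simp
  | cons x l ih =>
    rw [List.length_cons, pow_succ']
    exact Submodule.mul_mem_mul (LinearMap.mem_range_self _ _) ih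

theorem map_wedgeList {A M A' M' : Submodule k U} (f : SubQ A M →ₗ[k] SubQ A' M') (e : U → U)
    {l : List U} (h : ∀ x ∈ l, f (toSubQ A M x) = toSubQ A' M' (e x)) :
    ExteriorAlgebra.map f (wedgeList A M l) = wedgeList A' M' (l.map e) := by
  simp only [wedgeList, map_list_prod, List.map_map]
  congr 1
  refine List.map_congr_left fun x hx => ?_
  simp [h x hx]

theorem incl_toSubQ {A A' M M' : Submodule k U} (hA : A ≤ A') (hM : M ≤ M') {x : U} (hx : x ∈ A) :
    SubQ.incl hA hM (toSubQ A M x) = toSubQ A' M' x := by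
  rw [toSubQ_of_mem _ hx, toSubQ_of_mem _ (hA hx)]
  rfl

theorem congr_toSubQ (e : U ≃ₗ[k] U) {A A' M M' : Submodule k U}
    (hA : A.map e.toLinearMap = A') (hM : M.map e.toLinearMap = M') {x : U} (hx : x ∈ A) :
    SubQ.congr e hA hM (toSubQ A M x) = toSubQ A' M' (e x) := by
  have hx' : e x ∈ A' := hA ▸ Submodule.mem_map_of_mem hx
  rw [toSubQ_of_mem _ hx, toSubQ_of_mem _ hx']
  rfl

theorem topExt_congr_wedgeList (e : U ≃ₗ[k] U) {A A' M M' : Submodule k U}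
    (hA : A.map e.toLinearMap = A') (hM : M.map e.toLinearMap = M') {l : List U}
    (hl : ∀ x ∈ l, x ∈ A) {X : TopExt k (SubQ A M)} (hX : X.1 = wedgeList A M l) :
    (TopExt.congr (SubQ.congr e hA hM) X).1 = wedgeList A' M' (l.map e) := by
  change ExteriorAlgebra.map _ X.1 = _
  rw [hX]
  exact map_wedgeList _ e fun x hx => congr_toSubQ e hA hM (hl x hx)

/-- The auxiliary section and the given vectors of `l` lift the same classes of A/A∩B, so they
differ by vectors of A ∩ B, and these are killed by the top class of A∩B/M. After this the
isomorphism of a short exact sequence is concatenation of lists. -/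
theorem wedgeSub_apply {A B M : Submodule k U} (hM : M ≤ A ⊓ B)
    (hf : FiniteDimensional k (SubQ A M)) {X : TopExt k (SubQ A B)}
    {Y : TopExt k (SubQ (A ⊓ B) M)} {l l' : List U} (hl : ∀ x ∈ l, x ∈ A)
    (hl' : ∀ x ∈ l', x ∈ A ⊓ B) (hX : X.1 = wedgeList A B l)
    (hY : Y.1 = wedgeList (A ⊓ B) M l') :
    (wedgeSub A B M hM hf (X ⊗ₜ Y)).1 = wedgeList A M (l ++ l') := by
  have hV : FiniteDimensional k (SubQ (A ⊓ B) M) :=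
    FiniteDimensional.of_injective _ (SubQ.incl_injective M (inf_le_left : A ⊓ B ≤ A))
  have hp : Function.Surjective
      (SubQ.incl (le_refl A) (hM.trans inf_le_right) : SubQ A M →ₗ[k] SubQ A B) := by
    intro y
    induction y using Submodule.Quotient.induction_on with
    | _ y => exact ⟨Submodule.Quotient.mk y, rfl⟩
  have hs := (SubQ.incl (le_refl A) (hM.trans inf_le_right) :
    SubQ A M →ₗ[k] SubQ A B).exists_rightInverse_of_surjective (LinearMap.range_eq_top.2 hp)
  change ExteriorAlgebra.map (Classical.choose hs) X.1
    * ExteriorAlgebra.map (SubQ.incl inf_le_left le_rfl) Y.1 = _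
  have hsp := Classical.choose_spec hs
  set s := Classical.choose hs
  have hi : ExteriorAlgebra.map (SubQ.incl (inf_le_left : A ⊓ B ≤ A) (le_refl M)) Y.1
      = wedgeList A M l' := by
    rw [hY, map_wedgeList _ id fun x hx => incl_toSubQ _ _ (hl' x hx), List.map_id]
  rw [wedgeList_append, ← hi, hX]
  simp only [wedgeList_eq, map_list_prod, List.map_map]
  have h1 : (List.map (⇑(ExteriorAlgebra.map s) ∘ ⇑(ExteriorAlgebra.ι k) ∘ toSubQ A B) l)
      = ((l.map (s ∘ toSubQ A B)).map (ExteriorAlgebra.ι k)) := by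
    rw [List.map_map]
    exact List.map_congr_left fun x _ => by simp
  rw [h1, ← List.map_map (f := toSubQ A M)]
  refine prod_mul_congr (SubQ.incl (inf_le_left : A ⊓ B ≤ A) (le_refl M)) _ (fun v => ?_) ?_
  · rw [← ExteriorAlgebra.map_apply_ι, ← map_mul, ι_mul_top Y.2, map_zero]
  · rw [List.forall₂_map_left_iff, List.forall₂_map_right_iff, List.forall₂_same]
    intro x hx
    obtain ⟨y, hy, hxy⟩ := exists_toSubQ (s (toSubQ A B x))
    have h2 : toSubQ A B (y - x) = 0 := by
      rw [sub_eq_add_neg, ← neg_one_smul k x, toSubQ_add _ hy (A.smul_mem _ (hl x hx)),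
        toSubQ_smul _ _ (hl x hx), neg_one_smul, ← sub_eq_add_neg, sub_eq_zero,
        ← incl_toSubQ (le_refl A) (hM.trans inf_le_right) hy, hxy]
      exact DFunLike.congr_fun hsp _
    have h3 : y - x ∈ A ⊓ B :=
      ⟨A.sub_mem hy (hl x hx), (toSubQ_eq_zero (A.sub_mem hy (hl x hx))).1 h2⟩
    refine ⟨toSubQ (A ⊓ B) M (y - x), ?_⟩
    rw [incl_toSubQ _ _ h3, ← toSubQ_add _ h3.1 (hl x hx), sub_add_cancel]
    exact hxy.symm

theorem wedgeSub'_apply {A B M : Submodule k U} (hM : M ≤ A ⊓ B)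
    (hf : FiniteDimensional k (SubQ B M)) {X : TopExt k (SubQ B A)}
    {Y : TopExt k (SubQ (A ⊓ B) M)} {l l' : List U} (hl : ∀ x ∈ l, x ∈ B)
    (hl' : ∀ x ∈ l', x ∈ A ⊓ B) (hX : X.1 = wedgeList B A l)
    (hY : Y.1 = wedgeList (A ⊓ B) M l') :
    (wedgeSub' A B M hM hf (X ⊗ₜ Y)).1 = wedgeList B M (l ++ l') := by
  refine wedgeSub_apply (inf_comm A B ▸ hM) hf hl (fun x hx => inf_comm A B ▸ hl' x hx) hX ?_
  have := topExt_congr_wedgeList (LinearEquiv.refl k U) (A := A ⊓ B) (A' := B ⊓ A) (M := M)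
    (M' := M) (by rw [inf_comm]; exact Submodule.map_id _) (Submodule.map_id _) hl' hY
  exact this.trans (congrArg _ (List.map_id _))

/-- `l` is a list of vectors of `A` whose classes form a basis of `A / A ∩ M`. -/
structure IsFrame (A M : Submodule k U) (l : List U) : Prop where
  finite : FiniteDimensional k (SubQ A M)
  mem : ∀ x ∈ l, x ∈ A
  length : l.length = Module.finrank k (SubQ A M)
  ne_zero : wedgeList A M l ≠ 0

namespace IsFrame

variable {A B M : Submodule k U} {l l' : List U}

/-- The exterior product of a frame. -/
noncomputable def vol (h : IsFrame A M l) : TopExt k (SubQ A M) :=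
  ⟨wedgeList A M l, mem_topExt (wedgeList_mem A M l) h.length⟩

theorem vol_ne_zero (h : IsFrame A M l) : h.vol ≠ 0 :=
  fun h0 => h.ne_zero (congrArg Subtype.val h0)

theorem exists_smul_vol (h : IsFrame A M l) (X : TopExt k (SubQ A M)) : ∃ c : k, X = c • h.vol := by
  have := h.finite
  obtain ⟨c, hc⟩ := exists_smul_eq_of_finrank_eq_one (finrank_topExt (k := k)) h.vol_ne_zero X
  exact ⟨c, hc.symm⟩

theorem exists_smul_eq (h : IsFrame A M l) (h' : IsFrame A M l') :
    ∃ c : kˣ, wedgeList A M l = (c : k) • wedgeList A M l' := by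
  obtain ⟨c, hc⟩ := h'.exists_smul_vol h.vol
  have hc' : wedgeList A M l = c • wedgeList A M l' := congrArg Subtype.val hc
  have : c ≠ 0 := by
    rintro rfl
    exact h.ne_zero (by rw [hc', zero_smul])
  exact ⟨Units.mk0 c this, hc'⟩

theorem smul_injective (h : IsFrame A M l) {c d : k}
    (hcd : c • wedgeList A M l = d • wedgeList A M l) : c = d :=
  smul_left_injective k h.ne_zero hcd

theorem exists_frame (A M : Submodule k U) (h : FiniteDimensional k (SubQ A M)) :
    ∃ l, IsFrame A M l := by
  let b := Module.finBasis k (SubQ A M)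
  choose y hy hby using fun i => exists_toSubQ (b i)
  refine ⟨List.ofFn y, h, ?_, by simp, ?_⟩
  · intro x hx
    obtain ⟨i, rfl⟩ := List.mem_ofFn.1 hx
    exact hy i
  · have h1 := iMulti_ne_zero b.linearIndependent
    rw [ExteriorAlgebra.ιMulti_apply] at h1
    rw [wedgeList, List.map_ofFn]
    convert h1 using 3
    funext i
    simp [hby]

/-- Nonvanishing is the injectivity of `wedgeSub` on the tensor product of two nonzero elements of
lines. -/
theorem append (hM : M ≤ A ⊓ B) (h : IsFrame A B l) (h' : IsFrame (A ⊓ B) M l')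
    (hf : FiniteDimensional k (SubQ A M)) : IsFrame A M (l ++ l') := by
  have h1 := wedgeSub_apply hM hf h.mem h'.mem (X := h.vol) (Y := h'.vol) rfl rfl
  have h2 : wedgeList A M (l ++ l') ∈ TopExt k (SubQ A M) := h1 ▸ Subtype.prop _
  have h3 : wedgeList A M (l ++ l') ≠ 0 := by
    rw [← h1]
    have h4 : h.vol ⊗ₜ[k] h'.vol ≠ 0 := by
      intro h0
      have := h.finite
      have := h'.finite
      have h5 : ∀ z, z = (0 : TopExt k (SubQ A B) ⊗[k] TopExt k (SubQ (A ⊓ B) M)) := by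
        intro z
        induction z using TensorProduct.induction_on with
        | zero => rfl
        | tmul x y =>
          obtain ⟨c, rfl⟩ := h.exists_smul_vol x
          obtain ⟨d, rfl⟩ := h'.exists_smul_vol y
          rw [TensorProduct.smul_tmul_smul, h0, smul_zero]
        | add x y hx hy => rw [hx, hy, add_zero]
      have h6 : Module.finrank k (TopExt k (SubQ A B) ⊗[k] TopExt k (SubQ (A ⊓ B) M)) = 1 := by
        rw [Module.finrank_tensorProduct, finrank_topExt, finrank_topExt]
      have : Subsingleton (TopExt k (SubQ A B) ⊗[k] TopExt k (SubQ (A ⊓ B) M)) :=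
        ⟨fun a b => (h5 a).trans (h5 b).symm⟩
      rw [Module.finrank_zero_of_subsingleton] at h6
      exact zero_ne_one h6
    intro h0
    exact h4 ((wedgeSub A B M hM hf).map_eq_zero_iff.1 (Subtype.ext h0))
  refine ⟨hf, ?_, ?_, h3⟩
  · intro x hx
    rcases List.mem_append.1 hx with hx | hx
    exacts [h.mem x hx, (h'.mem x hx).1]
  -- A nonzero homogeneous element has only one degree: here both the length of the list and the
  -- dimension of the quotient.
  · by_contra hne
    refine h3 ?_
    have := DirectSum.degree_eq_of_mem_mem (fun n : ℕ => ⋀[k]^n (SubQ A M))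
      (wedgeList_mem A M (l ++ l')) h2 h3
    exact absurd this hne

theorem append_of_le (hM : M ≤ B) (hB : B ≤ A) (h : IsFrame A B l) (h' : IsFrame B M l')
    (hf : FiniteDimensional k (SubQ A M)) : IsFrame A M (l ++ l') :=
  append (le_inf (hM.trans hB) hM) h (by rwa [inf_eq_right.2 hB]) hf

theorem smul_append (hM : M ≤ B) (hB : B ≤ A) {l₁ l₁' l₂ l₂' : List U} {c d : k}
    (h₁' : IsFrame A B l₁') (h₂' : IsFrame B M l₂')
    (hl₁ : ∀ x ∈ l₁, x ∈ A) (hl₂ : ∀ x ∈ l₂, x ∈ B)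
    (hc : wedgeList A B l₁ = c • wedgeList A B l₁') (hd : wedgeList B M l₂ = d • wedgeList B M l₂')
    (hf : FiniteDimensional k (SubQ A M)) :
    wedgeList A M (l₁ ++ l₂) = (c * d) • wedgeList A M (l₁' ++ l₂') := by
  have hM' : M ≤ A ⊓ B := le_inf (hM.trans hB) hM
  have e : A ⊓ B = B := inf_eq_right.2 hB
  rw [← e] at h₂' hd
  replace hl₂ : ∀ x ∈ l₂, x ∈ A ⊓ B := fun x hx => e.symm ▸ hl₂ x hx
  rw [← wedgeSub_apply hM' hf hl₁ hl₂ (X := c • h₁'.vol) (Y := d • h₂'.vol) hc.symm hd.symm,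
    ← wedgeSub_apply hM' hf h₁'.mem h₂'.mem (X := h₁'.vol) (Y := h₂'.vol) rfl rfl,
    TensorProduct.smul_tmul_smul, map_smul]
  rfl

theorem map (e : U ≃ₗ[k] U) (h : IsFrame A M l) {A' M' : Submodule k U}
    (hA : A.map e.toLinearMap = A') (hM : M.map e.toLinearMap = M') :
    IsFrame A' M' (l.map e) := by
  refine ⟨?_, ?_, ?_, ?_⟩
  · have := h.finite
    exact Module.Finite.equiv (SubQ.congr e hA hM)
  · intro x hx
    obtain ⟨y, hy, rfl⟩ := List.mem_map.1 hx
    exact hA ▸ Submodule.mem_map_of_mem (h.mem y hy)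
  · rw [List.length_map, h.length, (SubQ.congr e hA hM).finrank_eq]
  · rw [← topExt_congr_wedgeList e hA hM h.mem (X := h.vol) rfl]
    intro h0
    exact h.vol_ne_zero ((TopExt.congr (SubQ.congr e hA hM)).map_eq_zero_iff.1 (Subtype.ext h0))

theorem smul_map (e : U ≃ₗ[k] U) {A' M' : Submodule k U}
    (hA : A.map e.toLinearMap = A') (hM : M.map e.toLinearMap = M') (hl : ∀ x ∈ l, x ∈ A)
    (hl' : ∀ x ∈ l', x ∈ A) {c : k}
    (hc : wedgeList A M l = c • wedgeList A M l') :
    wedgeList A' M' (l.map e) = c • wedgeList A' M' (l'.map e) := by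
  rw [← map_wedgeList (SubQ.congr e hA hM).toLinearMap e
      (fun x hx => congr_toSubQ e hA hM (hl x hx)),
    ← map_wedgeList (SubQ.congr e hA hM).toLinearMap e
      (fun x hx => congr_toSubQ e hA hM (hl' x hx)), hc, map_smul]

theorem nil (A : Submodule k U) : IsFrame A A [] := by
  have : Subsingleton (SubQ A A) := by
    rw [Submodule.Quotient.subsingleton_iff]
    exact Submodule.submoduleOf_self A
  exact ⟨Module.Finite.of_finite, by simp, by simp [Module.finrank_zero_of_subsingleton],
    by simp [wedgeList, List.map_nil, List.prod_nil]⟩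

theorem singleton {v : U} (hv : v ∈ A) (hv' : v ∉ B) (h : ∀ x ∈ A, ∃ c : k, x - c • v ∈ B) :
    IsFrame A B [v] := by
  have h0 : toSubQ A B v ≠ 0 := fun h => hv' ((toSubQ_eq_zero hv).1 h)
  have h1 : Module.finrank k (SubQ A B) = 1 := by
    refine finrank_eq_one (toSubQ A B v) h0 fun w => ?_
    obtain ⟨x, hx, rfl⟩ := exists_toSubQ w
    obtain ⟨c, hc⟩ := h x hx
    refine ⟨c, ?_⟩
    have h2 := (toSubQ_eq_zero (A.sub_mem hx (A.smul_mem c hv))).2 hc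
    rw [sub_eq_add_neg, ← neg_smul, toSubQ_add _ hx (A.smul_mem _ hv), toSubQ_smul _ _ hv,
      neg_smul, ← sub_eq_add_neg, sub_eq_zero] at h2
    exact h2.symm
  refine ⟨Module.finite_of_finrank_eq_succ h1, by simpa using hv, by simp [h1], ?_⟩
  simpa [wedgeList] using h0

end IsFrame

end Wedge

/-! ### Coefficients of elements of (A|B) with respect to frames -/

section Sends

universe u

variable {k : Type u} [Field k] {U : Type u} [AddCommGroup U] [Module k U]

theorem finite_subQ_of_le {A M M' : Submodule k U} (h : M ≤ M')
    (hf : FiniteDimensional k (SubQ A M)) : FiniteDimensional k (SubQ A M') := by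
  refine Module.Finite.of_surjective (SubQ.incl (le_refl A) h) fun y => ?_
  induction y using Submodule.Quotient.induction_on with
  | _ y => exact ⟨Submodule.Quotient.mk y, rfl⟩

theorem finite_subQ_mono {A A' M : Submodule k U} (h : A ≤ A')
    (hf : FiniteDimensional k (SubQ A' M)) : FiniteDimensional k (SubQ A M) :=
  FiniteDimensional.of_injective _ (SubQ.incl_injective M h)

theorem Rel.smul_one {A B : Submodule k U} (x : Rel A B) : Rel.smul 1 x = x := by
  ext1 t
  exact one_smul k _

theorem Rel.smul_smul {A B : Submodule k U} (z w : kˣ) (x : Rel A B) :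
    Rel.smul z (Rel.smul w x) = Rel.smul (z * w) x := by
  ext1 t
  exact _root_.smul_smul (z : k) (w : k) (x t)

theorem Rel.exists_smul_eq {A B : Submodule k U} (hA : FiniteDimensional k (SubQ A B))
    (hB : FiniteDimensional k (SubQ B A)) (x y : Rel A B) : ∃ z : kˣ, y = Rel.smul z x := by
  obtain ⟨l, hl⟩ := IsFrame.exists_frame A B hA
  have h1 : x hl.vol ≠ 0 := fun h => hl.vol_ne_zero (x.map_eq_zero_iff.1 h)
  obtain ⟨c, hc⟩ := exists_smul_eq_of_finrank_eq_one (finrank_topExt (k := k)) h1 (y hl.vol)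
  have hc0 : c ≠ 0 := by
    rintro rfl
    rw [zero_smul] at hc
    exact hl.vol_ne_zero (y.map_eq_zero_iff.1 hc.symm)
  refine ⟨Units.mk0 c hc0, ?_⟩
  ext1 t
  obtain ⟨d, rfl⟩ := hl.exists_smul_vol t
  change _ = c • x (d • hl.vol)
  rw [map_smul, map_smul, ← hc, smul_comm]

/-- The element `x` of `(A|B)` is `c` times the dual of the exterior product of the frame `l` of
`A/M`, tensored with the exterior product of the frame `l'` of `B/M`. -/
structure Rel.Sends {A B : Submodule k U} (x : Rel A B) (M : Submodule k U) (l l' : List U)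
    (c : kˣ) : Prop where
  le : M ≤ A ⊓ B
  left : IsFrame A M l
  right : IsFrame B M l'
  eq : (Rel.stab M le left.finite right.finite x left.vol).1 = (c : k) • wedgeList B M l'

namespace Rel

variable {A B C D M M' : Submodule k U} {x x' : Rel A B} {l l' m m' p : List U} {c d : kˣ}

theorem Sends.finite_left (h : Sends x M l l' c) : FiniteDimensional k (SubQ A B) :=
  finite_subQ_of_le (h.le.trans inf_le_right) h.left.finite

theorem Sends.finite_right (h : Sends x M l l' c) : FiniteDimensional k (SubQ B A) :=
  finite_subQ_of_le (h.le.trans inf_le_left) h.right.finite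

theorem exists_sends (x : Rel A B) (hM : M ≤ A ⊓ B) (hl : IsFrame A M l) (hl' : IsFrame B M l') :
    ∃ c, Sends x M l l' c := by
  obtain ⟨c, hc⟩ := hl'.exists_smul_vol (Rel.stab M hM hl.finite hl'.finite x hl.vol)
  have hc0 : c ≠ 0 := by
    rintro rfl
    rw [zero_smul] at hc
    exact hl.vol_ne_zero ((Rel.stab M hM hl.finite hl'.finite x).map_eq_zero_iff.1 hc)
  exact ⟨Units.mk0 c hc0, hM, hl, hl', congrArg Subtype.val hc⟩

theorem Sends.unique (h : Sends x M l l' c) (h' : Sends x M l l' d) : c = d :=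
  Units.ext (h.right.smul_injective (h.eq.symm.trans h'.eq))

/-- Change of frames: the coefficient `c` is multiplied by `a` for the source and divided by `b` for
the target. -/
theorem Sends.rescale (h : Sends x M l l' c) (hm : IsFrame A M m) (hm' : IsFrame B M m')
    {a b : kˣ} (ha : wedgeList A M m = (a : k) • wedgeList A M l)
    (hb : wedgeList B M m' = (b : k) • wedgeList B M l') (hcd : a * c = d * b) :
    Sends x M m m' d := by
  refine ⟨h.le, hm, hm', ?_⟩
  have h1 : hm.vol = (a : k) • h.left.vol := Subtype.ext ha
  rw [h1, map_smul, Submodule.coe_smul, h.eq, hb, _root_.smul_smul, _root_.smul_smul]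
  congr 1
  exact congrArg Units.val hcd

theorem Sends.smul (h : Sends x M l l' c) (z : kˣ) : Sends (Rel.smul z x) M l l' (z * c) := by
  refine ⟨h.le, h.left, h.right, ?_⟩
  rw [Rel.stab_scalar, LinearEquiv.trans_apply]
  change (z : k) • _ = _
  rw [h.eq, _root_.smul_smul]
  rfl

/-- The main tool for equalities in determinant lines: (A|B) is a line, so the coefficient in one
pair of frames determines the element. -/
theorem Sends.ext (h : Sends x M l l' c) (h' : Sends x' M l l' c) : x = x' := by
  obtain ⟨z, rfl⟩ := Rel.exists_smul_eq h.finite_left h.finite_right x x'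
  have := (h.smul z).unique h'
  obtain rfl : z = 1 := by simpa using this
  rw [Rel.smul_one]

theorem exists_of_frame (hM : M ≤ A ⊓ B) (hl : IsFrame A M l) (hl' : IsFrame B M l') (c : kˣ) :
    ∃ x : Rel A B, Sends x M l l' c := by
  have hA := finite_subQ_of_le (hM.trans inf_le_right) hl.finite
  have hB := finite_subQ_of_le (hM.trans inf_le_left) hl'.finite
  obtain ⟨x⟩ : Nonempty (Rel A B) := by
    exact ⟨LinearEquiv.ofFinrankEq _ _ (by rw [finrank_topExt, finrank_topExt])⟩
  obtain ⟨d, hd⟩ := exists_sends x hM hl hl'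
  exact ⟨Rel.smul (c * d⁻¹) x, by simpa using hd.smul (c * d⁻¹)⟩

/-- Comparison at the level `A ∩ B`. -/
theorem sends_of_apply (x : Rel A B) (hM : M ≤ A ⊓ B) (hA : FiniteDimensional k (SubQ A M))
    (hB : FiniteDimensional k (SubQ B M)) (hl : IsFrame A B l) (hl' : IsFrame B A l')
    (hp : IsFrame (A ⊓ B) M p) (hc : (x hl.vol).1 = (c : k) • wedgeList B A l') :
    Sends x M (l ++ p) (l' ++ p) c := by
  have h1 : IsFrame A M (l ++ p) := hl.append hM hp hA
  have h2 : IsFrame B M (l' ++ p) :=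
    hl'.append (inf_comm A B ▸ hM) (inf_comm A B ▸ hp) hB
  refine ⟨hM, h1, h2, ?_⟩
  have h3 : h1.vol = wedgeSub A B M hM hA (hl.vol ⊗ₜ hp.vol) :=
    Subtype.ext (wedgeSub_apply hM hA hl.mem hp.mem rfl rfl).symm
  have h4 : Rel.stab M hM h1.finite h2.finite x h1.vol
      = wedgeSub' A B M hM hB (x hl.vol ⊗ₜ hp.vol) := by
    rw [Rel.stab, LinearEquiv.trans_apply, h3, LinearEquiv.symm_apply_apply]
    rfl
  have h5 : x hl.vol = (c : k) • hl'.vol := Subtype.ext hc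
  rw [h4, h5, ← TensorProduct.smul_tmul', map_smul, Submodule.coe_smul,
    wedgeSub'_apply hM hB hl'.mem hp.mem rfl rfl]

theorem exists_apply (x : Rel A B) (hM : M ≤ A ⊓ B) (hA : FiniteDimensional k (SubQ A M))
    (hB : FiniteDimensional k (SubQ B M)) :
    ∃ l l' p, ∃ c : kˣ, ∃ hl : IsFrame A B l, IsFrame B A l' ∧ IsFrame (A ⊓ B) M p ∧
      (x hl.vol).1 = (c : k) • wedgeList B A l' := by
  obtain ⟨l, hl⟩ := IsFrame.exists_frame A B (finite_subQ_of_le (hM.trans inf_le_right) hA)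
  obtain ⟨l', hl'⟩ := IsFrame.exists_frame B A (finite_subQ_of_le (hM.trans inf_le_left) hB)
  obtain ⟨p, hp⟩ := IsFrame.exists_frame (A ⊓ B) M (finite_subQ_mono inf_le_left hA)
  obtain ⟨c, hc⟩ := hl'.exists_smul_vol (x hl.vol)
  have hc0 : c ≠ 0 := by
    rintro rfl
    rw [zero_smul] at hc
    exact hl.vol_ne_zero (x.map_eq_zero_iff.1 hc)
  exact ⟨l, l', p, Units.mk0 c hc0, hl, hl', hp, congrArg Subtype.val hc⟩

/-- The same vectors `p` are appended at the right end of both frames, so no sign appears. The proof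
compares with frames adapted to A ∩ B, for which the coefficient is visibly independent of the
level. -/
theorem Sends.refine (h : Sends x M l l' c) (hM : M' ≤ M) (hp : IsFrame M M' p)
    (hA : FiniteDimensional k (SubQ A M')) (hB : FiniteDimensional k (SubQ B M')) :
    Sends x M' (l ++ p) (l' ++ p) c := by
  obtain ⟨a, b, n, c₀, ha, hb, hn, hc⟩ := exists_apply x h.le h.left.finite h.right.finite
  have h0 := sends_of_apply x h.le h.left.finite h.right.finite ha hb hn hc
  have h1 := sends_of_apply x (hM.trans h.le) hA hB ha hb
    (hn.append_of_le hM h.le hp (finite_subQ_mono inf_le_left hA)) hc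
  rw [← List.append_assoc, ← List.append_assoc] at h1
  obtain ⟨s, hs⟩ := h.left.exists_smul_eq h0.left
  obtain ⟨t, ht⟩ := h.right.exists_smul_eq h0.right
  -- `s` and `t` express the given frames in the adapted ones. The same two scalars describe the
  -- change of frames at the finer level.
  have hst : s * c₀ = c * t := by
    have h2 : Sends x M l l' (s * c₀ * t⁻¹) :=
      h0.rescale h.left h.right hs ht (by simp)
    rw [h.unique h2]
    simp
  have hMA := h.le.trans inf_le_left
  have hMB := h.le.trans inf_le_right
  have one_p : wedgeList M M' p = (1 : k) • wedgeList M M' p := (one_smul _ _).symm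
  refine h1.rescale (h.left.append_of_le hM hMA hp hA) (h.right.append_of_le hM hMB hp hB)
    (a := s) (b := t) ?_ ?_ hst
  · simpa using IsFrame.smul_append hM hMA h0.left hp h.left.mem hp.mem hs one_p hA
  · simpa using IsFrame.smul_append hM hMB h0.right hp h.right.mem hp.mem ht one_p hB

theorem Sends.symm (h : Sends x M l l' c) : Sends (LinearEquiv.symm x : Rel B A) M l' l c⁻¹ := by
  obtain ⟨a, b, n, c₀, ha, hb, hn, hc⟩ := exists_apply x h.le h.left.finite h.right.finite
  have h0 := sends_of_apply x h.le h.left.finite h.right.finite ha hb hn hc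
  have h1 : Sends (LinearEquiv.symm x : Rel B A) M (b ++ n) (a ++ n) c₀⁻¹ := by
    refine sends_of_apply _ (inf_comm A B ▸ h.le) h.right.finite h.left.finite hb ha
      (inf_comm A B ▸ hn) ?_
    have h2 : hb.vol = (c₀ : k)⁻¹ • x ha.vol := by
      rw [show x ha.vol = (c₀ : k) • hb.vol from Subtype.ext hc, _root_.smul_smul,
        inv_mul_cancel₀ c₀.ne_zero, one_smul]
    rw [h2, map_smul, LinearEquiv.symm_apply_apply, Units.val_inv_eq_inv_val]
    rfl
  obtain ⟨s, hs⟩ := h.left.exists_smul_eq h0.left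
  obtain ⟨t, ht⟩ := h.right.exists_smul_eq h0.right
  have h2 : Sends x M l l' (s * c₀ * t⁻¹) := h0.rescale h.left h.right hs ht (by simp)
  rw [h.unique h2]
  refine h1.rescale h.right h.left ht hs ?_
  ext
  push_cast
  field_simp

theorem Sends.map (h : Sends x M l l' c) (e : U ≃ₗ[k] U) {A' B' : Submodule k U}
    (hA : A.map e.toLinearMap = A') (hB : B.map e.toLinearMap = B')
    (hM : M.map e.toLinearMap = M') : Sends (Rel.map e hA hB x) M' (l.map e) (l'.map e) c := by
  obtain ⟨a, b, n, c₀, ha, hb, hn, hc⟩ := exists_apply x h.le h.left.finite h.right.finite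
  have h0 := sends_of_apply x h.le h.left.finite h.right.finite ha hb hn hc
  have hl := h.left.map e hA hM
  have hl' := h.right.map e hB hM
  have hAB : (A ⊓ B).map e.toLinearMap = A' ⊓ B' := by
    rw [Submodule.map_inf _ e.injective, hA, hB]
  have h1 : Sends (Rel.map e hA hB x) M' ((a ++ n).map e) ((b ++ n).map e) c₀ := by
    rw [List.map_append, List.map_append]
    refine sends_of_apply _ (by rw [← hAB, ← hM]; exact Submodule.map_mono h.le) hl.finite
      hl'.finite (ha.map e hA hB) (hb.map e hB hA) (hn.map e hAB hM) ?_
    have h2 : (ha.map e hA hB).vol = TopExt.congr (SubQ.congr e hA hB) ha.vol :=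
      Subtype.ext (topExt_congr_wedgeList e hA hB ha.mem rfl).symm
    rw [h2, Rel.map, LinearEquiv.trans_apply, LinearEquiv.symm_apply_apply,
      LinearEquiv.trans_apply, show x ha.vol = (c₀ : k) • hb.vol from Subtype.ext hc, map_smul,
      Submodule.coe_smul, topExt_congr_wedgeList e hB hA hb.mem rfl]
  obtain ⟨s, hs⟩ := h.left.exists_smul_eq h0.left
  obtain ⟨t, ht⟩ := h.right.exists_smul_eq h0.right
  have h2 : Sends x M l l' (s * c₀ * t⁻¹) := h0.rescale h.left h.right hs ht (by simp)
  rw [h.unique h2]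
  exact h1.rescale hl hl' (IsFrame.smul_map e hA hM h.left.mem h0.left.mem hs)
    (IsFrame.smul_map e hB hM h.right.mem h0.right.mem ht) (by simp)

theorem sends_cast_refl (h : A = B) (hM : M ≤ A) (hl : IsFrame A M l) :
    Sends (Rel.cast h (LinearEquiv.refl k _ : Rel A A)) M l l 1 := by
  subst h
  refine sends_of_apply (l := []) (l' := []) (LinearEquiv.refl k _ : Rel A A) (le_inf hM hM)
    hl.finite hl.finite (IsFrame.nil A) (IsFrame.nil A) (by rwa [inf_idem]) ?_
  simp
  rfl

theorem rid_congr_symm_tmul {V N : Type u} [AddCommGroup V] [Module k V] [AddCommGroup N]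
    [Module k N] (T : N ≃ₗ[k] k) (b : V ⊗[k] N) :
    ((TensorProduct.rid k V).symm.trans
      (TensorProduct.congr (LinearEquiv.refl k V) T.symm)).symm b ⊗ₜ[k] T.symm 1 = b := by
  obtain ⟨c, rfl⟩ := ((TensorProduct.rid k V).symm.trans
      (TensorProduct.congr (LinearEquiv.refl k V) T.symm)).surjective b
  rw [LinearEquiv.symm_apply_apply]
  simp

/-- The vector `T.symm 1` split off on the target side is the one tensored on at the source side, so
the trivialisation cancels. -/
theorem stab_destab (hM : M ≤ A ⊓ B) (hA : FiniteDimensional k (SubQ A M))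
    (hB : FiniteDimensional k (SubQ B M))
    (y : TopExt k (SubQ A M) ≃ₗ[k] TopExt k (SubQ B M)) :
    Rel.stab M hM hA hB (Rel.destab M hM hA hB y) = y := by
  set T : TopExt k (SubQ (A ⊓ B) M) ≃ₗ[k] k := trivLine M hA with hT
  have key : ∀ a, Rel.stab M hM hA hB (Rel.destab M hM hA hB y)
      (wedgeSub A B M hM hA (a ⊗ₜ T.symm 1)) = y (wedgeSub A B M hM hA (a ⊗ₜ T.symm 1)) := by
    intro a
    have h2 : Rel.stab M hM hA hB (Rel.destab M hM hA hB y)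
      (wedgeSub A B M hM hA (a ⊗ₜ T.symm 1)) = wedgeSub' A B M hM hB
        (Rel.destab M hM hA hB y a ⊗ₜ T.symm 1) := by
      rw [Rel.stab, LinearEquiv.trans_apply, LinearEquiv.symm_apply_apply]
      rfl
    rw [h2]
    have h3 := rid_congr_symm_tmul T
      ((wedgeSub' A B M hM hB).symm (y (wedgeSub A B M hM hA (a ⊗ₜ T.symm 1))))
    refine Eq.trans (congrArg _ h3) (LinearEquiv.apply_symm_apply _ _)
  ext1 X
  obtain ⟨Z, rfl⟩ := (wedgeSub A B M hM hA).surjective X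
  obtain ⟨a, rfl⟩ := ((TensorProduct.rid k (TopExt k (SubQ A B))).symm.trans
      (TensorProduct.congr (LinearEquiv.refl k _) T.symm)).surjective Z
  exact key a

/-- At the level A ∩ B ∩ C the contraction is composition of homomorphisms, so coefficients multiply
there. Refinement to M preserves them, and in the passage to the given frames the scalar of the
middle frame cancels. -/
theorem Sends.comp {y : Rel B C} (h : Sends x M l l' c) (h' : Sends y M l' m d)
    (hA : FiniteDimensional k (SubQ A (A ⊓ B ⊓ C)))
    (hB : FiniteDimensional k (SubQ B (A ⊓ B ⊓ C)))
    (hC : FiniteDimensional k (SubQ C (A ⊓ B ⊓ C))) :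
    Sends (Rel.comp hA hB hC x y) M l m (c * d) := by
  set I := A ⊓ B ⊓ C with hI
  have hIA : I ≤ A := inf_le_left.trans inf_le_left
  have hIB : I ≤ B := inf_le_left.trans inf_le_right
  have hIC : I ≤ C := inf_le_right
  have hMI : M ≤ I := le_inf h.le (h'.le.trans inf_le_right)
  obtain ⟨a, ha⟩ := IsFrame.exists_frame A I hA
  obtain ⟨b, hb⟩ := IsFrame.exists_frame B I hB
  obtain ⟨e, he⟩ := IsFrame.exists_frame C I hC
  obtain ⟨p, hp⟩ := IsFrame.exists_frame I M (finite_subQ_mono hIA h.left.finite)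
  obtain ⟨c₀, hc₀⟩ := exists_sends x (le_inf hIA hIB) ha hb
  obtain ⟨d₀, hd₀⟩ := exists_sends y (le_inf hIB hIC) hb he
  have h0 : Sends (Rel.comp hA hB hC x y) I a e (c₀ * d₀) := by
    refine ⟨le_inf hIA hIC, ha, he, ?_⟩
    have h1 : Rel.stab I _ hA hB x ha.vol = (c₀ : k) • hb.vol := Subtype.ext hc₀.eq
    have h2 : Rel.stab I (le_inf hIA hIC) hA hC (Rel.comp hA hB hC x y) ha.vol
        = Rel.stab I (le_inf hIB hIC) hB hC y (Rel.stab I (le_inf hIA hIB) hA hB x ha.vol) :=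
      DFunLike.congr_fun (stab_destab (le_inf hIA hIC) hA hC _) ha.vol
    rw [h2, h1, map_smul, Submodule.coe_smul, hd₀.eq, _root_.smul_smul]
    rfl
  have h1 := hc₀.refine hMI hp h.left.finite h.right.finite
  have h2 := hd₀.refine hMI hp h.right.finite h'.right.finite
  have h3 := h0.refine hMI hp h.left.finite h'.right.finite
  obtain ⟨s, hs⟩ := h.left.exists_smul_eq h1.left
  obtain ⟨t, ht⟩ := h.right.exists_smul_eq h1.right
  obtain ⟨w, hw⟩ := h'.right.exists_smul_eq h2.right
  have h4 : Sends x M l l' (s * c₀ * t⁻¹) := h1.rescale h.left h.right hs ht (by simp)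
  have h5 : Sends y M l' m (t * d₀ * w⁻¹) := h2.rescale h.right h'.right ht hw (by simp)
  rw [h.unique h4, h'.unique h5]
  refine h3.rescale h.left h'.right hs hw ?_
  ext
  push_cast
  field_simp

end Rel

end Sends

/-! ### The determinant extension is a central extension -/

section ACKGroup

universe u

variable {k : Type u} [Field k] {r : ℕ}

theorem glEquiv_apply (g : GL (Fin r) k⸨X⸩) (x : Fin r → k⸨X⸩) :
    glEquiv g x = Matrix.mulVec g.val x := rfl

theorem glEquiv_one (x : Fin r → k⸨X⸩) : glEquiv (1 : GL (Fin r) k⸨X⸩) x = x :=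
  Matrix.one_mulVec x

theorem glEquiv_mul (g h : GL (Fin r) k⸨X⸩) (x : Fin r → k⸨X⸩) :
    glEquiv (g * h) x = glEquiv g (glEquiv h x) :=
  (Matrix.mulVec_mulVec x g.val h.val).symm

theorem map_glEquiv_one (l : List (Fin r → k⸨X⸩)) :
    l.map (glEquiv (1 : GL (Fin r) k⸨X⸩)) = l := by
  rw [show ⇑(glEquiv (1 : GL (Fin r) k⸨X⸩)) = id from funext glEquiv_one, List.map_id]

theorem map_glEquiv_mul (g h : GL (Fin r) k⸨X⸩) (l : List (Fin r → k⸨X⸩)) :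
    l.map (glEquiv (g * h)) = (l.map (glEquiv h)).map (glEquiv g) := by
  rw [List.map_map]
  exact List.map_congr_left fun x _ => glEquiv_mul g h x

/-- `A` is an `O`-lattice in `F^r`. -/
def IsLat (A : Submodule k (Fin r → k⸨X⸩)) : Prop := ∃ g, A = act g (stdLat k r)

theorem isLat_std : IsLat (stdLat k r) := ⟨1, (act_one _).symm⟩

theorem isLat_act (g : GL (Fin r) k⸨X⸩) : IsLat (act g (stdLat k r)) := ⟨g, rfl⟩

theorem IsLat.finite {A B : Submodule k (Fin r → k⸨X⸩)} (hA : IsLat A) (hB : IsLat B) :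
    FiniteDimensional k (SubQ A B) := by
  obtain ⟨f, rfl⟩ := hA
  obtain ⟨g, rfl⟩ := hB
  exact finite_subQ_act f g

theorem Rel.Sends.compLat {A B C M : Submodule k (Fin r → k⸨X⸩)} (hA : IsLat A) (hB : IsLat B)
    (hC : IsLat C) {x : Rel A B} {y : Rel B C} {l l' m : List (Fin r → k⸨X⸩)} {c d : kˣ}
    (h : Rel.Sends x M l l' c) (h' : Rel.Sends y M l' m d) :
    Rel.Sends (Rel.compLat hA hB hC x y) M l m (c * d) :=
  h.comp h' _ _ _

theorem Rel.exists_frames {A B : Submodule k (Fin r → k⸨X⸩)} (hA : IsLat A) (hB : IsLat B)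
    (x : Rel A B) : ∃ M l l' c, Rel.Sends x M l l' c := by
  obtain ⟨a, ha⟩ := IsFrame.exists_frame A (A ⊓ B) (finite_subQ_inf (hA.finite hA) (hA.finite hB))
  obtain ⟨b, hb⟩ := IsFrame.exists_frame B (A ⊓ B) (finite_subQ_inf (hB.finite hA) (hB.finite hB))
  obtain ⟨s, hs⟩ := Rel.exists_sends x le_rfl ha hb
  exact ⟨_, _, _, _, hs⟩

theorem ACK.ext_sends {a b : ACK k r} (hg : a.g = b.g) {M : Submodule k (Fin r → k⸨X⸩)}
    {l l' : List (Fin r → k⸨X⸩)} {c : kˣ} (ha : Rel.Sends a.v M l l' c)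
    (hb : Rel.Sends b.v M l l' c) : a = b := by
  obtain ⟨g, v⟩ := a
  obtain ⟨g', v'⟩ := b
  obtain rfl : g = g' := hg
  exact congrArg (ACK.mk g) (ha.ext hb)

/-- The rule for computing products: coefficients multiply as soon as the target frame of `a` is the
translate by `a.g` of the source frame of `b`. -/
theorem ACK.mul_sends {a b : ACK k r} {M M' : Submodule k (Fin r → k⸨X⸩)}
    (hM : M'.map (glEquiv a.g).toLinearMap = M) {l m m' : List (Fin r → k⸨X⸩)} {c d : kˣ}
    (ha : Rel.Sends a.v M l (m.map (glEquiv a.g)) c) (hb : Rel.Sends b.v M' m m' d) :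
    Rel.Sends (a * b).v M l (m'.map (glEquiv a.g)) (c * d) :=
  ha.compLat isLat_std (isLat_act _) (isLat_act _) (hb.map (glEquiv a.g) rfl (act_mul a.g b.g (stdLat k r)) hM)

theorem ACK.smul_sends {a : ACK k r} {M : Submodule k (Fin r → k⸨X⸩)}
    {l m : List (Fin r → k⸨X⸩)} {c : kˣ} (ha : Rel.Sends a.v M l m c) (z : kˣ) :
    Rel.Sends (ACK.smul z a).v M l m (z * c) := ha.smul z

theorem ACK.one_sends {M : Submodule k (Fin r → k⸨X⸩)} (hM : M ≤ stdLat k r)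
    {l : List (Fin r → k⸨X⸩)} (hl : IsFrame (stdLat k r) M l) :
    Rel.Sends (ACK.one k r).v M l l 1 := Rel.sends_cast_refl _ hM hl

noncomputable instance : One (ACK k r) := ⟨ACK.one k r⟩

noncomputable instance : Inv (ACK k r) :=
  ⟨fun a => ⟨a.g⁻¹, Rel.map (glEquiv a.g⁻¹) (by rw [act_mul, inv_mul_cancel, act_one]) rfl
    (LinearEquiv.symm a.v)⟩⟩

theorem ACK.mul_assoc' (a b c : ACK k r) : a * b * c = a * (b * c) := by
  -- A common level inside the four lattices of the chain. With frames of the successive lattices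
  -- translated from one another, both bracketings have the same coefficient `s * t * w`.
  set N := stdLat k r ⊓ act a.g (stdLat k r) ⊓ act (a.g * b.g) (stdLat k r)
    ⊓ act (a.g * b.g * c.g) (stdLat k r) with hN
  have hf : ∀ {P}, IsLat P → FiniteDimensional k (SubQ P N) := fun hP =>
    finite_subQ_inf (finite_subQ_inf (finite_subQ_inf (hP.finite isLat_std)
      (hP.finite (isLat_act _))) (hP.finite (isLat_act _))) (hP.finite (isLat_act _))
  have h0 : N ≤ stdLat k r := inf_le_left.trans (inf_le_left.trans inf_le_left)
  have h1 : N ≤ act a.g (stdLat k r) := inf_le_left.trans (inf_le_left.trans inf_le_right)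
  have h2 : N ≤ act (a.g * b.g) (stdLat k r) := inf_le_left.trans inf_le_right
  have h3 : N ≤ act (a.g * b.g * c.g) (stdLat k r) := inf_le_right
  have act_mono : ∀ (g : GL (Fin r) k⸨X⸩) {P Q}, P ≤ Q → act g P ≤ act g Q :=
    fun g _ _ h => Submodule.map_mono h
  have act_act : ∀ (g h : GL (Fin r) k⸨X⸩) P, act g (act h P) = act (g * h) P :=
    fun g h P => act_mul g h P
  have e1 : (act a.g⁻¹ N).map (glEquiv a.g).toLinearMap = N := by
    rw [act_mul, mul_inv_cancel, act_one]
  have e2 : (act (a.g * b.g)⁻¹ N).map (glEquiv b.g).toLinearMap = act a.g⁻¹ N := by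
    rw [act_mul]
    congr 1
    group
  have e3 : (act (a.g * b.g)⁻¹ N).map (glEquiv (a.g * b.g)).toLinearMap = N := by
    rw [act_mul, mul_inv_cancel, act_one]
  have fr : ∀ (g h : GL (Fin r) k⸨X⸩), FiniteDimensional k (SubQ (act g (stdLat k r)) (act h N)) :=
    fun g h => by
      have := hf (isLat_act (h⁻¹ * g))
      exact Module.Finite.equiv (SubQ.congr (glEquiv h) (A := act (h⁻¹ * g) (stdLat k r))
        (by rw [act_mul, mul_inv_cancel_left]) rfl)
  obtain ⟨l0, hl0⟩ := IsFrame.exists_frame _ _ (hf isLat_std)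
  obtain ⟨m1, hm1⟩ := IsFrame.exists_frame _ _ (fr 1 a.g⁻¹)
  obtain ⟨m2, hm2⟩ := IsFrame.exists_frame _ _ (fr 1 (a.g * b.g)⁻¹)
  obtain ⟨m3, hm3⟩ := IsFrame.exists_frame _ _ (fr c.g (a.g * b.g)⁻¹)
  rw [act_one] at hm1 hm2
  have i1 : act a.g⁻¹ N ≤ stdLat k r := by
    have := act_mono a.g⁻¹ h1
    rwa [act_act, inv_mul_cancel, act_one] at this
  have i1' : act a.g⁻¹ N ≤ act b.g (stdLat k r) := by
    have := act_mono a.g⁻¹ h2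
    rwa [act_act, inv_mul_cancel_left] at this
  have i2 : act (a.g * b.g)⁻¹ N ≤ stdLat k r := by
    have := act_mono (a.g * b.g)⁻¹ h2
    rwa [act_act, inv_mul_cancel, act_one] at this
  have i2' : act (a.g * b.g)⁻¹ N ≤ act c.g (stdLat k r) := by
    have := act_mono (a.g * b.g)⁻¹ h3
    rwa [act_act, inv_mul_cancel_left] at this
  obtain ⟨s, hs⟩ := Rel.exists_sends a.v (le_inf h0 h1) hl0 (hm1.map (glEquiv a.g) rfl e1)
  obtain ⟨t, ht⟩ := Rel.exists_sends b.v (le_inf i1 i1') hm1 (hm2.map (glEquiv b.g) rfl e2)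
  obtain ⟨w, hw⟩ := Rel.exists_sends c.v (le_inf i2 i2') hm2 hm3
  have hab := ACK.mul_sends e1 hs ht
  rw [← map_glEquiv_mul] at hab
  have habc := ACK.mul_sends (a := a * b) e3 hab hw
  have habc' := ACK.mul_sends e1 hs (ACK.mul_sends e2 ht hw)
  rw [← map_glEquiv_mul, ← mul_assoc] at habc'
  exact ACK.ext_sends (mul_assoc _ _ _) habc habc'

theorem ACK.exists_frames (a : ACK k r) : ∃ M l l' c, Rel.Sends a.v M l l' c :=
  Rel.exists_frames isLat_std (isLat_act _) a.v

theorem ACK.one_mul' (a : ACK k r) : ACK.one k r * a = a := by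
  obtain ⟨M, l, l', c, h⟩ := a.exists_frames
  have h1 := ACK.one_sends (h.le.trans inf_le_left) h.left
  rw [← map_glEquiv_one l] at h1
  nth_rewrite 1 [map_glEquiv_one] at h1
  have h2 := ACK.mul_sends (a := ACK.one k r) (act_one M) h1 h
  rw [show (ACK.one k r).g = 1 from rfl, map_glEquiv_one, one_mul] at h2
  exact ACK.ext_sends (one_mul _) h2 h

theorem ACK.inv_mul' (a : ACK k r) : a⁻¹ * a = ACK.one k r := by
  obtain ⟨M, l, l', c, h⟩ := a.exists_frames
  have h1 : Rel.Sends a⁻¹.v (act a.g⁻¹ M) (l'.map (glEquiv a.g⁻¹)) (l.map (glEquiv a.g⁻¹)) c⁻¹ :=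
    h.symm.map _ _ _ rfl
  have h2 := ACK.mul_sends (a := a⁻¹) rfl h1 h
  rw [inv_mul_cancel] at h2
  refine ACK.ext_sends (inv_mul_cancel _) h2 (ACK.one_sends (h1.le.trans inf_le_left) h1.left)

noncomputable instance : Group (ACK k r) :=
  { (inferInstance : Mul (ACK k r)), (inferInstance : One (ACK k r)),
    (inferInstance : Inv (ACK k r)) with
    mul_assoc := ACK.mul_assoc'
    one_mul := ACK.one_mul'
    mul_one := fun a => by
      have h := fun b : ACK k r => ACK.inv_mul' b
      have e : a * a⁻¹ = ACK.one k r := by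
        calc a * a⁻¹ = ACK.one k r * (a * a⁻¹) := (ACK.one_mul' _).symm
          _ = a⁻¹⁻¹ * a⁻¹ * (a * a⁻¹) := by rw [h]
          _ = a⁻¹⁻¹ * (a⁻¹ * a * a⁻¹) := by rw [ACK.mul_assoc', ACK.mul_assoc' a⁻¹]
          _ = ACK.one k r := by rw [h, ACK.one_mul', h]
      change a * ACK.one k r = a
      rw [← h a, ← ACK.mul_assoc', e, ACK.one_mul']
    inv_mul_cancel := ACK.inv_mul' }

theorem ACK.mul_g (a b : ACK k r) : (a * b).g = a.g * b.g := rfl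

theorem ACK.smul_one (a : ACK k r) : ACK.smul 1 a = a := by
  obtain ⟨g, v⟩ := a
  exact congrArg _ (Rel.smul_one v)

theorem ACK.smul_mul (z : kˣ) (a b : ACK k r) : ACK.smul z a * b = ACK.smul z (a * b) := by
  simpa [ACK.smul_one] using ACK.smul_mul_smul z 1 a b

theorem ACK.mul_smul (z : kˣ) (a b : ACK k r) : a * ACK.smul z b = ACK.smul z (a * b) := by
  simpa [ACK.smul_one] using ACK.smul_mul_smul 1 z a b

theorem ACK.smul_smul (z w : kˣ) (a : ACK k r) :
    ACK.smul z (ACK.smul w a) = ACK.smul (z * w) a := by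
  obtain ⟨g, v⟩ := a
  exact congrArg _ (Rel.smul_smul z w v)

theorem ACK.incl_mul (z : kˣ) (a : ACK k r) : ACK.incl k r z * a = ACK.smul z a := by
  rw [ACK.incl, ACK.smul_mul]
  exact congrArg _ (one_mul a)

theorem ACK.smul_left_injective (a : ACK k r) : Function.Injective fun z => ACK.smul z a := by
  intro z w h
  obtain ⟨M, l, l', c, hc⟩ := a.exists_frames
  have h1 := ACK.smul_sends hc z
  have h2 := ACK.smul_sends hc w
  obtain ⟨g, v⟩ := a
  have h3 : Rel.smul z v = Rel.smul w v := by simpa [ACK.smul] using h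
  have h4 : Rel.Sends (Rel.smul z v) M l l' (w * c) := h3 ▸ h2
  exact mul_right_cancel (h1.unique h4)

theorem ACK.exists_smul_eq {a b : ACK k r} (h : a.g = b.g) : ∃ z, b = ACK.smul z a := by
  obtain ⟨g, v⟩ := a
  obtain ⟨g', v'⟩ := b
  obtain rfl : g = g' := h
  obtain ⟨z, hz⟩ := Rel.exists_smul_eq (isLat_std.finite (isLat_act g))
    ((isLat_act g).finite isLat_std) v v'
  exact ⟨z, congrArg _ hz⟩

theorem exists_ack (g : GL (Fin r) k⸨X⸩) : ∃ a : ACK k r, a.g = g := by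
  obtain ⟨l, hl⟩ := IsFrame.exists_frame _ _
    (finite_subQ_inf (isLat_std.finite isLat_std) (isLat_std.finite (isLat_act g)))
  obtain ⟨l', hl'⟩ := IsFrame.exists_frame _ _
    (finite_subQ_inf ((isLat_act g).finite isLat_std) ((isLat_act g).finite (isLat_act g)))
  obtain ⟨v, -⟩ := Rel.exists_of_frame le_rfl hl hl' 1
  exact ⟨⟨g, v⟩, rfl⟩

theorem ACK.isCentralExtension (k : Type u) [Field k] (r : ℕ) :
    IsCentralExtension (ACK.incl k r) (ACK.g : ACK k r → GL (Fin r) k⸨X⸩) where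
  assoc := ACK.mul_assoc'
  one_mul x := by rw [ACK.incl_mul, ACK.smul_one]
  inv_mul x := ⟨x⁻¹, by
    rw [inv_mul_cancel, ACK.incl, ACK.smul_one]
    rfl⟩
  incl_mul a b := by rw [ACK.incl_mul, ACK.incl, ACK.incl, ACK.smul_smul]
  incl_injective := ACK.smul_left_injective _
  central a x := by
    rw [ACK.incl_mul, ACK.incl, ACK.mul_smul]
    exact congrArg _ (mul_one x).symm
  proj_mul _ _ := rfl
  proj_surjective := exists_ack
  exact x := by
    constructor
    · intro h
      exact ACK.exists_smul_eq (a := ACK.one k r) h.symm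
    · rintro ⟨a, rfl⟩
      rfl

end ACKGroup

/-! ### The Bruhat decomposition and simple reflections -/

section Bruhat

universe u

variable {R : Type u} [Field R] {r : ℕ}

theorem permGL_mul_apply (w : Equiv.Perm (Fin r)) (M : Matrix (Fin r) (Fin r) R) (i j : Fin r) :
    ((permGL w : GL (Fin r) R).val * M) i j = M (w⁻¹ i) j := by
  rw [Matrix.mul_apply, Finset.sum_eq_single (w⁻¹ i)]
  · simp [permGL]
  · intro b _ hb
    have : i ≠ w b := fun h => hb (by simp [h])
    simp [permGL, this]
  · simp

theorem mul_permGL_apply (w : Equiv.Perm (Fin r)) (M : Matrix (Fin r) (Fin r) R) (i j : Fin r) :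
    (M * (permGL w : GL (Fin r) R).val) i j = M i (w j) := by
  rw [Matrix.mul_apply, Finset.sum_eq_single (w j)]
  · simp [permGL]
  · intro b _ hb
    simp [permGL, hb]
  · simp

theorem permGL_mul (w w' : Equiv.Perm (Fin r)) :
    (permGL (w * w') : GL (Fin r) R) = permGL w * permGL w' := by
  ext i j
  rw [Units.val_mul, mul_permGL_apply]
  simp [permGL]
  rfl

theorem permGL_one : (permGL 1 : GL (Fin r) R) = 1 := by
  ext i j
  simp [permGL, Matrix.one_apply]
  rfl

theorem permGL_inv (w : Equiv.Perm (Fin r)) : (permGL w : GL (Fin r) R)⁻¹ = permGL w⁻¹ := by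
  rw [inv_eq_iff_mul_eq_one, ← permGL_mul, mul_inv_cancel, permGL_one]

theorem diagGL_one : (diagGL 1 : GL (Fin r) R) = 1 := by
  ext i j
  simp [diagGL]

theorem diagGL_mul' (t t' : Fin r → Rˣ) : (diagGL (t * t') : GL (Fin r) R) = diagGL t * diagGL t' :=
  diagGL_mul t t'

theorem diagGL_inv (t : Fin r → Rˣ) : (diagGL t : GL (Fin r) R)⁻¹ = diagGL t⁻¹ := by
  rw [inv_eq_iff_mul_eq_one, ← diagGL_mul', mul_inv_cancel, diagGL_one]

theorem diagGL_mul_apply (t : Fin r → Rˣ) (M : Matrix (Fin r) (Fin r) R) (i j : Fin r) :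
    ((diagGL t : GL (Fin r) R).val * M) i j = t i * M i j := Matrix.diagonal_mul _ _ _ _

theorem mul_diagGL_apply (t : Fin r → Rˣ) (M : Matrix (Fin r) (Fin r) R) (i j : Fin r) :
    (M * (diagGL t : GL (Fin r) R).val) i j = M i j * t j := Matrix.mul_diagonal _ _ _ _

theorem permGL_mul_diagGL (w : Equiv.Perm (Fin r)) (t : Fin r → Rˣ) :
    (permGL w * diagGL t : GL (Fin r) R) = diagGL (t ∘ ⇑w⁻¹) * permGL w := by
  ext i j
  rw [Units.val_mul, Units.val_mul, mul_diagGL_apply, diagGL_mul_apply]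
  by_cases h : i = w j
  · subst h
    simp [permGL]
  · simp [permGL, h]

theorem mono_inv (t : Fin r → Rˣ) (w : Equiv.Perm (Fin r)) :
    (diagGL t * permGL w : GL (Fin r) R)⁻¹ = diagGL (t⁻¹ ∘ w) * permGL w⁻¹ := by
  rw [mul_inv_rev, permGL_inv, diagGL_inv, permGL_mul_diagGL, inv_inv]

theorem mono_apply (t : Fin r → Rˣ) (w : Equiv.Perm (Fin r)) (i j : Fin r) :
    (diagGL t * permGL w : GL (Fin r) R).val i j = if i = w j then (t i : R) else 0 := by
  rw [Units.val_mul, diagGL_mul_apply]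
  simp [permGL]

theorem mono_inv_mul_apply (t t' : Fin r → Rˣ) (w w' : Equiv.Perm (Fin r)) (x : GL (Fin r) R)
    (i j : Fin r) : ((diagGL t' * permGL w')⁻¹ * x * (diagGL t * permGL w)).val i j
      = (↑(t' (w' i))⁻¹ : R) * x.val (w' i) (w j) * t (w j) := by
  rw [mono_inv, ← mul_assoc, Units.val_mul, mul_permGL_apply, Units.val_mul, mul_diagGL_apply,
    Units.val_mul, Units.val_mul, Matrix.mul_assoc, diagGL_mul_apply, permGL_mul_apply, inv_inv]
  rfl

theorem mono_injective {t t' : Fin r → Rˣ} {w w' : Equiv.Perm (Fin r)}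
    (h : (diagGL t * permGL w : GL (Fin r) R) = diagGL t' * permGL w') : t = t' ∧ w = w' := by
  have h1 : ∀ i j, (diagGL t * permGL w : GL (Fin r) R).val i j
    = (diagGL t' * permGL w' : GL (Fin r) R).val i j := fun i j => by rw [h]
  simp only [mono_apply] at h1
  have hw : w = w' := by
    ext j
    have := h1 (w j) j
    rw [if_pos rfl] at this
    by_contra hne
    rw [if_neg fun h => hne (congrArg Fin.val h)] at this
    exact (t (w j)).ne_zero this
  subst hw
  refine ⟨?_, rfl⟩
  funext i
  have := h1 i (w⁻¹ i)
  simp only [show w (w⁻¹ i) = i by simp, if_true] at this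
  exact Units.ext this

theorem IsUnip.one : IsUnip (1 : GL (Fin r) R) :=
  ⟨fun i => by simp, fun i j h => Matrix.one_apply_ne h.ne'⟩

theorem IsUnip.blockTriangular {n : GL (Fin r) R} (h : IsUnip n) :
    Matrix.BlockTriangular n.val id := fun i j hij => h.2 i j hij

theorem mul_apply_diag_of_blockTriangular {M N : Matrix (Fin r) (Fin r) R}
    (hM : M.BlockTriangular id) (hN : N.BlockTriangular id) (i : Fin r) :
    (M * N) i i = M i i * N i i := by
  rw [Matrix.mul_apply, Finset.sum_eq_single i]
  · intro j _ hj
    rcases lt_or_gt_of_ne hj with h | h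
    · rw [hM h, zero_mul]
    · rw [hN h, mul_zero]
  · simp

theorem IsUnip.mul {n n' : GL (Fin r) R} (h : IsUnip n) (h' : IsUnip n') : IsUnip (n * n') :=
  ⟨fun i => by
    rw [Units.val_mul, mul_apply_diag_of_blockTriangular h.blockTriangular h'.blockTriangular,
      h.1, h'.1, one_mul],
    fun _ _ hij => (h.blockTriangular.mul h'.blockTriangular) hij⟩

theorem IsUnip.inv {n : GL (Fin r) R} (h : IsUnip n) : IsUnip n⁻¹ := by
  have h1 : (n⁻¹).val.BlockTriangular id := by
    have : Invertible n.val := n.invertible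
    have := Matrix.blockTriangular_inv_of_blockTriangular h.blockTriangular
    rwa [← Matrix.coe_units_inv] at this
  refine ⟨fun i => ?_, fun i j hij => h1 hij⟩
  have h2 := mul_apply_diag_of_blockTriangular h.blockTriangular h1 i
  rw [← Units.val_mul, mul_inv_cancel, h.1, one_mul] at h2
  rw [← h2]
  simp

theorem IsUnip.conj_diag {n : GL (Fin r) R} (h : IsUnip n) (t : Fin r → Rˣ) :
    IsUnip (diagGL t * n * (diagGL t)⁻¹) := by
  rw [diagGL_inv]
  constructor
  · intro i
    rw [Units.val_mul, mul_diagGL_apply, Units.val_mul, diagGL_mul_apply, h.1]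
    simp
  · intro i j hij
    rw [Units.val_mul, mul_diagGL_apply, Units.val_mul, diagGL_mul_apply, h.2 i j hij]
    simp

/-- The elementary matrix `1 + a E_{ij}`. -/
def elemGL {i j : Fin r} (hij : i ≠ j) (a : R) : GL (Fin r) R where
  val := Matrix.transvection i j a
  inv := Matrix.transvection i j (-a)
  val_inv := by rw [Matrix.transvection_mul_transvection_same _ _ hij, add_neg_cancel,
    Matrix.transvection_zero]
  inv_val := by rw [Matrix.transvection_mul_transvection_same _ _ hij, neg_add_cancel,
    Matrix.transvection_zero]

theorem elemGL_inv {i j : Fin r} (hij : i ≠ j) (a : R) : (elemGL hij a)⁻¹ = elemGL hij (-a) :=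
  Units.ext rfl

theorem elemGL_apply {i j : Fin r} (hij : i ≠ j) (a : R) (x y : Fin r) :
    (elemGL hij a).val x y = (if x = y then 1 else 0) + if i = x ∧ j = y then a else 0 := by
  simp [elemGL, Matrix.transvection, Matrix.single, Matrix.one_apply]

theorem isUnip_elemGL {i j : Fin r} (hij : i < j) (a : R) : IsUnip (elemGL hij.ne a) := by
  constructor
  · intro x
    rw [elemGL_apply, if_pos rfl, if_neg, add_zero]
    rintro ⟨rfl, h⟩
    exact hij.ne' h
  · intro x y hxy
    rw [elemGL_apply, if_neg hxy.ne', if_neg, add_zero]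
    rintro ⟨rfl, rfl⟩
    exact absurd hxy hij.asymm

theorem elemGL_zero {i j : Fin r} (hij : i ≠ j) : elemGL hij (0 : R) = 1 := by
  ext x y
  rw [elemGL_apply]
  simp [Matrix.one_apply]

theorem diagGL_conj_elemGL {i j : Fin r} (hij : i ≠ j) (a : R) (t : Fin r → Rˣ) :
    diagGL t * elemGL hij a * (diagGL t)⁻¹ = elemGL hij (t i * a * ↑(t j)⁻¹) := by
  rw [diagGL_inv]
  ext x y
  rw [Units.val_mul, mul_diagGL_apply, Units.val_mul, diagGL_mul_apply, elemGL_apply, elemGL_apply]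
  by_cases h : i = x ∧ j = y
  · obtain ⟨rfl, rfl⟩ := h
    simp [hij]
  · by_cases h' : x = y
    · subst h'
      simp [h]
    · simp [h, h']

theorem permGL_conj_elemGL {i j : Fin r} (hij : i ≠ j) (a : R) (w : Equiv.Perm (Fin r)) :
    permGL w * elemGL hij a * (permGL w)⁻¹ = elemGL (w.injective.ne hij) a := by
  rw [permGL_inv]
  ext x y
  rw [Units.val_mul, mul_permGL_apply, Units.val_mul, permGL_mul_apply, elemGL_apply, elemGL_apply]
  simp [Equiv.eq_symm_apply, Equiv.Perm.inv_def]

/-- The diagonal matrix `diag(…, -1/a, a, …)` with entries at `i`, `j`. -/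
def rankOneTorus (i j : Fin r) (a : Rˣ) : Fin r → Rˣ := fun x =>
  if x = i then -a⁻¹ else if x = j then a else 1

/-- The 2 × 2 identity (0 1; 1 0)(1 a; 0 1) = (1 1/a; 0 1) diag(-1/a, a) (1 0; 1/a 1) in the rows
and columns i, j. -/
theorem swap_mul_elemGL {i j : Fin r} (hij : i ≠ j) (a : Rˣ) :
    (permGL (Equiv.swap i j) * elemGL hij (a : R) : GL (Fin r) R)
      = elemGL hij (↑a⁻¹ : R) * diagGL (rankOneTorus i j a) * elemGL hij.symm (↑a⁻¹ : R) := by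
  rw [mul_assoc, ← inv_mul_eq_iff_eq_mul, elemGL_inv]
  ext x y
  have h1 : (elemGL hij (-(↑a⁻¹ : R)) * (permGL (Equiv.swap i j) * elemGL hij (a : R))).val x y
    = (permGL (Equiv.swap i j) * elemGL hij (a : R)).val x y +
      if i = x then -(↑a⁻¹ : R) * (permGL (Equiv.swap i j) * elemGL hij (a : R)).val j y else 0 := by
    by_cases hx : i = x
    · subst hx
      rw [if_pos rfl, Units.val_mul]
      exact Matrix.transvection_mul_apply_same _ _ _ _ _
    · rw [if_neg hx, add_zero, Units.val_mul]
      exact Matrix.transvection_mul_apply_of_ne _ _ _ _ (Ne.symm hx) _ _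
  rw [h1, Units.val_mul, permGL_mul_apply, permGL_mul_apply, Units.val_mul, diagGL_mul_apply,
    Equiv.swap_inv, Equiv.swap_apply_right]
  simp only [elemGL_apply, rankOneTorus]
  have hji := hij.symm
  rcases eq_or_ne x i with rfl | hxi
  · rw [Equiv.swap_apply_left]
    rcases eq_or_ne y x with rfl | hyi
    · simp [hij, hji]
    · rcases eq_or_ne y j with rfl | hyj
      · simp [hij, hji]
      · simp [hij, hji, hyi.symm, hyj.symm]
  · rcases eq_or_ne x j with rfl | hxj
    · rw [Equiv.swap_apply_right]
      rcases eq_or_ne y i with rfl | hyi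
      · simp [hij, hji]
      · rcases eq_or_ne y x with rfl | hyj
        · simp [hij, hji]
        · simp [hij, hji, hyi.symm, hyj.symm]
    · rw [Equiv.swap_apply_of_ne_of_ne hxi hxj]
      simp [hxi, hxj, hxi.symm, hxj.symm]

/-- A simple reflection permutes the positive roots other than its own, so only the (p, q) entry can
leave the upper triangle. -/
theorem isUnip_swap_conj {p q : Fin r} (hpq : (q : ℕ) = p + 1) {n : GL (Fin r) R} (hn : IsUnip n)
    (h0 : n.val p q = 0) :
    IsUnip (permGL (Equiv.swap p q) * n * (permGL (Equiv.swap p q))⁻¹) := by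
  rw [permGL_inv]
  constructor
  · intro i
    rw [Units.val_mul, mul_permGL_apply, Units.val_mul, permGL_mul_apply, hn.1]
  · intro i j hij
    rw [Units.val_mul, mul_permGL_apply, Units.val_mul, permGL_mul_apply, Equiv.swap_inv]
    have hij' : (j : ℕ) < i := hij
    by_cases h : i = q ∧ j = p
    · obtain ⟨rfl, rfl⟩ := h
      rw [Equiv.swap_apply_right, Equiv.swap_apply_left, h0]
    · refine hn.2 _ _ ?_
      rw [Fin.lt_def]
      simp only [Equiv.swap_apply_def]
      simp only [Fin.ext_iff] at h ⊢
      split_ifs <;> omega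

/-- The root element with the (p, q) entry of `n` is split off, and the remaining factor stays
unipotent under the reflection. If `w⁻¹` keeps p before q, the root element moves through `tw` to
the right inside N_r. Otherwise the opposite root element does, and it is the one occurring in the
rank one identity when the entry is nonzero; a zero entry falls under the first case. -/
theorem swap_mul_cases {p q : Fin r} (hpq : (q : ℕ) = p + 1) {n : GL (Fin r) R} (hn : IsUnip n)
    (t : Fin r → Rˣ) (w : Equiv.Perm (Fin r)) (hne : p ≠ q) :
    ∃ (n₁ : GL (Fin r) R) (a : R), IsUnip n₁ ∧ IsUnip (permGL (Equiv.swap p q) * n₁ * (permGL (Equiv.swap p q))⁻¹) ∧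
      n = n₁ * elemGL hne a ∧
      (IsUnip ((diagGL t * permGL w)⁻¹ * elemGL hne a * (diagGL t * permGL w)) ∨
      ∃ u : Rˣ, a = (u : R) ∧
        IsUnip ((diagGL t * permGL w)⁻¹ * elemGL hne.symm (↑u⁻¹ : R) * (diagGL t * permGL w))) := by
  have hlt : p < q := by rw [Fin.lt_def]; omega
  have hx : IsUnip (elemGL hne (n.val p q)) := isUnip_elemGL hlt _
  have hconj : ∀ {i j : Fin r} (hij : i ≠ j) (a : R), w⁻¹ i < w⁻¹ j →
      IsUnip ((diagGL t * permGL w)⁻¹ * elemGL hij a * (diagGL t * permGL w)) := by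
    intro i j hij a hw
    have h1 := diagGL_conj_elemGL hij a t⁻¹
    have h2 := permGL_conj_elemGL hij (((t⁻¹) i : Rˣ) * a * ↑((t⁻¹) j)⁻¹) w⁻¹
    rw [← diagGL_inv, inv_inv] at h1
    rw [← h1, ← permGL_inv, inv_inv] at h2
    have h3 : (diagGL t * permGL w)⁻¹ * elemGL hij a * (diagGL t * permGL w)
        = (permGL w)⁻¹ * ((diagGL t)⁻¹ * elemGL hij a * diagGL t) * permGL w := by group
    rw [h3, h2]
    exact isUnip_elemGL hw _
  refine ⟨n * (elemGL hne (n.val p q))⁻¹, n.val p q, hn.mul hx.inv, ?_, by group, ?_⟩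
  · refine isUnip_swap_conj hpq (hn.mul hx.inv) ?_
    rw [elemGL_inv, Units.val_mul]
    refine (Matrix.mul_transvection_apply_same p q p (-n.val p q) n.val).trans ?_
    rw [hn.1]
    ring
  · rcases lt_or_gt_of_ne ((w⁻¹).injective.ne hne) with h | h
    · exact Or.inl (hconj _ _ h)
    · by_cases h0 : n.val p q = 0
      · left
        rw [h0, elemGL_zero]
        simpa using IsUnip.one
      · exact Or.inr ⟨Units.mk0 _ h0, rfl, hconj _ _ h⟩

/-- Gaussian elimination: GL_r is generated by N_r, T_r and the simple reflections, the lower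
transvections being conjugates of upper ones by transpositions. The generating set is closed under
inversion, so left multiplication by generators suffices. -/
theorem gl_induction {P : GL (Fin r) R → Prop} (one : P 1)
    (unip : ∀ n g, IsUnip n → P g → P (n * g)) (diag : ∀ t g, P g → P (diagGL t * g))
    (swap : ∀ (p q : Fin r) (_ : (q : ℕ) = p + 1) (g), P g → P (permGL (Equiv.swap p q) * g))
    (g : GL (Fin r) R) : P g := by
  let S : Set (GL (Fin r) R) := {g | IsUnip g ∨ (∃ t, g = diagGL t) ∨
    ∃ p q : Fin r, (q : ℕ) = p + 1 ∧ g = permGL (Equiv.swap p q)}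
  have hperm : ∀ w : Equiv.Perm (Fin r), permGL w ∈ Subgroup.closure S := by
    cases r with
    | zero =>
      intro w
      rw [Subsingleton.elim (permGL w) 1]
      exact one_mem _
    | succ r =>
      intro w
      have hw : w ∈ Submonoid.closure (Set.range fun i : Fin r ↦ Equiv.swap i.castSucc i.succ) := by
        rw [Equiv.Perm.mclosure_swap_castSucc_succ]
        trivial
      induction hw using Submonoid.closure_induction with
      | mem x hx =>
        obtain ⟨i, rfl⟩ := hx
        exact Subgroup.subset_closure (Or.inr (Or.inr ⟨_, _, by simp, rfl⟩))
      | one => rw [permGL_one]; exact one_mem _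
      | mul x y _ _ hx hy => rw [permGL_mul]; exact mul_mem hx hy
  have helem : ∀ (i j : Fin r) (hij : i ≠ j) (a : R), elemGL hij a ∈ Subgroup.closure S := by
    have h1 : ∀ (i j : Fin r) (hij : i < j) (a : R), elemGL hij.ne a ∈ Subgroup.closure S :=
      fun i j hij a => Subgroup.subset_closure (Or.inl (isUnip_elemGL hij a))
    intro i j hij a
    rcases lt_or_gt_of_ne hij with h | h
    · exact h1 i j h a
    · have h2 := permGL_conj_elemGL hij.symm a (Equiv.swap i j)
      have h3 : elemGL ((Equiv.swap i j).injective.ne hij.symm) a = elemGL hij a := by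
        congr 1 <;> simp
      rw [← h3, ← h2]
      exact mul_mem (mul_mem (hperm _) (h1 j i h a)) (inv_mem (hperm _))
  have hall : ∀ M : Matrix (Fin r) (Fin r) R, M.det ≠ 0 →
      ∀ g : GL (Fin r) R, g.val = M → g ∈ Subgroup.closure S := by
    intro M hM
    refine Matrix.diagonal_transvection_induction_of_det_ne_zero
      (fun M => ∀ g : GL (Fin r) R, g.val = M → g ∈ Subgroup.closure S) M hM ?_ ?_ ?_
    · intro D hD g hg
      rw [Matrix.det_diagonal, Finset.prod_ne_zero_iff] at hD
      refine Subgroup.subset_closure (Or.inr (Or.inl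
        ⟨fun i => Units.mk0 (D i) (hD i (Finset.mem_univ i)), Units.ext hg⟩))
    · intro t g hg
      have : g = elemGL t.hij t.c := Units.ext hg
      rw [this]
      exact helem _ _ _ _
    · intro A B hA hB ihA ihB g hg
      have : g = Matrix.GeneralLinearGroup.mkOfDetNeZero A hA
          * Matrix.GeneralLinearGroup.mkOfDetNeZero B hB := Units.ext hg
      rw [this]
      exact mul_mem (ihA _ rfl) (ihB _ rfl)
  have hg : g ∈ Subgroup.closure S :=
    hall g.val ((Matrix.isUnit_iff_isUnit_det _).1 g.isUnit).ne_zero g rfl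
  induction hg using Subgroup.closure_induction_left with
  | one => exact one
  | mul_left x hx y _ ih =>
    rcases hx with h | ⟨t, rfl⟩ | ⟨p, q, hpq, rfl⟩
    exacts [unip _ _ h ih, diag _ _ ih, swap _ _ hpq _ ih]
  | inv_mul_cancel x hx y _ ih =>
    rcases hx with h | ⟨t, rfl⟩ | ⟨p, q, hpq, rfl⟩
    · exact unip _ _ h.inv ih
    · rw [diagGL_inv]
      exact diag _ _ ih
    · rw [permGL_inv, Equiv.swap_inv]
      exact swap _ _ hpq _ ih

/-- If n m = m' n' with n, n' unipotent, comparison of the diagonal entries of m'⁻¹ n m makes the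
entry of n at (w' i, w i) nonzero. As n is upper triangular, w' i ≤ w i for all i. -/
theorem IsBruhat.unique {g m m' : GL (Fin r) R} (h : IsBruhat g m) (h' : IsBruhat g m') :
    m = m' := by
  obtain ⟨⟨t, w, rfl⟩, n₁, n₂, hn₁, hn₂, h⟩ := h
  obtain ⟨⟨t', w', rfl⟩, n₁', n₂', hn₁', hn₂', h'⟩ := h'
  have hN : IsUnip (n₁'⁻¹ * n₁) := hn₁'.inv.mul hn₁
  have hN' : IsUnip (n₂' * n₂⁻¹) := hn₂'.mul hn₂.inv
  have h1 : (diagGL t' * permGL w')⁻¹ * (n₁'⁻¹ * n₁) * (diagGL t * permGL w) = n₂' * n₂⁻¹ := by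
    rw [eq_mul_inv_iff_mul_eq]
    have : n₁ * (diagGL t * permGL w) * n₂ = n₁' * (diagGL t' * permGL w') * n₂' := h.symm.trans h'
    calc _ = (diagGL t' * permGL w')⁻¹ * n₁'⁻¹ * (n₁ * (diagGL t * permGL w) * n₂) := by group
      _ = _ := by rw [this]; group
  have h2 : ∀ i, (↑(t' (w' i))⁻¹ : R) * (n₁'⁻¹ * n₁).val (w' i) (w i) * t (w i) = 1 := by
    intro i
    rw [← hN'.1 i, ← h1, mono_inv_mul_apply]
  have h3 : ∀ i, w' i ≤ w i := by
    intro i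
    by_contra hlt
    have := h2 i
    rw [hN.2 _ _ (not_le.1 hlt)] at this
    simp at this
  have h4 : w = w' := by
    -- Both permutations have the same sum of values, so the pointwise inequality is an equality.
    have h5 : ∑ i : Fin r, ((w i : Fin r) : ℕ) = ∑ i : Fin r, ((w' i : Fin r) : ℕ) := by
      exact (Equiv.sum_comp w fun i : Fin r => (i : ℕ)).trans
        (Equiv.sum_comp w' fun i : Fin r => (i : ℕ)).symm
    have h6 := (Finset.sum_eq_sum_iff_of_le (f := fun i => ((w' i : Fin r) : ℕ))
      (g := fun i => ((w i : Fin r) : ℕ)) fun i _ => Fin.le_def.1 (h3 i)).1 h5.symm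
    ext i
    exact (h6 i (Finset.mem_univ i)).symm
  subst h4
  have h5 : t = t' := by
    funext i
    have := h2 (w⁻¹ i)
    rw [show w (w⁻¹ i) = i by simp, hN.1, mul_one, Units.inv_mul_eq_one] at this
    exact Units.ext this.symm
  rw [h5]

/-- The two cases are those of `swap_mul_cases`: either the reflection multiplies the monomial part,
or the rank one identity replaces it by a torus element. -/
theorem IsBruhat.swap_mul {p q : Fin r} (hpq : (q : ℕ) = p + 1) {g : GL (Fin r) R}
    {t : Fin r → Rˣ} {w : Equiv.Perm (Fin r)} (h : IsBruhat g (diagGL t * permGL w)) :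
    IsBruhat (permGL (Equiv.swap p q) * g) (permGL (Equiv.swap p q) * (diagGL t * permGL w)) ∨
    ∃ u, IsBruhat (permGL (Equiv.swap p q) * g)
      (diagGL (rankOneTorus p q u) * (diagGL t * permGL w)) := by
  obtain ⟨-, n, n', hn, hn', rfl⟩ := h
  have hne : p ≠ q := by
    rintro rfl
    omega
  obtain ⟨n₁, a, h₁, h₂, rfl, h | ⟨u, rfl, h⟩⟩ := swap_mul_cases hpq hn t w hne
  · refine Or.inl ⟨⟨t ∘ ⇑(Equiv.swap p q)⁻¹, Equiv.swap p q * w, ?_⟩, _, _, h₂, h.mul hn', ?_⟩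
    · rw [permGL_mul, ← mul_assoc (diagGL _), ← permGL_mul_diagGL, mul_assoc]
    · group
  · refine Or.inr ⟨u, ⟨rankOneTorus p q u * t, w, by rw [diagGL_mul', mul_assoc]⟩, _, _,
      h₂.mul (isUnip_elemGL (show p < q by rw [Fin.lt_def]; omega) (↑u⁻¹ : R)), h.mul hn', ?_⟩
    have := swap_mul_elemGL hne u
    calc permGL (Equiv.swap p q) * (n₁ * elemGL hne (u : R) * (diagGL t * permGL w) * n')
        = permGL (Equiv.swap p q) * n₁ * (permGL (Equiv.swap p q))⁻¹
          * (permGL (Equiv.swap p q) * elemGL hne (u : R)) * (diagGL t * permGL w) * n' := by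
          group
      _ = _ := by rw [this]; group

theorem exists_isBruhat (g : GL (Fin r) R) : ∃ m, IsBruhat g m := by
  induction g using gl_induction with
  | one => exact ⟨1, ⟨1, 1, by rw [diagGL_one, permGL_one, one_mul]⟩, 1, 1, .one, .one, by simp⟩
  | unip n g hn ih =>
    obtain ⟨m, hm, n₁, n₂, h₁, h₂, rfl⟩ := ih
    exact ⟨m, hm, n * n₁, n₂, hn.mul h₁, h₂, by group⟩
  | diag s g ih =>
    obtain ⟨m, ⟨t, w, rfl⟩, n₁, n₂, h₁, h₂, rfl⟩ := ih
    refine ⟨_, ⟨s * t, w, rfl⟩, _, n₂, h₁.conj_diag s, h₂, ?_⟩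
    rw [diagGL_mul']
    group
  | swap p q hpq g ih =>
    obtain ⟨_, hm⟩ := ih
    obtain ⟨t, w, rfl⟩ := hm.1
    rcases hm.swap_mul hpq with h | ⟨u, h⟩
    exacts [⟨_, h⟩, ⟨_, h⟩]

end Bruhat

/-! ### Uniqueness of the Kazhdan–Patterson cocycle -/

section Cocycle

universe u

variable {R : Type u} [Field R] {r : ℕ} {A B : Type*} [CommGroup A] [CommGroup B]

theorem IsKPCocycle.map {sym : Rˣ → Rˣ → A} {χ : GL (Fin r) R → GL (Fin r) R → A}
    (h : IsKPCocycle sym χ) (f : A →* B) :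
    IsKPCocycle (fun a b => f (sym a b)) (fun g g' => f (χ g g')) where
  cocycle g g' g'' := by
    rw [← map_inv, ← map_inv, ← map_mul, ← map_mul, ← map_mul, h.cocycle, map_one]
  torus_torus t t' := by simp only [h.torus_torus, map_prod]
  weyl_weyl w w' := by rw [h.weyl_weyl, map_one]
  torus_weyl t w := by rw [h.torus_weyl, map_one]
  refl_torus l hl t := by rw [h.refl_torus, map_mul, map_mul, map_inv]
  unip n n' hn hn' g g' := by rw [h.unip n n' hn hn']
  torus_bruhat t g m hm := by rw [h.torus_bruhat t g m hm]
  refl_bruhat l hl g m m' hm hm' := by rw [h.refl_bruhat l hl g m m' hm hm']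

theorem IsKPCocycle.div {sym : Rˣ → Rˣ → A} {χ χ' : GL (Fin r) R → GL (Fin r) R → A}
    (h : IsKPCocycle sym χ) (h' : IsKPCocycle sym χ') :
    IsKPCocycle (fun _ _ => (1 : A)) (fun g g' => χ g g' / χ' g g') where
  cocycle g g' g'' := by
    have h1 := h.cocycle g g' g''
    have h2 := h'.cocycle g g' g''
    calc _ = (χ g' g'' * (χ (g * g') g'')⁻¹ * χ g (g' * g'') * (χ g g')⁻¹)
        / (χ' g' g'' * (χ' (g * g') g'')⁻¹ * χ' g (g' * g'') * (χ' g g')⁻¹) := by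
          simp only [div_eq_mul_inv, mul_inv, inv_inv]
          simp only [mul_assoc, mul_comm, mul_left_comm]
      _ = 1 := by rw [h1, h2, div_one]
  torus_torus t t' := by
    rw [h.torus_torus, h'.torus_torus, div_self']
    simp
  weyl_weyl w w' := by rw [h.weyl_weyl, h'.weyl_weyl, div_self']
  torus_weyl t w := by rw [h.torus_weyl, h'.torus_weyl, div_self']
  refl_torus l hl t := by
    rw [h.refl_torus, h'.refl_torus, div_self']
    simp
  unip n n' hn hn' g g' := by rw [h.unip n n' hn hn', h'.unip n n' hn hn']
  torus_bruhat t g m hm := by rw [h.torus_bruhat t g m hm, h'.torus_bruhat t g m hm]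
  refl_bruhat l hl g m m' hm hm' := by
    rw [h.refl_bruhat l hl g m m' hm hm', h'.refl_bruhat l hl g m m' hm hm']

theorem IsKPCocycle.mul_eq {sym : Rˣ → Rˣ → A} {χ : GL (Fin r) R → GL (Fin r) R → A}
    (h : IsKPCocycle sym χ) (g g' g'' : GL (Fin r) R) :
    χ g g' * χ (g * g') g'' = χ g (g' * g'') * χ g' g'' := by
  have := h.cocycle g g' g''
  rw [mul_inv_eq_one, mul_right_comm, mul_inv_eq_iff_eq_mul, mul_comm (χ g' g'')] at this
  exact this.symm

/-- By the cocycle identity, the elements x with c(x, ·) = 1 are closed under products, so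
generators suffice. The torus reduces to monomial matrices through `torus_bruhat`, and a unipotent
element to x = 1 through `unip`. A simple reflection is reduced by `refl_bruhat` to a monomial
second argument, with either the reflection or a torus element as first argument. -/
theorem IsKPCocycle.eq_one {c : GL (Fin r) R → GL (Fin r) R → A}
    (h : IsKPCocycle (fun _ _ => (1 : A)) c) (g g' : GL (Fin r) R) : c g g' = 1 := by
  have htt : ∀ t t', c (diagGL t) (diagGL t') = 1 := fun t t' => by simp [h.torus_torus]
  have htm : ∀ t t' w, c (diagGL t) (diagGL t' * permGL w) = 1 := fun t t' w => by
    have := h.mul_eq (diagGL t) (diagGL t') (permGL w)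
    rwa [← diagGL_mul', h.torus_weyl, h.torus_weyl, htt, mul_one, mul_one, eq_comm] at this
  have htg : ∀ t g, c (diagGL t) g = 1 := fun t g => by
    obtain ⟨m, hm⟩ := exists_isBruhat g
    rw [h.torus_bruhat t g m hm]
    obtain ⟨t', w, rfl⟩ := hm.1
    exact htm t t' w
  have h1g : ∀ g, c 1 g = 1 := fun g => by rw [← diagGL_one, htg]
  have hswap : ∀ (l : ℕ) (hl : l + 1 < r) (g),
      c (permGL (Equiv.swap ⟨l, by omega⟩ ⟨l + 1, hl⟩)) g = 1 := by
    intro l hl g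
    set α : Equiv.Perm (Fin r) := Equiv.swap ⟨l, by omega⟩ ⟨l + 1, hl⟩ with hα
    have h1 : ∀ t w, c (permGL α) (diagGL t * permGL w) = 1 := by
      intro t w
      have h2 : c (permGL α) (diagGL t) = 1 := by rw [h.refl_torus]; simp
      have h3 : ∀ t', c (diagGL t' * permGL α) (permGL w) = 1 := fun t' => by
        have := h.mul_eq (diagGL t') (permGL α) (permGL w)
        rwa [h.torus_weyl, h.weyl_weyl, ← permGL_mul, h.torus_weyl, one_mul, one_mul] at this
      have := h.mul_eq (permGL α) (diagGL t) (permGL w)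
      rwa [h2, permGL_mul_diagGL, h3, h.torus_weyl, mul_one, mul_one, eq_comm] at this
    obtain ⟨m, hm⟩ := exists_isBruhat g
    obtain ⟨t, w, rfl⟩ := hm.1
    -- In the second case m' m⁻¹ is in the torus, which has already been treated.
    rcases hm.swap_mul (p := ⟨l, by omega⟩) (q := ⟨l + 1, hl⟩) rfl with h2 | ⟨u, h2⟩
    · rw [h.refl_bruhat l hl g _ _ hm h2, mul_inv_cancel_right, h1]
    · rw [h.refl_bruhat l hl g _ _ hm h2, mul_inv_cancel_right, htg]
  have hmul : ∀ x y, (∀ g, c x g = 1) → (∀ g, c y g = 1) → ∀ g, c (x * y) g = 1 := by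
    intro x y hx hy g
    have := h.mul_eq x y g
    rwa [hx, hx, hy, one_mul, one_mul] at this
  revert g'
  induction g using gl_induction with
  | one => exact h1g
  | unip n g hn ih =>
    refine hmul n g (fun g' => ?_) ih
    have := h.unip n 1 hn .one 1 g'
    rwa [mul_one, mul_one, h1g] at this
  | diag t g ih => exact hmul _ _ (htg t) ih
  | swap p q hpq g ih =>
    refine hmul _ _ ?_ ih
    have hl : (p : ℕ) + 1 < r := hpq ▸ q.2
    obtain rfl : q = ⟨p + 1, hl⟩ := Fin.ext hpq
    exact hswap p hl

theorem IsKPCocycle.unique {sym : Rˣ → Rˣ → A} {χ χ' : GL (Fin r) R → GL (Fin r) R → A}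
    (h : IsKPCocycle sym χ) (h' : IsKPCocycle sym χ') : χ = χ' := by
  funext g g'
  exact div_eq_one.1 ((h.div h').eq_one g g')

end Cocycle

/-! ### Valuation and leading coefficient -/

section Valuation

universe u

variable {k : Type u} [Field k]

theorem val_mul (f g : k⸨X⸩ˣ) : val (f * g) = val f + val g :=
  HahnSeries.order_mul f.ne_zero g.ne_zero

theorem val_one : val (1 : k⸨X⸩ˣ) = 0 := HahnSeries.order_one

theorem val_inv (f : k⸨X⸩ˣ) : val f⁻¹ = - val f := by
  have := val_mul f⁻¹ f
  rw [inv_mul_cancel, val_one] at this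
  omega

theorem val_neg (f : k⸨X⸩ˣ) : val (-f) = val f := HahnSeries.order_neg

theorem val_div (f g : k⸨X⸩ˣ) : val (f / g) = val f - val g := by
  rw [div_eq_mul_inv, val_mul, val_inv, sub_eq_add_neg]

theorem val_prod {ι : Type*} (s : Finset ι) (f : ι → k⸨X⸩ˣ) :
    val (∏ i ∈ s, f i) = ∑ i ∈ s, val (f i) := by
  classical
  induction s using Finset.induction_on with
  | empty => simp [val_one]
  | insert a s ha ih => rw [Finset.prod_insert ha, Finset.sum_insert ha, val_mul, ih]

theorem lc_mul (f g : k⸨X⸩ˣ) : lc (f * g) = lc f * lc g :=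
  Units.ext (HahnSeries.leadingCoeff_mul _ _)

theorem lc_one : lc (1 : k⸨X⸩ˣ) = 1 := Units.ext HahnSeries.leadingCoeff_one

theorem lc_inv (f : k⸨X⸩ˣ) : lc f⁻¹ = (lc f)⁻¹ := by
  rw [eq_inv_iff_mul_eq_one, ← lc_mul, inv_mul_cancel, lc_one]

theorem lc_neg (f : k⸨X⸩ˣ) : lc (-f) = - lc f := Units.ext HahnSeries.leadingCoeff_neg

theorem lc_prod {ι : Type*} (s : Finset ι) (f : ι → k⸨X⸩ˣ) :
    lc (∏ i ∈ s, f i) = ∏ i ∈ s, lc (f i) := by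
  classical
  induction s using Finset.induction_on with
  | empty => simp [lc_one]
  | insert a s ha ih => rw [Finset.prod_insert ha, Finset.prod_insert ha, lc_mul, ih]

/-- The power `ϖ^a` of the uniformizer. -/
noncomputable def unif (k : Type u) [Field k] (a : ℤ) : k⸨X⸩ˣ where
  val := HahnSeries.single a 1
  inv := HahnSeries.single (-a) 1
  val_inv := by simp
  inv_val := by simp

theorem val_unif (a : ℤ) : val (unif k a) = a := HahnSeries.order_single one_ne_zero

theorem lc_unif (a : ℤ) : lc (unif k a) = 1 := Units.ext HahnSeries.leadingCoeff_of_single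

theorem unif_add (a b : ℤ) : unif k (a + b) = unif k a * unif k b :=
  Units.ext (by simp [unif])

theorem unif_zero : unif k 0 = 1 := Units.ext rfl

theorem unif_neg (a : ℤ) : unif k (-a) = (unif k a)⁻¹ := by
  rw [eq_inv_iff_mul_eq_one, ← unif_add, neg_add_cancel, unif_zero]

theorem val_lc_add {a b c : k⸨X⸩ˣ} (h : (c : k⸨X⸩) = a + b) (hab : val a < val b) :
    val c = val a ∧ lc c = lc a := by
  have h1 : HahnSeries.orderTop (a : k⸨X⸩) < HahnSeries.orderTop (b : k⸨X⸩) := by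
    rw [← HahnSeries.order_eq_orderTop_of_ne_zero a.ne_zero,
      ← HahnSeries.order_eq_orderTop_of_ne_zero b.ne_zero]
    exact WithTop.coe_lt_coe.2 hab
  have h2 := HahnSeries.orderTop_add_eq_left h1
  have h3 := HahnSeries.leadingCoeff_add_eq_left h1
  rw [← h] at h2 h3
  refine ⟨?_, Units.ext h3⟩
  rw [← HahnSeries.order_eq_orderTop_of_ne_zero a.ne_zero,
      ← HahnSeries.order_eq_orderTop_of_ne_zero c.ne_zero] at h2
  exact WithTop.coe_injective h2

end Valuation

/-! ### The quadratic Hilbert symbol as a power of the tame symbol -/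

section Hilbert

universe u

variable {k : Type u} [Field k]

/-- Hensel's lemma for X² - f at the root c of the reduction, which is simple since 2c ≠ 0. -/
theorem isSquare_powerSeries (h2 : (2 : k) ≠ 0) (f : PowerSeries k) {c : k} (hc : c ≠ 0)
    (hf : PowerSeries.constantCoeff f = c * c) : IsSquare f := by
  have hI : ∀ g : PowerSeries k, g ∈ Ideal.span {(PowerSeries.X : PowerSeries k)} ↔
      PowerSeries.constantCoeff g = 0 := fun g => by
    rw [Ideal.mem_span_singleton, PowerSeries.X_dvd_iff]
  have h2' : PowerSeries.constantCoeff (2 : PowerSeries k) ≠ 0 := by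
    rwa [map_ofNat]
  obtain ⟨s, hs, -⟩ := HenselianRing.is_henselian (I := Ideal.span {(PowerSeries.X : PowerSeries k)})
    (Polynomial.X ^ 2 - Polynomial.C f) (Polynomial.monic_X_pow_sub_C f two_ne_zero)
    (PowerSeries.C c) (by
      rw [hI]
      simp [hf]
      ring) (by
      refine IsUnit.map _ ?_
      simp only [Polynomial.derivative_sub, Polynomial.derivative_X_pow, Polynomial.derivative_C]
      rw [PowerSeries.isUnit_iff_constantCoeff]
      simp [h2', hc])
  refine ⟨s, ?_⟩
  have : Polynomial.eval s (Polynomial.X ^ 2 - Polynomial.C f) = 0 := hs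
  simp only [Polynomial.eval_sub, Polynomial.eval_pow, Polynomial.eval_X, Polynomial.eval_C] at this
  rw [← sq]
  exact (sub_eq_zero.1 this).symm

theorem isSquare_of_lc (h2 : (2 : k) ≠ 0) (f : k⸨X⸩ˣ) (hv : Even (val f))
    (hl : IsSquare (lc f : k)) : ∃ s : k⸨X⸩ˣ, f = s * s := by
  obtain ⟨a, ha⟩ := hv
  obtain ⟨c, hc⟩ := hl
  have hc0 : c ≠ 0 := by
    rintro rfl
    exact (lc f).ne_zero (hc.trans (mul_zero 0))
  obtain ⟨s, hs⟩ := isSquare_powerSeries h2 (LaurentSeries.powerSeriesPart (f : k⸨X⸩)) hc0 (by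
    rw [← hc, ← PowerSeries.coeff_zero_eq_constantCoeff_apply, LaurentSeries.powerSeriesPart_coeff]
    simp [lc, HahnSeries.leadingCoeff_eq])
  have h1 := LaurentSeries.single_order_mul_powerSeriesPart (f : k⸨X⸩)
  have h3 : (f : k⸨X⸩) = ((unif k a : k⸨X⸩) * (s : k⸨X⸩)) * ((unif k a : k⸨X⸩) * (s : k⸨X⸩)) := by
    rw [← h1, hs, PowerSeries.coe_mul, show (f : k⸨X⸩).order = a + a from ha,
      show (HahnSeries.single (a + a) (1 : k) : k⸨X⸩) = unif k a * unif k a by simp [unif]]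
    ring
  have h4 : (unif k a : k⸨X⸩) * (s : k⸨X⸩) ≠ 0 := by
    intro h
    rw [h, mul_zero] at h3
    exact f.ne_zero h3
  exact ⟨Units.mk0 _ h4, Units.ext h3⟩

/-- The quadratic form `f x² + g y² - z²` is isotropic. -/
def Isotropic (f g : k⸨X⸩ˣ) : Prop :=
  ∃ x y z : k⸨X⸩, (x ≠ 0 ∨ y ≠ 0 ∨ z ≠ 0) ∧ z ^ 2 = (f : k⸨X⸩) * x ^ 2 + (g : k⸨X⸩) * y ^ 2

theorem Isotropic.symm {f g : k⸨X⸩ˣ} (h : Isotropic f g) : Isotropic g f := by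
  obtain ⟨x, y, z, h, h'⟩ := h
  exact ⟨y, x, z, by tauto, by rw [h', add_comm]⟩

/-- Division of z² = f x² + g y² by f gives x² = f (z/f)² + (-g/f) y². When f and g both have odd
valuation, -g/f has even valuation, so the odd case is reduced to the mixed one. -/
theorem isotropic_iff_neg_div (f g : k⸨X⸩ˣ) : Isotropic f g ↔ Isotropic f (-g / f) := by
  have hf := f.ne_zero
  constructor
  · rintro ⟨x, y, z, h, h'⟩
    refine ⟨z / f, y, x, ?_, ?_⟩
    · rcases h with h | h | h
      exacts [Or.inr (Or.inr h), Or.inr (Or.inl h), Or.inl (div_ne_zero h hf)]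
    · have : (((-g / f : k⸨X⸩ˣ)) : k⸨X⸩) = -(g : k⸨X⸩) / f := by
        rw [Units.val_div_eq_div_val, Units.val_neg]
      rw [this]
      field_simp
      linear_combination (-1 : k⸨X⸩) * h'
  · rintro ⟨x, y, z, h, h'⟩
    refine ⟨z, y, f * x, ?_, ?_⟩
    · rcases h with h | h | h
      exacts [Or.inr (Or.inr (mul_ne_zero hf h)), Or.inr (Or.inl h), Or.inl h]
    · have : (((-g / f : k⸨X⸩ˣ)) : k⸨X⸩) = -(g : k⸨X⸩) / f := by
        rw [Units.val_div_eq_div_val, Units.val_neg]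
      rw [this] at h'
      rw [h']
      field_simp
      ring

theorem isotropic_of_even [Fintype k] (hk : ringChar k ≠ 2) (f g : k⸨X⸩ˣ)
    (hf : Even (val f)) (hg : Even (val g)) : Isotropic f g := by
  have h2 : (2 : k) ≠ 0 := Ring.two_ne_zero hk
  obtain ⟨a, ha⟩ := hf
  obtain ⟨b, hb⟩ := hg
  -- A point of the conic lc(f) x² + lc(g) y² = 1 over the finite field. The corresponding power
  -- series has constant term 1, hence is a square.
  obtain ⟨x, y, hxy⟩ := FiniteField.exists_root_sum_quadratic
    (f := Polynomial.C (lc f : k) * Polynomial.X ^ 2 + Polynomial.C 0 * Polynomial.X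
      + Polynomial.C (-1))
    (g := Polynomial.C (lc g : k) * Polynomial.X ^ 2 + Polynomial.C 0 * Polynomial.X
      + Polynomial.C 0)
    (Polynomial.degree_quadratic (lc f).ne_zero) (Polynomial.degree_quadratic (lc g).ne_zero)
    (FiniteField.odd_card_of_char_ne_two hk)
  simp only [Polynomial.eval_add, Polynomial.eval_mul, Polynomial.eval_C, Polynomial.eval_pow,
    Polynomial.eval_X, zero_mul, add_zero] at hxy
  set P := LaurentSeries.powerSeriesPart (f : k⸨X⸩) with hP
  set Q := LaurentSeries.powerSeriesPart (g : k⸨X⸩) with hQ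
  have hP0 : PowerSeries.constantCoeff P = lc f := by
    rw [← PowerSeries.coeff_zero_eq_constantCoeff_apply, LaurentSeries.powerSeriesPart_coeff]
    simp [lc, HahnSeries.leadingCoeff_eq]
  have hQ0 : PowerSeries.constantCoeff Q = lc g := by
    rw [← PowerSeries.coeff_zero_eq_constantCoeff_apply, LaurentSeries.powerSeriesPart_coeff]
    simp [lc, HahnSeries.leadingCoeff_eq]
  obtain ⟨s, hs⟩ := isSquare_powerSeries h2 (P * PowerSeries.C x ^ 2 + Q * PowerSeries.C y ^ 2)
    one_ne_zero (by
      simp [hP0, hQ0]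
      linear_combination hxy)
  have hf' := LaurentSeries.single_order_mul_powerSeriesPart (f : k⸨X⸩)
  have hg' := LaurentSeries.single_order_mul_powerSeriesPart (g : k⸨X⸩)
  rw [show (f : k⸨X⸩).order = a + a from ha,
    show (HahnSeries.single (a + a) (1 : k) : k⸨X⸩) = unif k a * unif k a by simp [unif]] at hf'
  rw [show (g : k⸨X⸩).order = b + b from hb,
    show (HahnSeries.single (b + b) (1 : k) : k⸨X⸩) = unif k b * unif k b by simp [unif]] at hg'
  have ua := (unif k a).ne_zero
  have ub := (unif k b).ne_zero
  have hs' := congrArg (HahnSeries.ofPowerSeries ℤ k) hs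
  simp only [map_add, map_mul, map_pow] at hs'
  set x' := HahnSeries.ofPowerSeries ℤ k (PowerSeries.C x) with hx'
  set y' := HahnSeries.ofPowerSeries ℤ k (PowerSeries.C y) with hy'
  refine ⟨x' / unif k a, y' / unif k b, HahnSeries.ofPowerSeries ℤ k s, ?_, ?_⟩
  · by_contra hcon
    push Not at hcon
    obtain ⟨-, -, h3⟩ := hcon
    have hs0 : s = 0 := HahnSeries.ofPowerSeries_injective (h3.trans (map_zero _).symm)
    have := congrArg PowerSeries.constantCoeff hs
    rw [hs0] at this
    simp [hP0, hQ0] at this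
    exact one_ne_zero (α := k) (by linear_combination this - hxy)
  · rw [sq, ← hs', ← hf', ← hg', ← hP, ← hQ]
    field_simp

/-- The valuations of z² and f x² are even and that of g y² is odd. In a nontrivial solution the
leading terms of z² and f x² must therefore agree, which makes lc f a square. Conversely f is then
itself a square. -/
theorem isotropic_iff_of_even_odd (h2 : (2 : k) ≠ 0) (f g : k⸨X⸩ˣ) (hf : Even (val f))
    (hg : Odd (val g)) : Isotropic f g ↔ IsSquare (lc f : k) := by
  constructor
  · rintro ⟨x, y, z, h, h'⟩
    have vsq : ∀ u v : k⸨X⸩ˣ, val (u * v ^ 2) = val u + 2 * val v := fun u v => by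
      rw [sq, val_mul, val_mul]; ring
    have lsq : ∀ u v : k⸨X⸩ˣ, lc (u * v ^ 2) = lc u * (lc v * lc v) := fun u v => by
      rw [sq, lc_mul, lc_mul]
    have key : ∀ z x : k⸨X⸩ˣ, lc (1 * z ^ 2) = lc (f * x ^ 2) → IsSquare (lc f : k) := by
      intro z x hzx
      rw [lsq, lsq, lc_one, one_mul] at hzx
      have h3 : lc f = (lc z / lc x) * (lc z / lc x) := by
        rw [div_mul_div_comm, hzx, mul_div_cancel_right]
      exact ⟨_, by rw [← Units.val_mul, ← h3]⟩
    rcases eq_or_ne z 0 with rfl | hz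
    · by_cases hx : x = 0
      · subst hx
        have : y = 0 := by simpa using h'.symm
        simp [this] at h
      · have hy : y ≠ 0 := by
          rintro rfl
          exact hx (by simpa using h'.symm)
        exfalso
        have e : f * Units.mk0 x hx ^ 2 = -(g * Units.mk0 y hy ^ 2) := by
          ext1
          push_cast
          simp only [Units.val_mk0]
          linear_combination -h'
        have := congrArg val e
        rw [val_neg, vsq, vsq] at this
        obtain ⟨a, ha⟩ := hf
        obtain ⟨b, hb⟩ := hg
        omega
    · by_cases hy : y = 0
      · subst hy
        have hx : x ≠ 0 := by
          rintro rfl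
          exact hz (by simpa using h')
        refine key (Units.mk0 z hz) (Units.mk0 x hx) (congrArg lc (Units.ext ?_))
        push_cast
        simpa using h'
      · by_cases hx : x = 0
        · subst hx
          exfalso
          have e : 1 * Units.mk0 z hz ^ 2 = g * Units.mk0 y hy ^ 2 := by
            ext1
            push_cast
            simpa using h'
          have := congrArg val e
          rw [vsq, vsq, val_one] at this
          obtain ⟨b, hb⟩ := hg
          omega
        · have e : ((1 * Units.mk0 z hz ^ 2 : k⸨X⸩ˣ) : k⸨X⸩)
              = (f * Units.mk0 x hx ^ 2 : k⸨X⸩ˣ) + (g * Units.mk0 y hy ^ 2 : k⸨X⸩ˣ) := by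
            push_cast
            simpa using h'
          have h1 := vsq 1 (Units.mk0 z hz)
          have h2 := vsq f (Units.mk0 x hx)
          have h3 := vsq g (Units.mk0 y hy)
          rw [val_one] at h1
          obtain ⟨a, ha⟩ := hf
          obtain ⟨b, hb⟩ := hg
          rcases lt_or_ge (val (f * Units.mk0 x hx ^ 2)) (val (g * Units.mk0 y hy ^ 2)) with hlt | hge
          · exact key _ _ (val_lc_add e hlt).2
          · have hlt : val (g * Units.mk0 y hy ^ 2) < val (f * Units.mk0 x hx ^ 2) := by omega
            rw [add_comm] at e
            have := (val_lc_add e hlt).1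
            omega
  · intro h
    obtain ⟨s, hs⟩ := isSquare_of_lc h2 f hf h
    exact ⟨1, 0, s, Or.inl one_ne_zero, by rw [hs, sq]; simp⟩

variable [Fintype k] [DecidableEq k]

theorem quadraticChar_eq_one_iff (u : kˣ) :
    (quadraticChar k).toUnitHom u = 1 ↔ IsSquare (u : k) := by
  rw [← quadraticChar_one_iff_isSquare u.ne_zero, ← MulChar.coe_toUnitHom, Units.val_eq_one]

theorem intUnits_zpow_even (u : ℤˣ) {n : ℤ} (h : Even n) : u ^ n = 1 := by
  obtain ⟨m, rfl⟩ := h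
  rw [zpow_add, Int.units_mul_self]

theorem intUnits_zpow_odd (u : ℤˣ) {n : ℤ} (h : Odd n) : u ^ n = u := by
  obtain ⟨m, rfl⟩ := h
  rw [zpow_add, intUnits_zpow_even u (even_two_mul m), one_mul, zpow_one]

theorem hilbert_eq_iff (f g : k⸨X⸩ˣ) (u : kˣ) (h : Isotropic f g ↔ IsSquare (u : k)) :
    hilbert f g = (quadraticChar k).toUnitHom u := by
  by_cases h3 : Isotropic f g
  · exact (if_pos h3).trans ((quadraticChar_eq_one_iff u).2 (h.1 h3)).symm
  · exact (if_neg h3).trans ((Int.units_eq_one_or _).resolve_left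
      fun h4 => h3 (h.2 ((quadraticChar_eq_one_iff u).1 h4))).symm

/-- Both sides depend on the parities of the valuations. For two even ones both are 1, in the mixed
cases both test whether one leading coefficient is a square, and two odd ones reduce to a mixed case
with -g/f. -/
theorem hilbert_eq (hk : ringChar k ≠ 2) (f g : k⸨X⸩ˣ) :
    hilbert f g = (quadraticChar k).toUnitHom (tame f g) := by
  have h2 : (2 : k) ≠ 0 := Ring.two_ne_zero hk
  set ζ := (quadraticChar k).toUnitHom with hζ
  have ζsq : ∀ a b : kˣ, ζ (a / b) = ζ (a * b) := fun a b => by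
    rw [map_div, map_mul, Int.units_div_eq_mul]
  have ht : ζ (tame f g) = ζ (-1) ^ (val f * val g) * (ζ (lc f) ^ val g * ζ (lc g) ^ val f) := by
    rw [tame, map_mul, ζsq, map_mul, map_zpow, map_zpow, map_zpow]
  rw [ht]
  rcases Int.even_or_odd (val f) with hf | hf <;> rcases Int.even_or_odd (val g) with hg | hg
  · rw [intUnits_zpow_even _ hf, intUnits_zpow_even _ hg, intUnits_zpow_even _ (hf.mul_right _),
      hilbert_eq_iff f g 1 (iff_of_true (isotropic_of_even hk f g hf hg) (by simp)), map_one]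
    simp
  · rw [intUnits_zpow_even _ hf, intUnits_zpow_odd _ hg, intUnits_zpow_even _ (hf.mul_right _),
      hilbert_eq_iff f g (lc f) (isotropic_iff_of_even_odd h2 f g hf hg)]
    simp [hζ]
  · rw [intUnits_zpow_odd _ hf, intUnits_zpow_even _ hg, intUnits_zpow_even _ (hg.mul_left _),
      hilbert_eq_iff f g (lc g) ((⟨.symm, .symm⟩ : Isotropic f g ↔ Isotropic g f).trans
        (isotropic_iff_of_even_odd h2 g f hg hf))]
    simp [hζ]
  · have hv : Even (val (-g / f)) := by
      rw [val_div, val_neg]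
      exact hg.sub_odd hf
    rw [intUnits_zpow_odd _ hf, intUnits_zpow_odd _ hg, intUnits_zpow_odd _ (hf.mul hg),
      hilbert_eq_iff f g (lc (-g / f)) ((isotropic_iff_neg_div f g).trans
        ((⟨.symm, .symm⟩ : Isotropic f (-g / f) ↔ Isotropic (-g / f) f).trans
        (isotropic_iff_of_even_odd h2 _ f hv hf))), ← hζ, div_eq_mul_inv, lc_mul, lc_inv, lc_neg,
      ← div_eq_mul_inv, ζsq, neg_eq_neg_one_mul, map_mul, map_mul, mul_assoc, mul_comm (ζ (lc g))]

end Hilbert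

/-! ### The geometric extension is a central extension -/

section GeoGroup

universe u

variable {k : Type u} [Field k] {r : ℕ}

theorem geoRel_equivalence : Equivalence (geoRel (k := k) (r := r)) where
  refl p := ⟨1, (ACK.smul_one _).symm, (ACK.smul_one _).symm⟩
  symm := by
    rintro p q ⟨z, h1, h2⟩
    exact ⟨z⁻¹, by rw [h1, ACK.smul_smul, inv_mul_cancel, ACK.smul_one],
      by rw [h2, ACK.smul_smul, inv_mul_cancel, ACK.smul_one]⟩
  trans := by
    rintro p q s ⟨z, h1, h2⟩ ⟨w, h3, h4⟩
    exact ⟨w * z, by rw [h3, h1, ACK.smul_smul], by rw [h4, h2, ACK.smul_smul]⟩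

theorem Geo.mk_eq_iff {p q : GeoPre k r} : Geo.mk p = Geo.mk q ↔ geoRel p q := by
  exact Quot.eq.trans geoRel_equivalence.eqvGen_iff

/-- The element `a ⊗ b⁻¹` of the geometric extension. -/
def Geo.pair (a : ACK k 1) (b : ACK k r) (h : a.g = detGL1 b.g) : Geo k r := Geo.mk ⟨(a, b), h⟩

theorem Geo.exists_pair (x : Geo k r) : ∃ a b h, x = Geo.pair a b h := by
  induction x using Quot.ind with
  | mk p => exact ⟨p.1.1, p.1.2, p.2, rfl⟩

theorem Geo.pair_mul {a a' : ACK k 1} {b b' : ACK k r} (h : a.g = detGL1 b.g)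
    (h' : a'.g = detGL1 b'.g) : Geo.pair a b h * Geo.pair a' b' h'
      = Geo.pair (a * a') (b * b') (by rw [ACK.mul_g, ACK.mul_g, h, h', detGL1_mul]) := rfl

theorem Geo.pair_congr {a a' : ACK k 1} {b b' : ACK k r} (h : a.g = detGL1 b.g) (ha : a = a')
    (hb : b = b') : Geo.pair a b h = Geo.pair a' b' (by rw [← ha, ← hb, h]) := by
  subst ha hb
  rfl

theorem Geo.incl_mul_pair (z : kˣ) {a : ACK k 1} {b : ACK k r} (h : a.g = detGL1 b.g) :
    Geo.incl k r z * Geo.pair a b h = Geo.pair (ACK.smul z a) b h := by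
  refine (Geo.pair_mul (a := ACK.incl k 1 z) (b := ACK.one k r) detGL1_one.symm h).trans ?_
  exact Geo.pair_congr _ (ACK.incl_mul z a) (one_mul b)

theorem Geo.pair_mul_incl (z : kˣ) {a : ACK k 1} {b : ACK k r} (h : a.g = detGL1 b.g) :
    Geo.pair a b h * Geo.incl k r z = Geo.pair (ACK.smul z a) b h := by
  refine (Geo.pair_mul h (a' := ACK.incl k 1 z) (b' := ACK.one k r) detGL1_one.symm).trans ?_
  refine Geo.pair_congr _ ?_ (mul_one b)
  rw [ACK.incl, ACK.mul_smul]
  exact congrArg _ (mul_one a)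

/-- The second factor enters by its inverse, so scalars in G̃'_r count with the opposite sign. All
cocycle computations below end with this quotient. -/
theorem Geo.pair_smul_smul (z w : kˣ) {a : ACK k 1} {b : ACK k r} (h : a.g = detGL1 b.g) :
    Geo.pair (ACK.smul z a) (ACK.smul w b) h = Geo.incl k r (z / w) * Geo.pair a b h := by
  rw [Geo.incl_mul_pair]
  refine Geo.mk_eq_iff.2 ⟨w⁻¹, ?_, ?_⟩
  · change _ = ACK.smul w⁻¹ (ACK.smul z a)
    rw [ACK.smul_smul, div_eq_inv_mul]
  · change _ = ACK.smul w⁻¹ (ACK.smul w b)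
    rw [ACK.smul_smul, inv_mul_cancel, ACK.smul_one]

noncomputable instance : One (Geo k r) := ⟨Geo.pair 1 1 detGL1_one.symm⟩

theorem Geo.incl_one : Geo.incl k r 1 = 1 :=
  Geo.pair_congr (a := ACK.incl k 1 1) (b := ACK.one k r) detGL1_one.symm
    (ACK.smul_one _) rfl

theorem Geo.exists_inv (x : Geo k r) : ∃ y, y * x = 1 := by
  obtain ⟨a, b, h, rfl⟩ := x.exists_pair
  have h' : (a⁻¹).g = detGL1 (b⁻¹).g := by
    change (a.g)⁻¹ = detGL1 (b.g)⁻¹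
    rw [h, inv_eq_iff_mul_eq_one, ← detGL1_mul, mul_inv_cancel, detGL1_one]
  refine ⟨Geo.pair a⁻¹ b⁻¹ h', ?_⟩
  rw [Geo.pair_mul]
  exact Geo.pair_congr _ (inv_mul_cancel a) (inv_mul_cancel b)

noncomputable instance : Inv (Geo k r) := ⟨fun x => Classical.choose x.exists_inv⟩

theorem Geo.mul_assoc' (x y z : Geo k r) : x * y * z = x * (y * z) := by
  obtain ⟨a, b, h, rfl⟩ := x.exists_pair
  obtain ⟨a', b', h', rfl⟩ := y.exists_pair
  obtain ⟨a'', b'', h'', rfl⟩ := z.exists_pair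
  simp only [Geo.pair_mul]
  exact Geo.pair_congr _ (mul_assoc _ _ _) (mul_assoc _ _ _)

noncomputable instance : Group (Geo k r) :=
  { (inferInstance : Mul (Geo k r)), (inferInstance : One (Geo k r)),
    (inferInstance : Inv (Geo k r)) with
    mul_assoc := Geo.mul_assoc'
    one_mul := fun x => by
      obtain ⟨a, b, h, rfl⟩ := x.exists_pair
      exact (Geo.pair_mul detGL1_one.symm h).trans
        (Geo.pair_congr _ (one_mul a) (one_mul b))
    mul_one := fun x => by
      obtain ⟨a, b, h, rfl⟩ := x.exists_pair
      exact (Geo.pair_mul h detGL1_one.symm).trans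
        (Geo.pair_congr _ (mul_one a) (mul_one b))
    inv_mul_cancel := fun x => Classical.choose_spec x.exists_inv }

theorem Geo.proj_mul (x y : Geo k r) : (x * y).proj = x.proj * y.proj := by
  obtain ⟨a, b, h, rfl⟩ := x.exists_pair
  obtain ⟨a', b', h', rfl⟩ := y.exists_pair
  rfl

theorem Geo.incl_mul_comm (z : kˣ) (x : Geo k r) :
    Geo.incl k r z * x = x * Geo.incl k r z := by
  obtain ⟨a, b, h, rfl⟩ := x.exists_pair
  rw [Geo.incl_mul_pair, Geo.pair_mul_incl]

theorem Geo.incl_mul (z w : kˣ) : Geo.incl k r (z * w) = Geo.incl k r z * Geo.incl k r w := by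
  refine Eq.trans ?_ (Geo.incl_mul_pair z (a := ACK.incl k 1 w) (b := ACK.one k r) _).symm
  exact Geo.pair_congr (a := ACK.incl k 1 (z * w)) (b := ACK.one k r) detGL1_one.symm
    (ACK.smul_smul _ _ _).symm rfl

theorem Geo.incl_injective : Function.Injective (Geo.incl k r) := by
  intro z w h
  obtain ⟨c, h1, h2⟩ := Geo.mk_eq_iff.1 h
  have h3 : c = 1 := ACK.smul_left_injective (ACK.one k r)
    (h2.symm.trans (ACK.smul_one _).symm)
  subst h3
  change ACK.incl k 1 w = ACK.smul 1 (ACK.incl k 1 z) at h1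
  rw [ACK.smul_one] at h1
  exact (ACK.smul_left_injective _ h1).symm

theorem Geo.exists_incl_mul {x y : Geo k r} (h : x.proj = y.proj) :
    ∃ z, y = Geo.incl k r z * x := by
  obtain ⟨a, b, hx, rfl⟩ := x.exists_pair
  obtain ⟨a', b', hy, rfl⟩ := y.exists_pair
  change b.g = b'.g at h
  obtain ⟨z, rfl⟩ := ACK.exists_smul_eq h
  obtain ⟨w, rfl⟩ := ACK.exists_smul_eq (hx.trans ((congrArg detGL1 h).trans hy.symm))
  exact ⟨_, Geo.pair_smul_smul w z hx⟩

theorem Geo.proj_incl (z : kˣ) : (Geo.incl k r z).proj = 1 := rfl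

/-- The embedding `k^* → G̃_{r,geo}`, as a homomorphism. -/
noncomputable def Geo.inclHom (k : Type u) [Field k] (r : ℕ) : kˣ →* Geo k r where
  toFun := Geo.incl k r
  map_one' := Geo.incl_one
  map_mul' := Geo.incl_mul

/-- The projection `G̃_{r,geo} → GL_r(F)`, as a homomorphism. -/
def Geo.projHom (k : Type u) [Field k] (r : ℕ) : Geo k r →* GL (Fin r) k⸨X⸩ where
  toFun := Geo.proj
  map_one' := rfl
  map_mul' := Geo.proj_mul

theorem Geo.proj_inv (x : Geo k r) : (x⁻¹).proj = (x.proj)⁻¹ := map_inv (Geo.projHom k r) x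

theorem Geo.isCentralExtension (k : Type u) [Field k] (r : ℕ) :
    IsCentralExtension (Geo.incl k r) (Geo.proj : Geo k r → GL (Fin r) k⸨X⸩) where
  assoc := Geo.mul_assoc'
  one_mul x := by rw [Geo.incl_one, one_mul]
  inv_mul x := ⟨x⁻¹, by rw [Geo.incl_one, inv_mul_cancel]⟩
  incl_mul := Geo.incl_mul
  incl_injective := Geo.incl_injective
  central := Geo.incl_mul_comm
  proj_mul := Geo.proj_mul
  proj_surjective g := by
    obtain ⟨b, hb⟩ := exists_ack g
    obtain ⟨a, ha⟩ := exists_ack (detGL1 g)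
    exact ⟨Geo.pair a b (by rw [ha, hb]), hb⟩
  exact x := by
    constructor
    · intro h
      obtain ⟨z, hz⟩ := Geo.exists_incl_mul (x := 1) (y := x) h.symm
      exact ⟨z, by rw [hz, mul_one]⟩
    · rintro ⟨z, rfl⟩
      rfl

end GeoGroup

/-! ### The canonical splitting over GL_r(O) -/

section Integral

universe u

variable {k : Type u} [Field k] {r : ℕ}

/-- The stabilizer `GL_r(O)` of the standard lattice. -/
noncomputable def intGL (k : Type u) [Field k] (r : ℕ) : Subgroup (GL (Fin r) k⸨X⸩) where
  carrier := {u | act u (stdLat k r) = stdLat k r}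
  one_mem' := act_one _
  mul_mem' {a b} ha hb := by
    change act (a * b) _ = _
    rw [← act_mul]
    change act a (act b _) = _
    have ha' : act a (stdLat k r) = stdLat k r := ha
    have hb' : act b (stdLat k r) = stdLat k r := hb
    rw [hb', ha']
  inv_mem' {a} ha := by
    change act a⁻¹ _ = _
    have h : act a⁻¹ (act a (stdLat k r)) = stdLat k r := by
      rw [act, act_mul, inv_mul_cancel, act_one]
    have ha' : act a (stdLat k r) = stdLat k r := ha
    rwa [ha'] at h

theorem mem_intGL {u : GL (Fin r) k⸨X⸩} : u ∈ intGL k r ↔ act u (stdLat k r) = stdLat k r := Iff.rfl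

theorem act_std_le_std {g : GL (Fin r) k⸨X⸩}
    (hg : ∀ i j, ∀ n < 0, HahnSeries.coeff (g.val i j) n = 0) :
    act g (stdLat k r) ≤ stdLat k r := by
  intro y hy i n hn
  obtain ⟨x, hx, rfl⟩ := Submodule.mem_map.1 hy
  change HahnSeries.coeff (∑ j, g.val i j * x j) n = 0
  rw [HahnSeries.coeff_sum]
  refine Finset.sum_eq_zero fun j _ => ?_
  rw [HahnSeries.coeff_mul]
  refine Finset.sum_eq_zero fun ab hab => ?_
  rw [Finset.mem_antidiagonal] at hab
  obtain ⟨ha, hb, hab⟩ := hab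
  rcases lt_or_ge ab.1 0 with h | h
  · rw [hg i j _ h, zero_mul]
  · rw [hx j ab.2 (by omega), mul_zero]

theorem mem_intGL_of_integral {g : GL (Fin r) k⸨X⸩}
    (hg : ∀ i j, ∀ n < 0, HahnSeries.coeff (g.val i j) n = 0)
    (hg' : ∀ i j, ∀ n < 0, HahnSeries.coeff ((g⁻¹).val i j) n = 0) : g ∈ intGL k r := by
  refine le_antisymm (act_std_le_std hg) ?_
  have h1 := Submodule.map_mono (f := (glEquiv g).toLinearMap) (act_std_le_std hg')
  rwa [act_mul, mul_inv_cancel, act_one] at h1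

theorem coeff_one_of_neg {n : ℤ} (hn : n < 0) : HahnSeries.coeff (1 : k⸨X⸩) n = 0 := by
  rw [HahnSeries.coeff_one, if_neg hn.ne]

theorem coeff_eq_zero_of_lt_val (t : k⸨X⸩ˣ) {n : ℤ} (hn : n < val t) :
    HahnSeries.coeff (t : k⸨X⸩) n = 0 := HahnSeries.coeff_eq_zero_of_lt_order hn

theorem permGL_mem_intGL (w : Equiv.Perm (Fin r)) : permGL w ∈ intGL k r := by
  have h : ∀ w : Equiv.Perm (Fin r), ∀ i j, ∀ n < 0,
      HahnSeries.coeff ((permGL w : GL (Fin r) k⸨X⸩).val i j) n = 0 := by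
    intro w i j n hn
    change HahnSeries.coeff (if i = w j then (1 : k⸨X⸩) else 0) n = 0
    split_ifs
    exacts [coeff_one_of_neg hn, rfl]
  exact mem_intGL_of_integral (h w) (by rw [permGL_inv]; exact h _)

theorem diagGL_mem_intGL {t : Fin r → k⸨X⸩ˣ} (ht : ∀ i, val (t i) = 0) : diagGL t ∈ intGL k r := by
  have h : ∀ t : Fin r → k⸨X⸩ˣ, (∀ i, val (t i) = 0) → ∀ i j, ∀ n < 0,
      HahnSeries.coeff ((diagGL t : GL (Fin r) k⸨X⸩).val i j) n = 0 := by
    intro t ht i j n hn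
    change HahnSeries.coeff (Matrix.diagonal (fun i => (t i : k⸨X⸩)) i j) n = 0
    rw [Matrix.diagonal_apply]
    split_ifs
    exacts [coeff_eq_zero_of_lt_val _ (by rwa [ht]), rfl]
  refine mem_intGL_of_integral (h t ht) ?_
  rw [diagGL_inv]
  exact h _ fun i => by rw [Pi.inv_apply, val_inv, ht, neg_zero]

theorem elemGL_mem_intGL {i j : Fin r} (hij : i ≠ j) {a : k⸨X⸩}
    (ha : ∀ n < 0, HahnSeries.coeff a n = 0) : elemGL hij a ∈ intGL k r := by
  have h : ∀ a : k⸨X⸩, (∀ n < 0, HahnSeries.coeff a n = 0) → ∀ x y, ∀ n < 0,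
      HahnSeries.coeff ((elemGL hij a : GL (Fin r) k⸨X⸩).val x y) n = 0 := by
    intro a ha x y n hn
    rw [elemGL_apply, HahnSeries.coeff_add]
    split_ifs <;> simp [ha n hn, hn.ne]
  refine mem_intGL_of_integral (h a ha) ?_
  rw [elemGL_inv]
  exact h _ fun n hn => by rw [HahnSeries.coeff_neg, ha n hn, neg_zero]

/-- The canonical splitting of `G̃'_r` over `GL_r(O)`. -/
noncomputable def kapFun (u : intGL k r) : ACK k r :=
  ⟨u.1, Rel.cast (mem_intGL.1 u.2).symm (LinearEquiv.refl k _)⟩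

theorem kapFun_sends (u : intGL k r) {M : Submodule k (Fin r → k⸨X⸩)} (hM : M ≤ stdLat k r)
    {l : List (Fin r → k⸨X⸩)} (hl : IsFrame (stdLat k r) M l) :
    Rel.Sends (kapFun u).v M l l 1 := Rel.sends_cast_refl _ hM hl

/-- Right multiplication by u in GL_r(O) changes neither the lattice nor the element of the line,
since the canonical lift is the identity in every frame of O^r. -/
theorem mul_kapFun_sends {a : ACK k r} (u : intGL k r) {M : Submodule k (Fin r → k⸨X⸩)}
    {l l' : List (Fin r → k⸨X⸩)} {c : kˣ} (h : Rel.Sends a.v M l l' c) :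
    Rel.Sends (a * kapFun u).v M l l' c := by
  have e1 : (act a.g⁻¹ M).map (glEquiv a.g).toLinearMap = M := by
    rw [act_mul, mul_inv_cancel, act_one]
  have e2 : (act a.g (stdLat k r)).map (glEquiv a.g⁻¹).toLinearMap = stdLat k r := by
    rw [act_mul, inv_mul_cancel, act_one]
  have h1 : (l'.map (glEquiv a.g⁻¹)).map (glEquiv a.g) = l' := by
    rw [← map_glEquiv_mul, mul_inv_cancel, map_glEquiv_one]
  have h2 : act a.g⁻¹ M ≤ stdLat k r := by
    rw [← e2]
    exact Submodule.map_mono (h.le.trans inf_le_right)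
  have h3 := ACK.mul_sends e1 (h1.symm ▸ h) (kapFun_sends u h2 (h.right.map _ e2 rfl))
  rwa [h1, mul_one] at h3

/-- Left multiplication, in contrast, translates both frames by u. Commutators with the canonical
lift are therefore quotients of determinants of u on the two quotients. -/
theorem kapFun_mul_sends {a : ACK k r} (u : intGL k r) {M : Submodule k (Fin r → k⸨X⸩)}
    {l l' : List (Fin r → k⸨X⸩)} {c : kˣ} (h : Rel.Sends a.v M l l' c) :
    Rel.Sends (kapFun u * a).v (act u.1 M) (l.map (glEquiv u.1)) (l'.map (glEquiv u.1)) c := by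
  have h1 : act u.1 M ≤ stdLat k r := by
    rw [← mem_intGL.1 u.2]
    exact Submodule.map_mono (h.le.trans inf_le_left)
  have h2 := ACK.mul_sends (a := kapFun u) (M' := M) rfl
    (kapFun_sends u h1 (h.left.map _ (mem_intGL.1 u.2) rfl)) h
  rwa [one_mul] at h2

/-- The canonical splitting of `G̃'_r` over `GL_r(O)`, as a homomorphism. -/
noncomputable def kap (k : Type u) [Field k] (r : ℕ) : intGL k r →* ACK k r :=
  MonoidHom.mk' kapFun fun u u' => by
    obtain ⟨M, l, l', c, h⟩ := (1 : ACK k r).exists_frames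
    have hM := h.le.trans inf_le_left
    exact ACK.ext_sends rfl (kapFun_sends (u * u') hM h.left)
      (mul_kapFun_sends u' (kapFun_sends u hM h.left))

theorem kap_g (u : intGL k r) : (kap k r u).g = u.1 := rfl

end Integral

/-! ### Lifts of unipotent elements, characterised by p-power order -/

section UnipotentLift

universe u

variable {k : Type u} [Field k] {r : ℕ}

/-- The order of `x` is a power of the characteristic of `k`. -/
def IsPTor (k : Type u) [Field k] {E : Type*} [Monoid E] (x : E) : Prop :=
  ∃ s : ℕ, x ^ (ringChar k ^ s) = 1

theorem IsPTor.conj {E : Type*} [Group E] {x : E} (hx : IsPTor k x) (y : E) :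
    IsPTor k (y * x * y⁻¹) := by
  obtain ⟨s, hs⟩ := hx
  exact ⟨s, by rw [conj_pow, hs, mul_one, mul_inv_cancel]⟩

theorem IsPTor.map {E E' : Type*} [Monoid E] [Monoid E'] {x : E} (hx : IsPTor k x) (f : E →* E') :
    IsPTor k (f x) := by
  obtain ⟨s, hs⟩ := hx
  exact ⟨s, by rw [← map_pow, hs, map_one]⟩

theorem isPTor_one {E : Type*} [Monoid E] : IsPTor k (1 : E) := ⟨0, one_pow _⟩

theorem ringChar_prime [Finite k] : (ringChar k).Prime :=
  CharP.char_is_prime k (ringChar k)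

/-- In characteristic p, (z - 1)^(p^s) = z^(p^s) - 1. -/
theorem eq_one_of_isPTor [Finite k] {z : kˣ} (h : IsPTor k z) : z = 1 := by
  obtain ⟨s, hs⟩ := h
  have : Fact (ringChar k).Prime := ⟨ringChar_prime⟩
  have h1 : ((z : k) - 1) ^ (ringChar k ^ s) = 0 := by
    rw [sub_pow_char_pow, one_pow, sub_eq_zero, ← Units.val_pow_eq_pow_val, hs, Units.val_one]
  exact Units.ext (sub_eq_zero.1 (eq_zero_of_pow_eq_zero h1))

/-- Two lifts of the same element differ by a central scalar. If both have p-power order then so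
does the scalar, which is then 1. -/
theorem Geo.eq_of_isPTor [Finite k] {x y : Geo k r} (h : x.proj = y.proj) (hx : IsPTor k x)
    (hy : IsPTor k y) : x = y := by
  obtain ⟨z, rfl⟩ := Geo.exists_incl_mul h
  suffices z = 1 by rw [this, Geo.incl_one, one_mul]
  obtain ⟨s, hs⟩ := hx
  obtain ⟨t, ht⟩ := hy
  refine eq_one_of_isPTor ⟨s + t, Geo.incl_injective (r := r) ?_⟩
  have h1 : (Geo.incl k r z * x) ^ (ringChar k ^ (s + t)) = 1 := by
    rw [pow_add, mul_comm, pow_mul, ht, one_pow]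
  have h2 : x ^ (ringChar k ^ (s + t)) = 1 := by
    rw [pow_add, pow_mul, hs, one_pow]
  rw [Commute.mul_pow (Geo.incl_mul_comm z x), h2, mul_one] at h1
  rw [Geo.incl_one]
  exact (map_pow (Geo.inclHom k r) z _).trans h1

theorem IsUnip.isPTor [Finite k] {n : GL (Fin r) k⸨X⸩} (hn : IsUnip n) : IsPTor k n := by
  have hp : Fact (ringChar k).Prime := ⟨ringChar_prime⟩
  have : CharP k⸨X⸩ (ringChar k) := charP_of_injective_algebraMap
    (algebraMap k k⸨X⸩).injective (ringChar k)
  have h1 : n.val.charpoly = (Polynomial.X - Polynomial.C 1) ^ r := by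
    rw [Matrix.charpoly_of_isUpperTriangular n.val hn.blockTriangular]
    simp [hn.1]
  have h2 := Matrix.aeval_self_charpoly n.val
  -- By Cayley–Hamilton (n - 1)^r = 0, and p^r ≥ r, so n^(p^r) - 1 = (n - 1)^(p^r) = 0.
  refine ⟨r, Units.ext ?_⟩
  have h3 : (Polynomial.X - Polynomial.C 1 : Polynomial k⸨X⸩) ^ (ringChar k ^ r)
      = (Polynomial.X - Polynomial.C 1) ^ (ringChar k ^ r - r)
        * (Polynomial.X - Polynomial.C 1) ^ r := by
    rw [← pow_add, Nat.sub_add_cancel (Nat.lt_pow_self hp.out.one_lt).le]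
  have h4 := congrArg (Polynomial.aeval n.val) h3
  rw [map_mul, ← h1, h2, mul_zero, sub_pow_char_pow, ← map_pow, one_pow, map_sub, map_pow,
    Polynomial.aeval_X, map_one, map_one, sub_eq_zero] at h4
  rw [Units.val_pow_eq_pow_val, h4, Units.val_one]

theorem conj_mem_intGL {g h : GL (Fin r) k⸨X⸩}
    (hL : act g (act h (stdLat k r)) = act h (stdLat k r)) : h⁻¹ * g * h ∈ intGL k r := by
  have h1 : ∀ (a b : GL (Fin r) k⸨X⸩) A, act a (act b A) = act (a * b) A := act_mul
  rw [mem_intGL, mul_assoc, ← h1, ← h1, hL, h1, inv_mul_cancel, act_one]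

/-- With a = (h, v), the element v ⊗ n(v⁻¹) is the conjugate by a of the canonical lift of h⁻¹ n h,
an element of GL_r(O) because n preserves the lattice h O^r. -/
theorem unipLift_aux {x a : ACK k r}
    (hL : act x.g (act a.g (stdLat k r)) = act a.g (stdLat k r))
    (hL' : act a.g (stdLat k r) = act x.g (act a.g (stdLat k r)))
    (hv : x.v = Rel.compLat isLat_std (isLat_act a.g) (isLat_act x.g) a.v
        (Rel.map (glEquiv x.g) hL rfl (LinearEquiv.symm a.v))) :
    x * a = a * kapFun ⟨_, conj_mem_intGL hL⟩ := by
  have hc : ∀ (a b : GL (Fin r) k⸨X⸩) A, act a (act b A) = act (a * b) A := act_mul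
  obtain ⟨M, hM⟩ : ∃ M, M = stdLat k r ⊓ act a.g (stdLat k r) ⊓ act x.g (stdLat k r) := ⟨_, rfl⟩
  have hf : ∀ {P}, IsLat P → FiniteDimensional k (SubQ P M) := fun hP => hM ▸
    finite_subQ_inf (finite_subQ_inf (hP.finite isLat_std)
      (hP.finite (isLat_act _))) (hP.finite (isLat_act _))
  have hM1 : M ≤ stdLat k r := hM ▸ inf_le_left.trans inf_le_left
  have hM2 : M ≤ act a.g (stdLat k r) := hM ▸ inf_le_left.trans inf_le_right
  have hM3 : M ≤ act x.g (stdLat k r) := hM ▸ inf_le_right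
  have e1 : act x.g (act x.g⁻¹ M) = M := by rw [hc, mul_inv_cancel, act_one]
  have e2 : act x.g⁻¹ (act x.g (stdLat k r)) = stdLat k r := by rw [hc, inv_mul_cancel, act_one]
  have e3 : act x.g⁻¹ (act a.g (stdLat k r)) = act a.g (stdLat k r) := by
    conv_lhs => rw [hL']
    rw [hc, inv_mul_cancel, act_one]
  have hM1' : act x.g⁻¹ M ≤ stdLat k r := (Submodule.map_mono hM3).trans e2.le
  have hM2' : act x.g⁻¹ M ≤ act a.g (stdLat k r) := (Submodule.map_mono hM2).trans e3.le
  obtain ⟨l, hl⟩ := IsFrame.exists_frame _ _ (hf isLat_std)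
  obtain ⟨b, hb⟩ := IsFrame.exists_frame _ _ (hf (isLat_act x.g))
  obtain ⟨d, hd⟩ := IsFrame.exists_frame _ _ (hf (isLat_act a.g))
  have hl0 := hb.map (glEquiv x.g⁻¹) e2 rfl
  have hl1 := hd.map (glEquiv x.g⁻¹) e3 rfl
  obtain ⟨c', hc'⟩ := Rel.exists_sends a.v (le_inf hM1' hM2') hl0 hl1
  obtain ⟨c, hc⟩ := Rel.exists_sends a.v (le_inf hM1 hM2) hl (hl1.map (glEquiv x.g) hL e1)
  have h0 := hc'.symm.map (glEquiv x.g) hL rfl e1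
  have h1 := hc.compLat isLat_std (isLat_act a.g) (isLat_act x.g) h0
  replace h1 : x.v.Sends M l ((b.map (glEquiv x.g⁻¹)).map (glEquiv x.g)) (c * c'⁻¹) := hv.symm ▸ h1
  have h2 := ACK.mul_sends (a := x) (b := a) e1 h1 hc'
  rw [inv_mul_cancel_right] at h2
  have h3 := mul_kapFun_sends (a := a) ⟨_, conj_mem_intGL hL⟩ hc
  refine ACK.ext_sends ?_ h2 h3
  change x.g * a.g = a.g * (a.g⁻¹ * x.g * a.g)
  group

theorem IsUnipLift.mul_eq {n : GL (Fin r) k⸨X⸩} {x : ACK k r} (hx : IsUnipLift n x) :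
    x.g = n ∧ ∃ (a : ACK k r) (u : intGL k r), x * a = a * kap k r u := by
  obtain ⟨rfl, h, hL, v, hv⟩ := hx
  exact ⟨rfl, ⟨h, v⟩, _, unipLift_aux (a := ⟨h, v⟩) hL hL.symm hv⟩

theorem IsUnipLift.isPTor {n : GL (Fin r) k⸨X⸩} {x : ACK k r} (hx : IsUnipLift n x)
    (hn : IsPTor k n) : IsPTor k x := by
  obtain ⟨rfl, a, u, h⟩ := hx.mul_eq
  have h1 : x = a * kap k r u * a⁻¹ := eq_mul_inv_of_mul_eq h
  have h2 : IsPTor k u := by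
    obtain ⟨s, hs⟩ := hn
    refine ⟨s, Subtype.ext ?_⟩
    have h3 := congrArg ACK.g h
    rw [ACK.mul_g, ACK.mul_g, kap_g, ← inv_mul_eq_iff_eq_mul, ← mul_assoc] at h3
    rw [Subgroup.coe_pow, ← h3]
    have := conj_pow (i := ringChar k ^ s) (a := a.g⁻¹) (b := x.g)
    rw [inv_inv] at this
    rw [this, hs, mul_one, inv_mul_cancel]
    rfl
  rw [h1]
  exact (h2.map _).conj a

theorem IsUnipLift.of_act_eq {n h : GL (Fin r) k⸨X⸩}
    (hL : act n (act h (stdLat k r)) = act h (stdLat k r)) : ∃ x, IsUnipLift n x := by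
  obtain ⟨⟨h', v⟩, rfl⟩ := exists_ack h
  exact ⟨⟨n, Rel.compLat isLat_std (isLat_act h') (isLat_act n) v
    (Rel.map (glEquiv n) hL rfl v.symm)⟩, rfl, h', hL, v, rfl⟩

/-- The conjugation multiplies the (i, j) entry by ϖ^((j-i)N). Above the diagonal the exponent is at
least N, and N exceeds the orders of the poles. -/
theorem exists_conj_integral {n : GL (Fin r) k⸨X⸩} (hn : IsUnip n) : ∃ C : ℕ, ∀ N : ℕ, C ≤ N →
    ∀ i j, ∀ m < 0, HahnSeries.coeff (((diagGL fun i : Fin r => unif k (i * N : ℤ))⁻¹ * n *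
      diagGL fun i : Fin r => unif k (i * N : ℤ)).val i j) m = 0 := by
  refine ⟨Finset.univ.sup fun i => Finset.univ.sup fun j =>
      (HahnSeries.order (n.val i j)).natAbs, fun N hN i j m hm => ?_⟩
  have hb : -(N : ℤ) ≤ HahnSeries.order (n.val i j) := by
    have h1 : (HahnSeries.order (n.val i j)).natAbs ≤ Finset.univ.sup fun j =>
      (HahnSeries.order (n.val i j)).natAbs :=
      Finset.le_sup (f := fun j => (HahnSeries.order (n.val i j)).natAbs) (Finset.mem_univ j)
    have h2 := Finset.le_sup (f := fun i => Finset.univ.sup fun j =>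
      (HahnSeries.order (n.val i j)).natAbs) (Finset.mem_univ i)
    omega
  have h1 : ((diagGL fun i : Fin r => unif k (i * N : ℤ))⁻¹ * n *
      diagGL fun i : Fin r => unif k (i * N : ℤ)).val i j
      = HahnSeries.single ((j : ℤ) * N - i * N) (1 : k) * n.val i j := by
    rw [diagGL_inv, Units.val_mul, mul_diagGL_apply, Units.val_mul, diagGL_mul_apply,
      Pi.inv_apply, ← unif_neg, mul_right_comm, ← Units.val_mul, ← unif_add]
    congr 2
    rw [neg_add_eq_sub]
    rfl
  rw [h1]
  rcases lt_trichotomy i j with hij | rfl | hij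
  · have hij' : (i : ℤ) + 1 ≤ j := by exact_mod_cast hij
    have h2 : m = (m - ((j : ℤ) * N - i * N)) + ((j : ℤ) * N - i * N) := by ring
    rw [h2, HahnSeries.coeff_single_mul_add, one_mul]
    refine HahnSeries.coeff_eq_zero_of_lt_order ?_
    nlinarith
  · rw [hn.1, mul_one, sub_self]
    exact coeff_one_of_neg hm
  · rw [hn.2 i j hij, mul_zero]
    rfl

theorem exists_conj_mem_intGL {n n' : GL (Fin r) k⸨X⸩} (hn : IsUnip n) (hn' : IsUnip n') :
    ∃ h : GL (Fin r) k⸨X⸩, h⁻¹ * n * h ∈ intGL k r ∧ h⁻¹ * n' * h ∈ intGL k r := by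
  obtain ⟨C₁, h₁⟩ := exists_conj_integral hn
  obtain ⟨C₂, h₂⟩ := exists_conj_integral hn.inv
  obtain ⟨C₃, h₃⟩ := exists_conj_integral hn'
  obtain ⟨C₄, h₄⟩ := exists_conj_integral hn'.inv
  -- The sum dominates the four bounds, so one conjugation makes n, n' and their inverses integral.
  refine ⟨diagGL fun i : Fin r => unif k (i * (C₁ + C₂ + C₃ + C₄ : ℕ) : ℤ), ?_, ?_⟩
  · refine mem_intGL_of_integral (h₁ _ (by omega)) ?_
    rw [mul_inv_rev, mul_inv_rev, inv_inv, ← mul_assoc]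
    exact h₂ _ (by omega)
  · refine mem_intGL_of_integral (h₃ _ (by omega)) ?_
    rw [mul_inv_rev, mul_inv_rev, inv_inv, ← mul_assoc]
    exact h₄ _ (by omega)

theorem IsUnip.exists_lift {n : GL (Fin r) k⸨X⸩} (hn : IsUnip n) : ∃ x, IsUnipLift n x := by
  obtain ⟨h, hu, -⟩ := exists_conj_mem_intGL hn .one
  refine IsUnipLift.of_act_eq (h := h) ?_
  have := congrArg (act h) (mem_intGL.1 hu)
  rw [act, act_mul] at this
  rw [act, act_mul, ← this]
  congr 1
  group

/-- A single h conjugates n and n' into GL_r(O), where the splitting is a homomorphism. The product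
of the two lifts is then again conjugate to a canonical lift of a unipotent element and has p-power
order. -/
theorem exists_isPTor_lifts [Finite k] {n n' : GL (Fin r) k⸨X⸩} (hn : IsUnip n) (hn' : IsUnip n') :
    ∃ x x' : ACK k r, x.g = n ∧ x'.g = n' ∧ IsPTor k x ∧ IsPTor k x' ∧ IsPTor k (x * x') := by
  obtain ⟨h, hu, hu'⟩ := exists_conj_mem_intGL hn hn'
  obtain ⟨a, rfl⟩ := exists_ack h
  have key : ∀ m (hm : IsUnip m) (hu : a.g⁻¹ * m * a.g ∈ intGL k r),
      IsPTor k (⟨_, hu⟩ : intGL k r) := by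
    intro m hm hu
    obtain ⟨s, hs⟩ := hm.isPTor
    refine ⟨s, Subtype.ext ?_⟩
    have := conj_pow (i := ringChar k ^ s) (a := a.g⁻¹) (b := m)
    rw [inv_inv] at this
    rw [Subgroup.coe_pow, this, hs, mul_one, inv_mul_cancel]
    rfl
  have hg : ∀ m (hu : a.g⁻¹ * m * a.g ∈ intGL k r), (a * kap k r ⟨_, hu⟩ * a⁻¹).g = m := by
    intro m hu
    change a.g * (a.g⁻¹ * m * a.g) * (a.g)⁻¹ = m
    group
  have e : a.g⁻¹ * (n * n') * a.g = (a.g⁻¹ * n * a.g) * (a.g⁻¹ * n' * a.g) := by group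
  refine ⟨a * kap k r ⟨_, hu⟩ * a⁻¹, a * kap k r ⟨_, hu'⟩ * a⁻¹, hg n hu, hg n' hu',
    ((key n hn hu).map _).conj a, ((key n' hn' hu').map _).conj a, ?_⟩
  have h1 : a * kap k r ⟨_, hu⟩ * a⁻¹ * (a * kap k r ⟨_, hu'⟩ * a⁻¹)
      = a * kap k r ⟨a.g⁻¹ * (n * n') * a.g, e ▸ mul_mem hu hu'⟩ * a⁻¹ := by
    have : (⟨a.g⁻¹ * (n * n') * a.g, e ▸ mul_mem hu hu'⟩ : intGL k r)
      = ⟨_, hu⟩ * ⟨_, hu'⟩ := Subtype.ext e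
    rw [this, map_mul]
    group
  rw [h1]
  exact ((key _ (hn.mul hn') _).map _).conj a

theorem detGL1_of_isUnip {n : GL (Fin r) k⸨X⸩} (hn : IsUnip n) : detGL1 n = 1 := by
  have : Matrix.GeneralLinearGroup.det n = 1 := by
    ext1
    change n.val.det = 1
    rw [Matrix.det_of_isUpperTriangular hn.blockTriangular]
    simp [hn.1]
  rw [detGL1, this]
  exact diagGL_one

theorem isPTor_pair_one {b : ACK k r} (hb : IsPTor k b) (h : (1 : ACK k 1).g = detGL1 b.g) :
    IsPTor k (Geo.pair 1 b h) := by
  obtain ⟨s, hs⟩ := hb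
  refine ⟨s, ?_⟩
  have h1 : ∀ m : ℕ, ∃ h', Geo.pair 1 b h ^ m = Geo.pair 1 (b ^ m) h' := by
    intro m
    induction m with
    | zero => exact ⟨_, (pow_zero _).trans (Geo.pair_congr detGL1_one.symm rfl (pow_zero b).symm)⟩
    | succ m ih =>
      obtain ⟨h', e⟩ := ih
      refine ⟨by rw [pow_succ, ACK.mul_g, detGL1_mul, ← h', ← h]; exact (mul_one _).symm, ?_⟩
      rw [pow_succ, e, Geo.pair_mul]
      exact Geo.pair_congr _ (one_mul _) (pow_succ b m).symm
  obtain ⟨h', e⟩ := h1 (ringChar k ^ s)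
  rw [e]
  exact Geo.pair_congr _ rfl hs

/-- The lift `δ_n` of a unipotent element `n`: the lift whose order is a power of `p`. -/
noncomputable def unipLift (n : GL (Fin r) k⸨X⸩) : Geo k r :=
  @Classical.epsilon _ ⟨1⟩ fun x => x.proj = n ∧ IsPTor k x

theorem eq_unipLift [Finite k] {x : Geo k r} (hx : IsPTor k x) : x = unipLift x.proj := by
  have : unipLift x.proj = @Classical.epsilon _ ⟨1⟩ fun y : Geo k r => y.proj = x.proj ∧ IsPTor k y :=
    rfl
  have h := @Classical.epsilon_spec _ (fun y : Geo k r => y.proj = x.proj ∧ IsPTor k y) ⟨x, rfl, hx⟩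
  exact Geo.eq_of_isPTor h.1.symm hx h.2

/-- Uniqueness applied to lifts of n and n' whose product also has p-power order. In general a
product of two elements of p-power order need not have p-power order, hence the need for
`exists_isPTor_lifts`. -/
theorem unipLift_mul [Finite k] {n n' : GL (Fin r) k⸨X⸩} (hn : IsUnip n) (hn' : IsUnip n') :
    unipLift (n * n') = unipLift n * unipLift n' := by
  obtain ⟨x, x', rfl, rfl, hx, hx', hxx'⟩ := exists_isPTor_lifts hn hn'
  have h1 := eq_unipLift (isPTor_pair_one hx (detGL1_of_isUnip hn).symm)
  have h2 := eq_unipLift (isPTor_pair_one hx' (detGL1_of_isUnip hn').symm)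
  have h3 := eq_unipLift (isPTor_pair_one hxx' (detGL1_of_isUnip (hn.mul hn')).symm)
  change _ = unipLift x.g at h1
  change _ = unipLift x'.g at h2
  change _ = unipLift (x * x').g at h3
  rw [← h1, ← h2, ← ACK.mul_g, ← h3]
  exact (Geo.pair_congr _ (one_mul _).symm rfl).trans (Geo.pair_mul ..).symm

theorem isPTor_unipLift [Finite k] {n : GL (Fin r) k⸨X⸩} (hn : IsUnip n) :
    (unipLift n).proj = n ∧ IsPTor k (unipLift n) := by
  obtain ⟨x, -, rfl, -, hx, -⟩ := exists_isPTor_lifts hn .one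
  have h1 := isPTor_pair_one hx (detGL1_of_isUnip hn).symm
  have h2 := eq_unipLift h1
  change _ = unipLift x.g at h2
  rw [← h2]
  exact ⟨rfl, h1⟩

theorem conj_unipLift [Finite k] {n : GL (Fin r) k⸨X⸩} (x : Geo k r) (hn : IsPTor k (unipLift n))
    (hn' : (unipLift n).proj = n) :
    x * unipLift n * x⁻¹ = unipLift (x.proj * n * x.proj⁻¹) := by
  have := eq_unipLift (hn.conj x)
  rwa [Geo.proj_mul, Geo.proj_mul, Geo.proj_inv, hn'] at this

/-- Every admissible lattice and vector give a lift of p-power order, so the choices do not matter.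
-/
theorem isGeoUnipLift_iff [Finite k] {n : GL (Fin r) k⸨X⸩} (hn : IsUnip n) {x : Geo k r} :
    IsGeoUnipLift n x ↔ x = unipLift n := by
  have key : ∀ x, IsGeoUnipLift n x → x = unipLift n := by
    rintro x ⟨⟨⟨a, b⟩, h⟩, rfl, ha, hb⟩
    obtain rfl : a = 1 := ha
    obtain rfl : b.g = n := hb.mul_eq.1
    exact eq_unipLift (isPTor_pair_one (hb.isPTor hn.isPTor) h)
  refine ⟨key x, ?_⟩
  rintro rfl
  obtain ⟨b, hb⟩ := hn.exists_lift
  have hg := hb.mul_eq.1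
  have h : IsGeoUnipLift n (Geo.pair 1 b (by rw [hg, detGL1_of_isUnip hn]; rfl)) :=
    ⟨_, rfl, rfl, hb⟩
  rwa [key _ h] at h

end UnipotentLift

/-! ### Products over pairs of indices -/

section PairProd

variable {A : Type*} [CommGroup A]

/-- The product of `f i j` over the pairs `i < j`. -/
def pairProd {r : ℕ} (f : Fin r → Fin r → A) : A :=
  ∏ i : Fin r, ∏ j ∈ Finset.univ.filter (fun j => i < j), f i j

variable {r : ℕ}

theorem pairProd_mul (f g : Fin r → Fin r → A) :
    (pairProd fun i j => f i j * g i j) = pairProd f * pairProd g := by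
  simp only [pairProd, Finset.prod_mul_distrib]

theorem pairProd_congr {f g : Fin r → Fin r → A} (h : ∀ i j, i < j → f i j = g i j) :
    pairProd f = pairProd g :=
  Finset.prod_congr rfl fun i _ => Finset.prod_congr rfl fun j hj =>
    h i j (Finset.mem_filter.1 hj).2

theorem pairProd_eq_one {f : Fin r → Fin r → A} (h : ∀ i j, i < j → f i j = 1) :
    pairProd f = 1 :=
  (pairProd_congr h).trans (by simp [pairProd])

theorem pairProd_succ (f : Fin (r + 1) → Fin (r + 1) → A) :
    pairProd f = (∏ j : Fin r, f 0 j.succ) * pairProd fun i j => f i.succ j.succ := by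
  simp only [pairProd, Finset.prod_filter, Fin.prod_univ_succ, if_false,
    Fin.succ_pos, if_true, one_mul, Fin.not_lt_zero, Fin.succ_lt_succ_iff]

/-- The product of `f i j` over the pairs `i`, `j` with `i` before `j` in a list. -/
def listPairProd {ι : Type*} (f : ι → ι → A) : List ι → A
  | [] => 1
  | i :: l => (l.map (f i)).prod * listPairProd f l

theorem listPairProd_map {ι κ : Type*} (f : ι → ι → A) (g : κ → ι) (l : List κ) :
    listPairProd f (l.map g) = listPairProd (fun i j => f (g i) (g j)) l := by
  induction l with
  | nil => rfl
  | cons i l ih =>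
    rw [List.map_cons, listPairProd, listPairProd, ih, List.map_map]
    rfl

theorem listPairProd_finRange (f : Fin r → Fin r → A) :
    listPairProd f (List.finRange r) = pairProd f := by
  induction r with
  | zero => simp [listPairProd, pairProd]
  | succ r ih =>
    rw [List.finRange_succ, listPairProd, listPairProd_map, ih, pairProd_succ, List.map_map]
    congr 1

end PairProd

/-! ### Diagonal lattices and their monomial frames -/

section DiagonalLattice

universe u

variable {k : Type u} [Field k] {r : ℕ}

/-- The lattice `⨁ ϖ^{a_i} O e_i`. -/
def dLat (k : Type u) [Field k] {r : ℕ} (a : Fin r → ℤ) : Submodule k (Fin r → k⸨X⸩) where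
  carrier := {x | ∀ i, ∀ n < a i, HahnSeries.coeff (x i) n = 0}
  add_mem' hx hy i n hn := by simp [hx i n hn, hy i n hn]
  zero_mem' i n hn := by simp
  smul_mem' c x hx i n hn := by simp [hx i n hn]

theorem dLat_mono {a b : Fin r → ℤ} (h : a ≤ b) : dLat k b ≤ dLat k a :=
  fun _ hx i n hn => hx i n (hn.trans_le (h i))

theorem glEquiv_diagGL (t : Fin r → k⸨X⸩ˣ) (x : Fin r → k⸨X⸩) (i : Fin r) :
    glEquiv (diagGL t) x i = (t i : k⸨X⸩) * x i := Matrix.mulVec_diagonal _ _ i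

theorem coeff_mul_eq_zero (t : k⸨X⸩ˣ) {y : k⸨X⸩} {b : ℤ}
    (hy : ∀ n < b, HahnSeries.coeff y n = 0) {n : ℤ} (hn : n < val t + b) :
    HahnSeries.coeff ((t : k⸨X⸩) * y) n = 0 := by
  rw [HahnSeries.coeff_mul]
  refine Finset.sum_eq_zero fun ab hab => ?_
  rw [Finset.mem_antidiagonal] at hab
  obtain ⟨ha, hb, hab⟩ := hab
  rcases lt_or_ge ab.1 (val t) with h | h
  · rw [coeff_eq_zero_of_lt_val t h, zero_mul]
  · rw [hy ab.2 (by omega), mul_zero]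

theorem act_diagGL_le (t : Fin r → k⸨X⸩ˣ) (b : Fin r → ℤ) :
    act (diagGL t) (dLat k b) ≤ dLat k fun i => val (t i) + b i := by
  rintro _ ⟨x, hx, rfl⟩ i n hn
  change HahnSeries.coeff (glEquiv (diagGL t) x i) n = 0
  rw [glEquiv_diagGL]
  exact coeff_mul_eq_zero _ (hx i) hn

theorem act_diagGL (t : Fin r → k⸨X⸩ˣ) (b : Fin r → ℤ) :
    act (diagGL t) (dLat k b) = dLat k fun i => val (t i) + b i := by
  refine le_antisymm (act_diagGL_le t b) ?_
  have h := act_diagGL_le t⁻¹ fun i => val (t i) + b i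
  have h1 := Submodule.map_mono (f := (glEquiv (diagGL t)).toLinearMap) h
  rw [act_mul, ← diagGL_inv, mul_inv_cancel, act_one] at h1
  refine h1.trans (Submodule.map_mono (dLat_mono fun i => ?_))
  change b i ≤ val (t i)⁻¹ + (val (t i) + b i)
  rw [val_inv, neg_add_cancel_left]

theorem act_diagGL_mul_permGL (t : Fin r → k⸨X⸩ˣ) (w : Equiv.Perm (Fin r)) :
    act (diagGL t * permGL w) (stdLat k r) = dLat k fun i => val (t i) := by
  rw [← act_mul, mem_intGL.1 (permGL_mem_intGL w)]
  refine (act_diagGL t fun _ => 0).trans ?_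
  simp only [add_zero]

theorem isLat_dLat (a : Fin r → ℤ) : IsLat (dLat k a) := by
  refine ⟨diagGL fun i => unif k (a i), ?_⟩
  rw [← mul_one (diagGL _), ← permGL_one, act_diagGL_mul_permGL]
  simp only [val_unif]

theorem finite_dLat (a b : Fin r → ℤ) : FiniteDimensional k (SubQ (dLat k a) (dLat k b)) :=
  (isLat_dLat a).finite (isLat_dLat b)

/-- The vectors `ϖ^j e_i`, `a ≤ j < m`. -/
noncomputable def monoBlock (k : Type u) [Field k] {r : ℕ} (i : Fin r) (a m : ℤ) :
    List (Fin r → k⸨X⸩) :=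
  (List.range (m - a).toNat).map fun j : ℕ => Pi.single i (HahnSeries.single (a + (j : ℤ)) (1 : k))

/-- The vectors `ϖ^j e_i`, `a_i ≤ j < m_i`, in lexicographic order. -/
noncomputable def monoFrame (k : Type u) [Field k] {r : ℕ} (a m : Fin r → ℤ) :
    List (Fin r → k⸨X⸩) :=
  (List.finRange r).flatMap fun i => monoBlock k i (a i) (m i)

theorem length_monoBlock (i : Fin r) (a m : ℤ) : (monoBlock k i a m).length = (m - a).toNat := by
  simp [monoBlock]

theorem monoBlock_append (i : Fin r) {a b c : ℤ} (h : a ≤ b) (h' : b ≤ c) :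
    monoBlock k i a c = monoBlock k i a b ++ monoBlock k i b c := by
  have e : (c - a).toNat = (b - a).toNat + (c - b).toNat := by omega
  rw [monoBlock, e, List.range_add, List.map_append, List.map_map]
  congr 1
  refine List.map_congr_left fun j _ => ?_
  simp only [Function.comp_apply]
  have : a + ((b - a).toNat + j : ℕ) = b + j := by omega
  rw [this]

theorem monoBlock_succ (i : Fin r) {a m : ℤ} (h : a < m) :
    monoBlock k i a m = Pi.single i (HahnSeries.single a (1 : k)) :: monoBlock k i (a + 1) m := by
  rw [monoBlock_append i (b := a + 1) (by omega) (by omega)]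
  simp [monoBlock]

theorem map_monoBlock (a : Fin r → ℤ) (i : Fin r) (b m : ℤ) :
    (monoBlock k i b m).map (glEquiv (diagGL fun i => unif k (a i)))
      = monoBlock k i (a i + b) (a i + m) := by
  rw [monoBlock, monoBlock, add_sub_add_left_eq_sub, List.map_map]
  refine List.map_congr_left fun j _ => ?_
  funext i'
  rw [Function.comp_apply, glEquiv_diagGL]
  by_cases h : i' = i
  · subst h
    rw [Pi.single_eq_same, Pi.single_eq_same, add_assoc]
    exact (HahnSeries.single_mul_single).trans (by rw [one_mul])
  · rw [Pi.single_eq_of_ne h, Pi.single_eq_of_ne h, mul_zero]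

theorem map_monoFrame (a b m : Fin r → ℤ) :
    (monoFrame k b m).map (glEquiv (diagGL fun i => unif k (a i))) = monoFrame k (a + b) (a + m) := by
  rw [monoFrame, List.map_flatMap]
  exact List.flatMap_congr fun i _ => map_monoBlock a i _ _

theorem single_mem_dLat {a : Fin r → ℤ} {i : Fin r} {y : k⸨X⸩}
    (hy : ∀ n < a i, HahnSeries.coeff y n = 0) : Pi.single i y ∈ dLat k a := by
  intro i' n hn
  by_cases h : i' = i
  · subst h
    rw [Pi.single_eq_same]
    exact hy n hn
  · rw [Pi.single_eq_of_ne h]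
    rfl

theorem coeff_single_of_lt {a n : ℤ} (h : n < a) :
    HahnSeries.coeff (HahnSeries.single a (1 : k)) n = 0 := HahnSeries.coeff_single_of_ne h.ne

theorem le_update_of_le {a : Fin r → ℤ} {i : Fin r} {m : ℤ} (h : a i ≤ m) :
    a ≤ Function.update a i m := by
  intro j
  by_cases hj : j = i
  · subst hj; simpa using h
  · simp [hj]

theorem isFrame_singleton (a : Fin r → ℤ) (i : Fin r) :
    IsFrame (dLat k a) (dLat k (Function.update a i (a i + 1)))
      [Pi.single i (HahnSeries.single (a i) (1 : k))] := by
  refine IsFrame.singleton (single_mem_dLat fun n hn => coeff_single_of_lt hn) ?_ ?_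
  · intro h
    have := h i (a i) (by simp)
    simp at this
  · intro x hx
    refine ⟨HahnSeries.coeff (x i) (a i), fun j n hn => ?_⟩
    by_cases h : j = i
    · subst h
      rw [Function.update_self] at hn
      rw [Pi.sub_apply, Pi.smul_apply, Pi.single_eq_same, HahnSeries.coeff_sub,
        HahnSeries.coeff_smul]
      rcases (Int.lt_add_one_iff.1 hn).lt_or_eq with h | rfl
      · rw [hx j n h, coeff_single_of_lt h, smul_zero, sub_zero]
      · rw [HahnSeries.coeff_single_same, smul_eq_mul, mul_one, sub_self]
    · rw [Function.update_of_ne h] at hn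
      rw [Pi.sub_apply, Pi.smul_apply, Pi.single_eq_of_ne h, smul_zero, sub_zero]
      exact hx j n hn

/-- Induction along the chain of lattices in which the i-th exponent grows by one; each step has a
one-dimensional quotient. -/
theorem isFrame_monoBlock (i : Fin r) {m : ℤ} (n : ℕ) : ∀ {a : Fin r → ℤ}, a i + n = m →
    IsFrame (dLat k a) (dLat k (Function.update a i m)) (monoBlock k i (a i) m) := by
  induction n with
  | zero =>
    intro a h
    obtain rfl : a i = m := by simpa using h
    rw [Function.update_eq_self]
    have : monoBlock k i (a i) (a i) = [] := by simp [monoBlock]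
    rw [this]
    exact IsFrame.nil _
  | succ n ih =>
    intro a h
    push_cast at h
    rw [monoBlock_succ i (by omega)]
    have h1 := ih (a := Function.update a i (a i + 1)) (by rw [Function.update_self]; omega)
    rw [Function.update_self, Function.update_idem] at h1
    refine (isFrame_singleton a i).append_of_le ?_ (dLat_mono (le_update_of_le (by omega))) h1
      (finite_dLat _ _)
    have h2 := le_update_of_le (a := Function.update a i (a i + 1)) (i := i) (m := m)
      (by rw [Function.update_self]; omega)
    rw [Function.update_idem] at h2
    exact dLat_mono h2

theorem isFrame_monoBlock_of_le {a : Fin r → ℤ} (i : Fin r) {m : ℤ} (h : a i ≤ m) :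
    IsFrame (dLat k a) (dLat k (Function.update a i m)) (monoBlock k i (a i) m) :=
  isFrame_monoBlock i (m - a i).toNat (by omega)

/-- The tuple equal to `m` on the indices in the list `l`, and to `a` elsewhere. -/
def mixTuple (l : List (Fin r)) (a m : Fin r → ℤ) : Fin r → ℤ := fun i => if i ∈ l then m i else a i

theorem mixTuple_cons (i : Fin r) (l : List (Fin r)) (a m : Fin r → ℤ) :
    mixTuple l (Function.update a i (m i)) m = mixTuple (i :: l) a m := by
  funext j
  by_cases h : j = i
  · subst h; simp [mixTuple]
  · simp [mixTuple, h]

theorem le_mixTuple {l : List (Fin r)} {a m : Fin r → ℤ} (h : a ≤ m) : a ≤ mixTuple l a m := by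
  intro i
  rw [mixTuple]
  split_ifs
  exacts [h i, le_rfl]

theorem update_le {a m : Fin r → ℤ} (h : a ≤ m) (i : Fin r) : Function.update a i (m i) ≤ m := by
  intro j
  by_cases hj : j = i
  · subst hj; simp
  · simp [hj, h j]

theorem flatMap_update {l : List (Fin r)} {i : Fin r} (hi : i ∉ l) (a m : Fin r → ℤ) (c : ℤ) :
    (l.flatMap fun j => monoBlock k j (Function.update a i c j) (m j))
      = l.flatMap fun j => monoBlock k j (a j) (m j) :=
  List.flatMap_congr fun j hj => by rw [Function.update_of_ne (ne_of_mem_of_not_mem hj hi)]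

/-- The exponents are raised from a to m one coordinate at a time, in the order of the list, which
is the lexicographic order of the monomials. -/
theorem isFrame_flatMap (l : List (Fin r)) (hl : l.Nodup) {m : Fin r → ℤ} :
    ∀ {a : Fin r → ℤ}, a ≤ m → IsFrame (dLat k a) (dLat k (mixTuple l a m))
      (l.flatMap fun i => monoBlock k i (a i) (m i)) := by
  induction l with
  | nil =>
    intro a _
    have : mixTuple [] a m = a := by funext; simp [mixTuple]
    rw [this]
    exact IsFrame.nil _
  | cons i l ih =>
    intro a h
    obtain ⟨hi, hl'⟩ := List.nodup_cons.1 hl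
    have h1 := ih hl' (update_le h i)
    rw [mixTuple_cons, flatMap_update hi] at h1
    rw [List.flatMap_cons]
    refine (isFrame_monoBlock_of_le i (h i)).append_of_le ?_ (dLat_mono (le_update_of_le (h i))) h1
      (finite_dLat _ _)
    rw [← mixTuple_cons]
    exact dLat_mono (le_mixTuple (update_le h i))

theorem mixTuple_finRange (a m : Fin r → ℤ) : mixTuple (List.finRange r) a m = m := by
  funext i
  simp [mixTuple]

theorem isFrame_monoFrame {a m : Fin r → ℤ} (h : a ≤ m) :
    IsFrame (dLat k a) (dLat k m) (monoFrame k a m) := by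
  have := isFrame_flatMap (k := k) (List.finRange r) (List.nodup_finRange r) h
  rwa [mixTuple_finRange] at this

end DiagonalLattice

/-! ### Signs from reordering monomials, and powers of the uniformizer -/

section MonomialSigns

universe u

variable {k : Type u} [Field k]

theorem neg_one_zpow_sq (n : ℤ) : ((-1 : kˣ) ^ n) * (-1) ^ n = 1 := by
  rw [← mul_zpow]; simp

theorem neg_one_zpow_congr {m n : ℤ} (h : Even (m - n)) : (-1 : kˣ) ^ m = (-1) ^ n := by
  rw [← mul_inv_eq_one, ← zpow_neg, ← zpow_add, ← sub_eq_add_neg]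
  exact h.neg_one_zpow

theorem neg_one_zpow_mul_sum {ι : Type*} (a : ℤ) (l : List ι) (f : ι → ℤ) :
    (-1 : kˣ) ^ (a * (l.map f).sum) = (l.map fun i => (-1 : kˣ) ^ (a * f i)).prod := by
  induction l with
  | nil => simp
  | cons i l ih => rw [List.map_cons, List.sum_cons, mul_add, zpow_add, ih]; rfl

variable {U : Type u} [AddCommGroup U] [Module k U]

theorem wedgeList_append_comm_units (A M : Submodule k U) (l l' : List U) :
    wedgeList A M (l ++ l')
      = (((-1 : kˣ) ^ ((l.length : ℤ) * l'.length) : kˣ) : k) • wedgeList A M (l' ++ l) := by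
  rw [wedgeList_append_comm, ← Nat.cast_mul, zpow_natCast]
  simp

/-- To collect all the `p` blocks in front, each `q i` is moved past every later `p j`. -/
theorem wedgeList_flatMap_append {ι : Type*} (A M : Submodule k U) (p q : ι → List U)
    (l : List ι) :
    wedgeList A M (l.flatMap fun i => p i ++ q i)
      = ((listPairProd (fun i j => (-1 : kˣ) ^ (((q i).length : ℤ) * (p j).length)) l : kˣ) : k)
        • wedgeList A M (l.flatMap p ++ l.flatMap q) := by
  induction l with
  | nil => simp [listPairProd]
  | cons i l ih =>
    have h1 := wedgeList_append_comm_units A M (q i) (l.flatMap p)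
    have h2 : ((l.flatMap p).length : ℤ) = (l.map fun j => ((p j).length : ℤ)).sum := by
      rw [List.length_flatMap, Nat.cast_list_sum, List.map_map]
      rfl
    rw [h2, neg_one_zpow_mul_sum] at h1
    simp only [List.flatMap_cons, listPairProd, wedgeList_append] at h1 ih ⊢
    rw [ih, mul_smul_comm, mul_assoc, ← mul_assoc (wedgeList A M (q i)), h1]
    simp only [smul_mul_assoc, mul_smul_comm, smul_smul, mul_assoc, Units.val_mul]
    rw [mul_comm]

variable {r : ℕ}

theorem monoFrame_trans {a M N : Fin r → ℤ} (h : a ≤ M) (h' : M ≤ N)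
    (A B : Submodule k (Fin r → k⸨X⸩)) :
    wedgeList A B (monoFrame k a N)
      = ((pairProd fun i j => (-1 : kˣ) ^ ((N i - M i) * (M j - a j)) : kˣ) : k)
        • wedgeList A B (monoFrame k a M ++ monoFrame k M N) := by
  have e : monoFrame k a N = (List.finRange r).flatMap fun i =>
      monoBlock k i (a i) (M i) ++ monoBlock k i (M i) (N i) :=
    List.flatMap_congr fun i _ => monoBlock_append i (h i) (h' i)
  rw [e, wedgeList_flatMap_append, listPairProd_finRange]
  congr 2
  refine pairProd_congr fun i j _ => ?_
  rw [length_monoBlock, length_monoBlock, Int.toNat_of_nonneg (sub_nonneg.2 (h' i)),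
    Int.toNat_of_nonneg (sub_nonneg.2 (h j))]

/-- Refinement itself is free of signs, but the appended monomials must be sorted into lexicographic
order in both frames. The quotient of the two sorting signs involves only b - a. -/
theorem Rel.Sends.level {A B : Submodule k (Fin r → k⸨X⸩)} {a b M N : Fin r → ℤ}
    (hA : A = dLat k a) (hB : B = dLat k b) (ha : a ≤ M) (hb : b ≤ M) (hN : M ≤ N) {x : Rel A B}
    {c : kˣ} (h : Rel.Sends x (dLat k M) (monoFrame k a M) (monoFrame k b M) c) :
    Rel.Sends x (dLat k N) (monoFrame k a N) (monoFrame k b N)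
      (c * pairProd fun i j => (-1) ^ ((N i - M i) * (b j - a j))) := by
  subst hA hB
  refine (h.refine (dLat_mono hN) (isFrame_monoFrame hN) (finite_dLat _ _) (finite_dLat _ _)).rescale
    (isFrame_monoFrame (ha.trans hN)) (isFrame_monoFrame (hb.trans hN))
    (monoFrame_trans ha hN _ _) (monoFrame_trans hb hN _ _) ?_
  rw [mul_comm, mul_assoc, ← pairProd_mul]
  congr 1
  refine pairProd_congr fun i j _ => ?_
  rw [← zpow_add, ← mul_add]
  congr 2
  ring

/-- A bound for the absolute values of the entries of a tuple. -/
def tupleBound (a : Fin r → ℤ) : ℤ := ∑ i, |a i|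

theorem le_tupleBound (a : Fin r → ℤ) (i : Fin r) : a i ≤ tupleBound a :=
  (le_abs_self _).trans (Finset.single_le_sum (f := fun i => |a i|) (fun i _ => abs_nonneg (a i))
    (Finset.mem_univ i))

theorem tupleBound_nonneg (a : Fin r → ℤ) : 0 ≤ tupleBound a :=
  Finset.sum_nonneg fun i _ => abs_nonneg (a i)

theorem isFrame_std {M : Fin r → ℤ} (h : 0 ≤ M) :
    IsFrame (stdLat k r) (dLat k M) (monoFrame k 0 M) := isFrame_monoFrame h

/-- The role of the even level: at the constant level m the correction sign is (-1)^(m a_j) = 1, so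
all even m define the same element, whose coefficient at any level M is then known. -/
theorem Rel.Sends.of_even {B : Submodule k (Fin r → k⸨X⸩)} {a : Fin r → ℤ} (hB : B = dLat k a)
    {x : Rel (stdLat k r) B} {m : ℤ} (hm : Even m) (hm0 : 0 ≤ m) (hma : ∀ i, a i ≤ m)
    (h : Rel.Sends x (dLat k fun _ => m) (monoFrame k 0 fun _ => m) (monoFrame k a fun _ => m) 1)
    {M : Fin r → ℤ} (hM : 0 ≤ M) (ha : a ≤ M) :
    Rel.Sends x (dLat k M) (monoFrame k 0 M) (monoFrame k a M)
      (pairProd fun i j => (-1) ^ (M i * a j)) := by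
  have h0 : dLat k M ≤ stdLat k r ⊓ B := le_inf (dLat_mono hM) (hB ▸ dLat_mono ha)
  obtain ⟨c, hc⟩ := Rel.exists_sends x h0 (isFrame_std hM) (hB ▸ isFrame_monoFrame ha)
  have hA : stdLat k r = dLat k 0 := rfl
  -- The two descriptions are compared at the common finer level m + M.
  have h1 := hc.level hA hB hM ha (N := fun i => m + M i) (fun i => by linarith)
  have h2 := h.level hA hB (fun _ => hm0) hma (N := fun i => m + M i) (fun i => le_add_of_nonneg_right (hM i))
  have h3 := h1.unique h2
  rw [one_mul] at h3
  have h4 : (pairProd fun i j => (-1 : kˣ) ^ ((m + M i - M i) * (a j - (0 : Fin r → ℤ) j))) = 1 :=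
    pairProd_eq_one fun i j _ => by
      rw [add_sub_cancel_right]
      exact (hm.mul_right _).neg_one_zpow
  rw [h4, mul_one] at h3
  convert hc using 1
  rw [h3]
  refine pairProd_congr fun i j _ => ?_
  rw [add_sub_cancel_left, Pi.zero_apply, sub_zero]

theorem exists_torP (a : Fin r → ℤ) : ∃ x : ACK k r, x.g = diagGL (fun i => unif k (a i)) ∧
    ∀ M : Fin r → ℤ, 0 ≤ M → a ≤ M → Rel.Sends x.v (dLat k M) (monoFrame k 0 M) (monoFrame k a M)
      (pairProd fun i j => (-1) ^ (M i * a j)) := by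
  have hB : act (diagGL fun i => unif k (a i)) (stdLat k r) = dLat k a := by
    have := act_diagGL_mul_permGL (fun i => unif k (a i)) (1 : Equiv.Perm (Fin r))
    rw [permGL_one, mul_one] at this
    simpa only [val_unif] using this
  have h0 := tupleBound_nonneg a
  have ha : ∀ i, a i ≤ 2 * tupleBound a := fun i => by linarith [le_tupleBound a i]
  have h1 : dLat k (fun _ => 2 * tupleBound a) ≤ stdLat k r ⊓ act (diagGL fun i => unif k (a i))
      (stdLat k r) :=
    le_inf (dLat_mono (a := 0) fun i => show 0 ≤ 2 * tupleBound a by linarith) (hB ▸ dLat_mono ha)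
  obtain ⟨v, hv⟩ := Rel.exists_of_frame h1 (isFrame_std fun i => by simpa using h0)
    (hB ▸ isFrame_monoFrame ha) 1
  exact ⟨⟨_, v⟩, rfl, fun M hM hM' => hv.of_even hB (even_two_mul _) (by linarith) ha hM hM'⟩

/-- The element `(diag(ϖ^{a_i}), 𝔡)` of `G̃'_r`. -/
noncomputable def torP (k : Type u) [Field k] {r : ℕ} (a : Fin r → ℤ) : ACK k r :=
  Classical.choose (exists_torP a)

theorem torP_g (a : Fin r → ℤ) : (torP k a).g = diagGL fun i => unif k (a i) :=
  (Classical.choose_spec (exists_torP a)).1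

theorem torP_sends {a M : Fin r → ℤ} (h0 : 0 ≤ M) (ha : a ≤ M) :
    Rel.Sends (torP k a).v (dLat k M) (monoFrame k 0 M) (monoFrame k a M)
      (pairProd fun i j => (-1) ^ (M i * a j)) :=
  (Classical.choose_spec (exists_torP a)).2 M h0 ha

theorem torP_sends_even {a : Fin r → ℤ} {m : ℤ} (hm : Even m) (h0 : 0 ≤ m) (ha : ∀ i, a i ≤ m) :
    Rel.Sends (torP k a).v (dLat k fun _ => m) (monoFrame k 0 fun _ => m)
      (monoFrame k a fun _ => m) 1 := by
  have := torP_sends (k := k) (M := fun _ => m) (fun _ => h0) ha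
  rwa [pairProd_eq_one fun i j _ => (hm.mul_right _).neg_one_zpow] at this

theorem exists_even_bound (a b : Fin r → ℤ) : ∃ m : ℤ, Even m ∧ 0 ≤ m ∧ (∀ i, a i ≤ m) ∧
    (∀ i, b i ≤ m) ∧ (∀ i, -a i ≤ m) ∧ ∀ i, a i + b i ≤ m := by
  refine ⟨2 * (tupleBound a + tupleBound b + tupleBound (-a)), even_two_mul _, ?_, ?_, ?_, ?_, ?_⟩
  all_goals
    try intro i
    try have h1 := le_tupleBound a i
    try have h2 := le_tupleBound b i
    try have h3 := le_tupleBound (-a) i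
    try rw [Pi.neg_apply] at h3
    have h4 := tupleBound_nonneg a
    have h5 := tupleBound_nonneg b
    have h6 := tupleBound_nonneg (-a)
    linarith

theorem torP_mul (a b : Fin r → ℤ) :
    torP k a * torP k b = ACK.smul (pairProd fun i j => (-1) ^ (a i * b j)) (torP k (a + b)) := by
  obtain ⟨m, hm, h0, ha, hb, ha', hab⟩ := exists_even_bound a b
  -- The level of the first factor is a + m because ϖ^a carries the level m of the second factor
  -- there, so that the frames match in the product.
  have h1 := torP_sends (k := k) (a := a) (M := a + fun _ => m)
    (fun i => by simpa using by linarith [ha' i]) (fun i => by simpa using h0)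
  have h2 := torP_sends_even (k := k) hm h0 hb
  have h3 := torP_sends (k := k) (a := a + b) (M := a + fun _ => m)
    (fun i => by simpa using by linarith [ha' i]) (fun i => by simpa using hb i)
  have e : act (torP k a).g (dLat k fun _ => m) = dLat k (a + fun _ => m) := by
    rw [torP_g, act_diagGL]
    simp only [val_unif]
    rfl
  have e1 : ∀ c : Fin r → ℤ, (monoFrame k c fun _ => m).map (glEquiv (torP k a).g)
      = monoFrame k (a + c) (a + fun _ => m) := fun c => by rw [torP_g, map_monoFrame]
  have h4 := ACK.mul_sends e (by rw [e1, add_zero]; exact h1) h2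
  rw [e1] at h4
  refine ACK.ext_sends ?_ h4 (by
    have h5 := ACK.smul_sends h3 (pairProd fun i j => (-1) ^ (a i * b j))
    convert h5 using 1
    rw [mul_one, ← pairProd_mul]
    refine pairProd_congr fun i j _ => ?_
    rw [← zpow_add]
    refine neg_one_zpow_congr ?_
    rw [Pi.add_apply, Pi.add_apply]
    -- Modulo 2 the signs at level a + m leave exactly a_i b_j, as m is even.
    have : (a i + m) * a j - (a i * b j + (a i + m) * (a j + b j))
      = -(2 * (a i * b j)) - m * b j := by ring
    rw [this]
    exact (even_two_mul _).neg.sub (hm.mul_right _))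
  change (torP k a).g * (torP k b).g = (torP k (a + b)).g
  rw [torP_g, torP_g, torP_g, ← diagGL_mul]
  congr 1
  funext i
  exact (unif_add _ _).symm

end MonomialSigns

/-! ### Determinants of diagonal units on quotients of lattices -/

section UnitScaling

universe u

variable {k : Type u} [Field k] {r : ℕ}

theorem act_diagGL_of_val_eq_zero {u : Fin r → k⸨X⸩ˣ} (hu : ∀ i, val (u i) = 0) (a : Fin r → ℤ) :
    act (diagGL u) (dLat k a) = dLat k a := by
  rw [act_diagGL]
  simp only [hu, zero_add]

theorem map_mem_dLat {u : Fin r → k⸨X⸩ˣ} (hu : ∀ i, val (u i) = 0) {a : Fin r → ℤ}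
    {l : List (Fin r → k⸨X⸩)} (hl : ∀ x ∈ l, x ∈ dLat k a) :
    ∀ x ∈ l.map (glEquiv (diagGL u)), x ∈ dLat k a := by
  intro x hx
  obtain ⟨y, hy, rfl⟩ := List.mem_map.1 hx
  rw [← act_diagGL_of_val_eq_zero hu a]
  exact ⟨y, hl y hy, rfl⟩

/-- On the one-dimensional quotient ϖ^a O/ϖ^(a+1) O a unit acts by its value at 0, which is its
leading coefficient. -/
theorem wedgeList_map_singleton {u : Fin r → k⸨X⸩ˣ} (hu : ∀ i, val (u i) = 0) (a : Fin r → ℤ)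
    (i : Fin r) :
    wedgeList (dLat k a) (dLat k (Function.update a i (a i + 1)))
        ([Pi.single i (HahnSeries.single (a i) (1 : k))].map (glEquiv (diagGL u)))
      = (lc (u i) : k) • wedgeList (dLat k a) (dLat k (Function.update a i (a i + 1)))
        [Pi.single i (HahnSeries.single (a i) (1 : k))] := by
  have hv : Pi.single i (HahnSeries.single (a i) (1 : k)) ∈ dLat k a :=
    single_mem_dLat fun n hn => coeff_single_of_lt hn
  have h1 : glEquiv (diagGL u) (Pi.single i (HahnSeries.single (a i) (1 : k)))
      = Pi.single i ((u i : k⸨X⸩) * HahnSeries.single (a i) (1 : k)) := by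
    funext j
    rw [glEquiv_diagGL]
    by_cases h : j = i
    · subst h; simp
    · simp [h]
  have h2 : HahnSeries.coeff (u i : k⸨X⸩) 0 = lc (u i) := by
    rw [← hu i]
    exact HahnSeries.leadingCoeff_eq.symm
  have hc : ∀ n, HahnSeries.coeff ((u i : k⸨X⸩) * HahnSeries.single (a i) (1 : k)) (n + a i)
      = HahnSeries.coeff (u i : k⸨X⸩) n := fun n => by
    rw [HahnSeries.coeff_mul_single_add, mul_one]
  have hc' : ∀ n, HahnSeries.coeff ((u i : k⸨X⸩) * HahnSeries.single (a i) (1 : k)) n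
      = HahnSeries.coeff (u i : k⸨X⸩) (n - a i) := fun n => by
    rw [← hc, sub_add_cancel]
  have hw : (Pi.single i ((u i : k⸨X⸩) * HahnSeries.single (a i) (1 : k)) : Fin r → k⸨X⸩)
      - (lc (u i) : k) • (Pi.single i (HahnSeries.single (a i) (1 : k)) : Fin r → k⸨X⸩)
      ∈ dLat k (Function.update a i (a i + 1)) := by
    rw [← Pi.single_smul, ← Pi.single_sub]
    refine single_mem_dLat fun n hn => ?_
    rw [Function.update_self] at hn
    rw [HahnSeries.coeff_sub, HahnSeries.coeff_smul, hc']
    rcases (Int.lt_add_one_iff.1 hn).lt_or_eq with h | rfl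
    · rw [coeff_eq_zero_of_lt_val _ (by rw [hu]; omega), coeff_single_of_lt h, smul_zero, sub_zero]
    · rw [sub_self, h2, HahnSeries.coeff_single_same, smul_eq_mul, mul_one, sub_self]
  have h3 : toSubQ (dLat k a) (dLat k (Function.update a i (a i + 1)))
      (Pi.single i ((u i : k⸨X⸩) * HahnSeries.single (a i) (1 : k)))
      = (lc (u i) : k) • toSubQ (dLat k a) (dLat k (Function.update a i (a i + 1)))
        (Pi.single i (HahnSeries.single (a i) (1 : k))) := by
    have hw' := dLat_mono (k := k) (le_update_of_le (a := a) (i := i) (m := a i + 1) (by omega)) hw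
    have h4 := toSubQ_add (dLat k (Function.update a i (a i + 1))) hw'
      (Submodule.smul_mem _ (lc (u i) : k) hv)
    rw [sub_add_cancel, (toSubQ_eq_zero hw').2 hw, zero_add, toSubQ_smul _ _ hv] at h4
    exact h4
  simp only [List.map_cons, List.map_nil, h1, wedgeList, List.prod_cons, List.prod_nil, mul_one, h3,
    map_smul]

theorem wedgeList_map_monoBlock {u : Fin r → k⸨X⸩ˣ} (hu : ∀ i, val (u i) = 0) (i : Fin r) {m : ℤ}
    (n : ℕ) : ∀ {a : Fin r → ℤ}, a i + n = m →
    wedgeList (dLat k a) (dLat k (Function.update a i m))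
        ((monoBlock k i (a i) m).map (glEquiv (diagGL u)))
      = ((lc (u i) ^ (m - a i) : kˣ) : k) • wedgeList (dLat k a) (dLat k (Function.update a i m))
        (monoBlock k i (a i) m) := by
  induction n with
  | zero =>
    intro a h
    obtain rfl : a i = m := by simpa using h
    have : monoBlock k i (a i) (a i) = [] := by simp [monoBlock]
    rw [this]
    simp
  | succ n ih =>
    intro a h
    push_cast at h
    have h1 : Function.update a i (a i + 1) i + n = m := by rw [Function.update_self]; omega
    have h2 := ih h1
    have h3 := isFrame_monoBlock (k := k) i n h1
    rw [Function.update_self, Function.update_idem] at h2 h3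
    have h4 := le_update_of_le (a := Function.update a i (a i + 1)) (i := i) (m := m)
      (by rw [Function.update_self]; omega)
    rw [Function.update_idem] at h4
    rw [monoBlock_succ i (by omega), ← List.singleton_append, List.map_append,
      (isFrame_singleton a i).smul_append (dLat_mono h4) (dLat_mono (le_update_of_le (by omega)))
        h3 (map_mem_dLat hu (isFrame_singleton a i).mem) (map_mem_dLat hu h3.mem)
        (wedgeList_map_singleton hu a i) h2 (finite_dLat _ _)]
    congr 1
    rw [← Units.val_mul, ← zpow_one_add]
    congr 2
    ring

theorem wedgeList_map_flatMap {u : Fin r → k⸨X⸩ˣ} (hu : ∀ i, val (u i) = 0) (l : List (Fin r))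
    (hl : l.Nodup) {m : Fin r → ℤ} : ∀ {a : Fin r → ℤ}, a ≤ m →
    wedgeList (dLat k a) (dLat k (mixTuple l a m))
        ((l.flatMap fun i => monoBlock k i (a i) (m i)).map (glEquiv (diagGL u)))
      = (((l.map fun i => lc (u i) ^ (m i - a i)).prod : kˣ) : k)
        • wedgeList (dLat k a) (dLat k (mixTuple l a m))
          (l.flatMap fun i => monoBlock k i (a i) (m i)) := by
  induction l with
  | nil => intro a _; simp
  | cons i l ih =>
    intro a h
    obtain ⟨hi, hl'⟩ := List.nodup_cons.1 hl
    have h1 := ih hl' (update_le h i)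
    have h2 := isFrame_flatMap (k := k) l hl' (update_le h i)
    rw [mixTuple_cons, flatMap_update hi] at h1 h2
    have h3 : (l.map fun j => lc (u j) ^ (m j - Function.update a i (m i) j))
        = l.map fun j => lc (u j) ^ (m j - a j) :=
      List.map_congr_left fun j hj => by rw [Function.update_of_ne (ne_of_mem_of_not_mem hj hi)]
    rw [h3] at h1
    have h4 := isFrame_monoBlock_of_le (k := k) i (h i)
    have h5 := le_mixTuple (l := l) (update_le h i)
    rw [mixTuple_cons] at h5
    rw [List.flatMap_cons, List.map_append, List.map_cons, List.prod_cons,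
      h4.smul_append (dLat_mono h5) (dLat_mono (le_update_of_le (h i))) h2
        (map_mem_dLat hu h4.mem) (map_mem_dLat hu h2.mem)
        (wedgeList_map_monoBlock hu i (m i - a i).toNat
          (by have : a i ≤ m i := h i; omega)) h1
        (finite_dLat _ _), Units.val_mul]

theorem wedgeList_map_monoFrame {u : Fin r → k⸨X⸩ˣ} (hu : ∀ i, val (u i) = 0) {a m : Fin r → ℤ}
    (h : a ≤ m) :
    wedgeList (dLat k a) (dLat k m) ((monoFrame k a m).map (glEquiv (diagGL u)))
      = ((∏ i, lc (u i) ^ (m i - a i) : kˣ) : k) • wedgeList (dLat k a) (dLat k m)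
        (monoFrame k a m) := by
  have h1 := wedgeList_map_flatMap hu (List.finRange r) (List.nodup_finRange r) h
  rwa [mixTuple_finRange, ← List.ofFn_eq_map, List.prod_ofFn] at h1

end UnitScaling

/-! ### Lifts of monomial matrices to the determinant extension -/

section TorusLift

universe u

variable {k : Type u} [Field k] {r : ℕ}

/-- The unit `t ϖ^{-v(t)}`. -/
noncomputable def unitPart (t : k⸨X⸩ˣ) : k⸨X⸩ˣ := t * unif k (-val t)

theorem val_unitPart (t : k⸨X⸩ˣ) : val (unitPart t) = 0 := by
  rw [unitPart, val_mul, val_unif, add_neg_cancel]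

theorem lc_unitPart (t : k⸨X⸩ˣ) : lc (unitPart t) = lc t := by
  rw [unitPart, lc_mul, lc_unif, mul_one]

theorem unif_mul_unitPart (t : k⸨X⸩ˣ) : unif k (val t) * unitPart t = t := by
  rw [unitPart, mul_left_comm, ← unif_add, add_neg_cancel, unif_zero, mul_one]

theorem unitPart_mul (t t' : k⸨X⸩ˣ) : unitPart (t * t') = unitPart t * unitPart t' := by
  rw [unitPart, unitPart, unitPart, val_mul, neg_add, unif_add, mul_mul_mul_comm]

theorem unitPart_of_val_eq_zero {t : k⸨X⸩ˣ} (h : val t = 0) : unitPart t = t := by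
  rw [unitPart, h, neg_zero, unif_zero, mul_one]

/-- The diagonal matrix of the unit parts, in `GL_r(O)`. -/
noncomputable def unitDiag (t : Fin r → k⸨X⸩ˣ) : intGL k r :=
  ⟨diagGL fun i => unitPart (t i), diagGL_mem_intGL fun i => val_unitPart (t i)⟩

theorem unitDiag_mul (t t' : Fin r → k⸨X⸩ˣ) : unitDiag (t * t') = unitDiag t * unitDiag t' :=
  Subtype.ext (by
    change diagGL _ = diagGL _ * diagGL _
    rw [← diagGL_mul]
    congr 1
    funext i
    exact unitPart_mul _ _)

/-- The permutation matrices, in `GL_r(O)`. -/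
noncomputable def permInt (k : Type u) [Field k] (r : ℕ) : Equiv.Perm (Fin r) →* intGL k r where
  toFun w := ⟨permGL w, permGL_mem_intGL w⟩
  map_one' := Subtype.ext permGL_one
  map_mul' w w' := Subtype.ext (permGL_mul w w')

theorem permInt_mul_unitDiag (w : Equiv.Perm (Fin r)) (t : Fin r → k⸨X⸩ˣ) :
    permInt k r w * unitDiag t = unitDiag (t ∘ ⇑w⁻¹) * permInt k r w :=
  Subtype.ext (permGL_mul_diagGL w _)

theorem eq_inv_smul_of_eq_smul {E : Type*} [AddCommGroup E] [Module k E] {c : kˣ} {v w : E}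
    (h : w = (c : k) • v) : v = ((c⁻¹ : kˣ) : k) • w := by
  rw [h, _root_.smul_smul, ← Units.val_mul, inv_mul_cancel, Units.val_one, one_smul]

/-- The unit parts have determinant ∏ lc(t_i)^m on O^r modulo ϖ^m O^r and ∏ lc(t_i)^(m - b_i) on ϖ^b
O^r modulo ϖ^m O^r. The commutator is the quotient of the second by the first. -/
theorem kap_unitDiag_mul_torP (t : Fin r → k⸨X⸩ˣ) (b : Fin r → ℤ) :
    kap k r (unitDiag t) * torP k b
      = ACK.smul (∏ i, lc (t i) ^ (-b i)) (torP k b * kap k r (unitDiag t)) := by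
  obtain ⟨m, hm, h0, hb, -, -, -⟩ := exists_even_bound b b
  have hu : ∀ i, val (unitPart (t i)) = 0 := fun i => val_unitPart (t i)
  have h1 := torP_sends_even (k := k) hm h0 hb
  have h2 := kapFun_mul_sends (unitDiag t) h1
  have h3 := ACK.smul_sends (mul_kapFun_sends (unitDiag t) h1) (∏ i, lc (t i) ^ (-b i))
  rw [mul_one] at h3
  have e : act (unitDiag t).1 (dLat k fun _ => m) = dLat k fun _ => m :=
    act_diagGL_of_val_eq_zero hu _
  have eB : act (kapFun (unitDiag t) * torP k b).g (stdLat k r) = dLat k b := by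
    rw [ACK.mul_g, torP_g]
    change act (diagGL _ * diagGL _) _ = _
    rw [← diagGL_mul, ← mul_one (diagGL _), ← permGL_one, act_diagGL_mul_permGL]
    congr 1
    funext i
    rw [val_mul, hu, val_unif, zero_add]
  rw [e] at h2
  have w1 := wedgeList_map_monoFrame hu (a := (0 : Fin r → ℤ)) (m := fun _ => m) fun _ => h0
  have w2 := wedgeList_map_monoFrame hu (a := b) (m := fun _ => m) hb
  simp only [lc_unitPart] at w1 w2
  have w1' : wedgeList (stdLat k r) (dLat k fun _ => m) (monoFrame k 0 fun _ => m)
      = (((∏ i, lc (t i) ^ (m - (0 : Fin r → ℤ) i))⁻¹ : kˣ) : k) •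
        wedgeList (stdLat k r) (dLat k fun _ => m)
          ((monoFrame k 0 fun _ => m).map (glEquiv (unitDiag t).1)) :=
    eq_inv_smul_of_eq_smul w1
  have w2' : wedgeList (dLat k b) (dLat k fun _ => m) (monoFrame k b fun _ => m)
      = (((∏ i, lc (t i) ^ (m - b i))⁻¹ : kˣ) : k) •
        wedgeList (dLat k b) (dLat k fun _ => m)
          ((monoFrame k b fun _ => m).map (glEquiv (unitDiag t).1)) :=
    eq_inv_smul_of_eq_smul w2
  have h4 := h2.rescale (d := ∏ i, lc (t i) ^ (-b i)) (isFrame_std fun _ => h0)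
    (eB.symm ▸ isFrame_monoFrame hb) w1' (by rw [eB]; exact w2') (by
      rw [mul_one, eq_mul_inv_iff_mul_eq, inv_mul_eq_iff_eq_mul, ← Finset.prod_mul_distrib]
      refine Finset.prod_congr rfl fun i _ => ?_
      rw [← zpow_add, Pi.zero_apply, sub_zero]
      congr 1)
  refine ACK.ext_sends ?_ h4 h3
  change diagGL _ * (torP k b).g = (torP k b).g * diagGL _
  rw [torP_g, ← diagGL_mul, ← diagGL_mul]
  simp only [mul_comm]

theorem glEquiv_permGL_single (w : Equiv.Perm (Fin r)) (i : Fin r) (y : k⸨X⸩) :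
    glEquiv (permGL w) (Pi.single i y) = Pi.single (w i) y := by
  funext j
  rw [glEquiv_apply, Matrix.mulVec_single]
  change (if j = w i then (1 : k⸨X⸩) else 0) * y = _
  rw [Pi.single_apply, ite_mul, one_mul, zero_mul]

theorem map_permGL_monoFrame (w : Equiv.Perm (Fin r)) (a : Fin r → ℤ) (m : ℤ) :
    (monoFrame k a fun _ => m).map (glEquiv (permGL w))
      = ((List.finRange r).map w).flatMap fun j => monoBlock k j ((a ∘ ⇑w⁻¹) j) m := by
  rw [monoFrame, List.map_flatMap, List.flatMap_map]
  refine List.flatMap_congr fun i _ => ?_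
  rw [monoBlock, monoBlock, List.map_map, Function.comp_apply,
    Equiv.Perm.inv_def, Equiv.symm_apply_apply]
  exact List.map_congr_left fun j _ => glEquiv_permGL_single w i _

theorem finRange_split {l : ℕ} (hl : l + 1 < r) : ∃ L₁ L₂ : List (Fin r),
    List.finRange r = L₁ ++ ⟨l, by omega⟩ :: ⟨l + 1, hl⟩ :: L₂ ∧
    (List.finRange r).map (Equiv.swap ⟨l, by omega⟩ ⟨l + 1, hl⟩)
      = L₁ ++ ⟨l + 1, hl⟩ :: ⟨l, by omega⟩ :: L₂ := by
  have h1 : List.finRange r = (List.finRange r).take l ++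
      ⟨l, by omega⟩ :: ⟨l + 1, hl⟩ :: (List.finRange r).drop (l + 2) := by
    conv_lhs => rw [← List.take_append_drop l (List.finRange r)]
    rw [List.drop_eq_getElem_cons (by simp; omega), List.drop_eq_getElem_cons (by simp; omega)]
    simp
  refine ⟨_, _, h1, ?_⟩
  have h2 := List.nodup_finRange r
  rw [h1] at h2
  generalize (List.finRange r).take l = L₁ at h1 h2 ⊢
  generalize (List.finRange r).drop (l + 2) = L₂ at h1 h2 ⊢
  have key : ∀ L : List (Fin r), (⟨l, by omega⟩ : Fin r) ∉ L → (⟨l + 1, hl⟩ : Fin r) ∉ L →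
      L.map (Equiv.swap ⟨l, by omega⟩ ⟨l + 1, hl⟩) = L := by
    intro L ha hb
    conv_rhs => rw [← List.map_id L]
    refine List.map_congr_left fun x hx => ?_
    exact Equiv.swap_apply_of_ne_of_ne (ne_of_mem_of_not_mem hx ha) (ne_of_mem_of_not_mem hx hb)
  rw [List.nodup_append, List.nodup_cons, List.nodup_cons] at h2
  obtain ⟨-, ⟨h3, h4, -⟩, h5⟩ := h2
  rw [h1, List.map_append, List.map_cons, List.map_cons, Equiv.swap_apply_left,
    Equiv.swap_apply_right, key L₁ (fun h => h5 _ h _ (by simp) rfl)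
      (fun h => h5 _ h _ (by simp) rfl), key L₂ (fun h => h3 (List.mem_cons_of_mem _ h)) h4]

/-- The reflection exchanges two neighbouring blocks, of lengths m - a_l and m - a_(l+1). The
product of these lengths has the parity of a_l a_(l+1) because m is even. -/
theorem wedgeList_map_swap {l : ℕ} (hl : l + 1 < r) (a : Fin r → ℤ) {m : ℤ} (hm : Even m)
    (ha : ∀ i, a i ≤ m) (A B : Submodule k (Fin r → k⸨X⸩)) :
    wedgeList A B (monoFrame k (a ∘ Equiv.swap ⟨l, by omega⟩ ⟨l + 1, hl⟩) fun _ => m)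
      = (((-1 : kˣ) ^ (a ⟨l, by omega⟩ * a ⟨l + 1, hl⟩) : kˣ) : k) • wedgeList A B
        ((monoFrame k a fun _ => m).map
          (glEquiv (permGL (Equiv.swap ⟨l, by omega⟩ ⟨l + 1, hl⟩)))) := by
  obtain ⟨L₁, L₂, h1, h2⟩ := finRange_split hl
  rw [map_permGL_monoFrame, Equiv.swap_inv, h2, monoFrame, h1]
  simp only [List.flatMap_append, List.flatMap_cons, Function.comp_apply, Equiv.swap_apply_left,
    Equiv.swap_apply_right]
  rw [← List.append_assoc (monoBlock _ _ _ _), ← List.append_assoc (monoBlock _ _ _ _),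
    wedgeList_append, wedgeList_append, wedgeList_append_comm_units, length_monoBlock,
    length_monoBlock, Int.toNat_of_nonneg (sub_nonneg.2 (ha _)),
    Int.toNat_of_nonneg (sub_nonneg.2 (ha _)), smul_mul_assoc, mul_smul_comm,
    neg_one_zpow_congr (n := a ⟨l, by omega⟩ * a ⟨l + 1, hl⟩), ← wedgeList_append,
    ← wedgeList_append]
  have : (m - a ⟨l + 1, hl⟩) * (m - a ⟨l, by omega⟩) - a ⟨l, by omega⟩ * a ⟨l + 1, hl⟩
    = m * (m - a ⟨l + 1, hl⟩ - a ⟨l, by omega⟩) := by ring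
  rw [this]
  exact hm.mul_right _

theorem act_permGL_const (w : Equiv.Perm (Fin r)) (m : ℤ) :
    act (permGL w) (dLat k fun _ => m) = dLat k fun _ => m := by
  have h : ∀ w : Equiv.Perm (Fin r), dLat k (fun _ => m)
      = act (diagGL (fun _ => unif k m) * permGL w) (stdLat k r) := fun w => by
    rw [act_diagGL_mul_permGL]
    simp only [val_unif]
  have h1 := h 1
  rw [permGL_one, mul_one] at h1
  conv_lhs => rw [h1]
  rw [act, act_mul, permGL_mul_diagGL]
  exact (h w).symm

/-- Only the target frame contributes a sign: in the source frame all exponents are 0 and the blocks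
have even length. -/
theorem kap_swap_mul_torP {l : ℕ} (hl : l + 1 < r) (a : Fin r → ℤ) :
    kap k r (permInt k r (Equiv.swap ⟨l, by omega⟩ ⟨l + 1, hl⟩)) * torP k a
      = ACK.smul ((-1) ^ (a ⟨l, by omega⟩ * a ⟨l + 1, hl⟩))
        (torP k (a ∘ Equiv.swap ⟨l, by omega⟩ ⟨l + 1, hl⟩)
          * kap k r (permInt k r (Equiv.swap ⟨l, by omega⟩ ⟨l + 1, hl⟩))) := by
  obtain ⟨α, hα⟩ : ∃ α : Equiv.Perm (Fin r), α = Equiv.swap ⟨l, by omega⟩ ⟨l + 1, hl⟩ := ⟨_, rfl⟩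
  obtain ⟨m, hm, h0, ha, -, -, -⟩ := exists_even_bound a a
  have h1 := torP_sends_even (k := k) hm h0 ha
  have h1' := torP_sends_even (k := k) (a := a ∘ α) hm h0 fun i => ha (α i)
  have h2 := kapFun_mul_sends (permInt k r α) h1
  have h3 := ACK.smul_sends (mul_kapFun_sends (permInt k r α) h1')
    ((-1) ^ (a ⟨l, by omega⟩ * a ⟨l + 1, hl⟩))
  rw [mul_one] at h3
  have e : act (permInt k r α).1 (dLat k fun _ => m) = dLat k fun _ => m := act_permGL_const α m
  have eg : (kapFun (permInt k r α) * torP k a).g = (torP k (a ∘ α) * kapFun (permInt k r α)).g := by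
    change permGL α * (torP k a).g = (torP k (a ∘ α)).g * permGL α
    rw [torP_g, torP_g, permGL_mul_diagGL, hα, Equiv.swap_inv]
    rfl
  have eB : act (kapFun (permInt k r α) * torP k a).g (stdLat k r) = dLat k (a ∘ α) := by
    rw [eg]
    change act ((torP k (a ∘ α)).g * permGL α) _ = _
    rw [torP_g, act_diagGL_mul_permGL]
    simp only [val_unif]
  rw [e] at h2
  have w1 : wedgeList (stdLat k r) (dLat k fun _ => m) (monoFrame k 0 fun _ => m)
      = ((1 : kˣ) : k) • wedgeList (stdLat k r) (dLat k fun _ => m)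
        ((monoFrame k 0 fun _ => m).map (glEquiv (permInt k r α).1)) := by
    have := wedgeList_map_swap (k := k) hl 0 hm (fun _ => h0) (stdLat k r) (dLat k fun _ => m)
    rwa [Pi.zero_apply, Pi.zero_apply, mul_zero, zpow_zero, ← hα] at this
  have w2 := wedgeList_map_swap (k := k) hl a hm ha (dLat k (a ∘ α)) (dLat k fun _ => m)
  rw [← hα] at w2 ⊢
  have h4 := h2.rescale (d := (-1) ^ (a ⟨l, by omega⟩ * a ⟨l + 1, hl⟩)) (isFrame_std fun _ => h0)
    (eB.symm ▸ isFrame_monoFrame fun i => ha (α i)) w1 (by rw [eB]; exact w2)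
    (by rw [neg_one_zpow_sq, mul_one])
  exact ACK.ext_sends eg h4 h3

/-- The element `(t, 𝔡_t)` of `G̃'_r`. -/
noncomputable def torLift (t : Fin r → k⸨X⸩ˣ) : ACK k r :=
  torP k (fun i => val (t i)) * kap k r (unitDiag t)

theorem torLift_g (t : Fin r → k⸨X⸩ˣ) : (torLift t).g = diagGL t := by
  change (torP k fun i => val (t i)).g * diagGL _ = _
  rw [torP_g, ← diagGL_mul]
  simp only [unif_mul_unitPart]

/-- The leading coefficients come from moving the units of t past the powers of ϖ in t', the signs
from multiplying the two powers of ϖ. -/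
theorem torLift_mul (t t' : Fin r → k⸨X⸩ˣ) :
    torLift t * torLift t' = ACK.smul ((∏ i, lc (t i) ^ (-val (t' i)))
      * pairProd fun i j => (-1) ^ (val (t i) * val (t' j))) (torLift (t * t')) := by
  have e : ((fun i => val (t i)) + fun i => val (t' i)) = fun i => val ((t * t') i) := by
    funext i
    exact (val_mul _ _).symm
  rw [torLift, torLift, mul_assoc, ← mul_assoc (kap k r _), kap_unitDiag_mul_torP, ACK.smul_mul,
    ACK.mul_smul, mul_assoc, ← mul_assoc (torP k _) (torP k _), torP_mul, ACK.smul_mul,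
    ACK.smul_smul, ← map_mul, ← unitDiag_mul, e, torLift]

theorem torLift_of_val_eq_zero {t : Fin r → k⸨X⸩ˣ} (h : ∀ i, val (t i) = 0) :
    torLift t = kap k r (unitDiag t) := by
  have h1 := torP_mul (k := k) (0 : Fin r → ℤ) 0
  rw [pairProd_eq_one (fun i j _ => by simp), ACK.smul_one, add_zero, mul_eq_left] at h1
  rw [torLift, show (fun i => val (t i)) = 0 from funext h, h1, one_mul]

theorem kap_swap_mul_torLift {l : ℕ} (hl : l + 1 < r) (t : Fin r → k⸨X⸩ˣ) :
    kap k r (permInt k r (Equiv.swap ⟨l, by omega⟩ ⟨l + 1, hl⟩)) * torLift t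
      = ACK.smul ((-1) ^ (val (t ⟨l, by omega⟩) * val (t ⟨l + 1, hl⟩)))
        (torLift (t ∘ Equiv.swap ⟨l, by omega⟩ ⟨l + 1, hl⟩)
          * kap k r (permInt k r (Equiv.swap ⟨l, by omega⟩ ⟨l + 1, hl⟩))) := by
  rw [torLift, ← mul_assoc, kap_swap_mul_torP, ACK.smul_mul, mul_assoc, ← map_mul,
    permInt_mul_unitDiag, map_mul, ← mul_assoc, Equiv.swap_inv]
  rfl

theorem torLift_mul_kap_g (t : Fin r → k⸨X⸩ˣ) (w : Equiv.Perm (Fin r)) :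
    (torLift t * kap k r (permInt k r w)).g = diagGL t * permGL w := by
  rw [ACK.mul_g, torLift_g]
  rfl

theorem isTorusLift_iff_sends {t : Fin r → k⸨X⸩ˣ} {w : Equiv.Perm (Fin r)} {x : ACK k r} :
    IsTorusLift t w x ↔ x.g = diagGL t * permGL w ∧ ∃ m : ℕ, Even m ∧
      Rel.Sends x.v (dLat k fun _ => (m : ℤ)) (monoFrame k 0 fun _ => (m : ℤ))
        (monoFrame k (fun i => val (t i)) fun _ => (m : ℤ)) 1 := by
  constructor
  · rintro ⟨hg, m, hm, hM, hA, hB, h⟩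
    have eB : act x.g (stdLat k r) = dLat k fun i => val (t i) := by
      rw [hg, act_diagGL_mul_permGL]
    -- The inclusion ϖ^m O^r ⊂ tw O^r, tested on ϖ^m e_i, bounds the valuations by m.
    have hle : (fun i => val (t i)) ≤ fun _ => (m : ℤ) := by
      intro i
      by_contra! hlt
      have h1 : (Pi.single i (HahnSeries.single (m : ℤ) (1 : k)) : Fin r → k⸨X⸩)
          ∈ pLat k r m := single_mem_dLat (a := fun _ => (m : ℤ))
            fun n hn => coeff_single_of_lt hn
      have h2 := hM.trans inf_le_right h1
      rw [eB] at h2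
      have h3 := h2 i m hlt
      simp at h3
    have hl : IsFrame (stdLat k r) (pLat k r m) (monoFrame k 0 fun _ => (m : ℤ)) :=
      isFrame_std fun _ => Int.natCast_nonneg m
    have hl' : IsFrame (act x.g (stdLat k r)) (pLat k r m)
        (monoFrame k (fun i => val (t i)) fun _ => (m : ℤ)) := eB.symm ▸ isFrame_monoFrame hle
    refine ⟨hg, m, hm, hM, hl, hl', ?_⟩
    rw [Units.val_one, one_smul]
    exact h hl.vol rfl
  · rintro ⟨hg, m, hm, h⟩
    refine ⟨hg, m, hm, h.le, h.left.finite, h.right.finite, fun X hX => ?_⟩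
    obtain rfl : X = h.left.vol := Subtype.ext hX
    have := h.eq
    rw [Units.val_one, one_smul] at this
    exact this

/-- Independence of the even level m: two admissible elements are compared through
`Rel.Sends.of_even` at one common level. The permutation w only multiplies on the right by the
canonical lift. -/
theorem isTorusLift_iff {t : Fin r → k⸨X⸩ˣ} {w : Equiv.Perm (Fin r)} {x : ACK k r} :
    IsTorusLift t w x ↔ x = torLift t * kap k r (permInt k r w) := by
  have key : IsTorusLift t w (torLift t * kap k r (permInt k r w)) := by
    rw [isTorusLift_iff_sends]
    obtain ⟨m, hm, h0, ha, -⟩ := exists_even_bound (fun i => val (t i)) 0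
    obtain ⟨m, rfl⟩ := Int.eq_ofNat_of_zero_le h0
    refine ⟨torLift_mul_kap_g t w, m, by exact_mod_cast hm, ?_⟩
    exact mul_kapFun_sends _ (mul_kapFun_sends _ (torP_sends_even hm h0 ha))
  refine ⟨fun h => ?_, fun h => h ▸ key⟩
  rw [isTorusLift_iff_sends] at h key
  obtain ⟨hg, m, hm, h⟩ := h
  obtain ⟨hg', m', hm', h'⟩ := key
  have eB : ∀ {y : ACK k r}, y.g = diagGL t * permGL w →
      act y.g (stdLat k r) = dLat k fun i => val (t i) := fun h => by
    rw [h, act_diagGL_mul_permGL]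
  have hle : ∀ {y : ACK k r} {m : ℕ} {c : kˣ}, y.g = diagGL t * permGL w →
      Rel.Sends y.v (dLat k fun _ => (m : ℤ)) (monoFrame k 0 fun _ => (m : ℤ))
        (monoFrame k (fun i => val (t i)) fun _ => (m : ℤ)) c → ∀ i, val (t i) ≤ m := by
    intro y m c hg h i
    by_contra! hlt
    have h1 : (Pi.single i (HahnSeries.single (m : ℤ) (1 : k)) : Fin r → k⸨X⸩)
        ∈ dLat k fun _ => (m : ℤ) := single_mem_dLat fun n hn => coeff_single_of_lt hn
    have h2 := h.le.trans inf_le_right h1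
    rw [eB hg] at h2
    have h3 := h2 i m hlt
    simp at h3
  have hm1 : Even (m : ℤ) := by exact_mod_cast hm
  have hm1' : Even (m' : ℤ) := by exact_mod_cast hm'
  have h1 := h.of_even (eB hg) hm1 (Int.natCast_nonneg m) (hle hg h)
    (M := fun _ => (m : ℤ)) (fun _ => Int.natCast_nonneg m) (hle hg h)
  have h2 := h'.of_even (eB hg') hm1' (Int.natCast_nonneg m') (hle hg' h')
    (M := fun _ => (m : ℤ)) (fun _ => Int.natCast_nonneg m) (hle hg h)
  exact ACK.ext_sends (hg.trans hg'.symm) h1 h2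

end TorusLift

/-! ### Rearranging products over pairs -/

section PairProdSwap

variable {A : Type*} [CommGroup A]

theorem zpow_finset_sum {ι : Type*} (x : A) (s : Finset ι) (f : ι → ℤ) :
    x ^ (∑ i ∈ s, f i) = ∏ i ∈ s, x ^ f i := by
  classical
  induction s using Finset.induction_on with
  | empty => simp
  | insert i s hi ih => rw [Finset.sum_insert hi, Finset.prod_insert hi, zpow_add, ih]

theorem prod_prod_eq_pairProd {r : ℕ} (f : Fin r → Fin r → A) :
    ∏ i, ∏ j, f i j = (∏ i, f i i) * pairProd fun i j => f i j * f j i := by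
  induction r with
  | zero => simp [pairProd]
  | succ r ih =>
    rw [pairProd_succ]
    simp only [Fin.prod_univ_succ, Finset.prod_mul_distrib, ih]
    simp only [mul_assoc, mul_comm, mul_left_comm]

/-- Exchanging two neighbours of a list reverses the order of one pair only. -/
theorem prod_listPairProd_swap {ι : Type*} (f : ι → ι → A) (i j : ι) (L₁ L₂ : List ι) :
    listPairProd f (L₁ ++ j :: i :: L₂) * f i j = listPairProd f (L₁ ++ i :: j :: L₂) * f j i := by
  induction L₁ with
  | nil =>
    simp only [List.nil_append, listPairProd, List.map_cons, List.prod_cons]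
    simp only [mul_assoc, mul_comm, mul_left_comm]
  | cons x L₁ ih =>
    simp only [List.cons_append, listPairProd, mul_assoc, ih]
    simp only [List.map_append, List.map_cons, List.prod_append, List.prod_cons, mul_left_comm]

theorem pairProd_swap {r l : ℕ} (hl : l + 1 < r) (f : Fin r → Fin r → A) :
    (pairProd fun i j => f (Equiv.swap ⟨l, by omega⟩ ⟨l + 1, hl⟩ i)
      (Equiv.swap ⟨l, by omega⟩ ⟨l + 1, hl⟩ j)) * f ⟨l, by omega⟩ ⟨l + 1, hl⟩
      = pairProd f * f ⟨l + 1, hl⟩ ⟨l, by omega⟩ := by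
  obtain ⟨L₁, L₂, h1, h2⟩ := finRange_split hl
  rw [← listPairProd_finRange, ← listPairProd_map f, h2, prod_listPairProd_swap, ← h1,
    listPairProd_finRange]

end PairProdSwap

/-! ### Torus and permutation matrices in the geometric extension -/

section GeoTorus

universe u

variable {k : Type u} [Field k] {r : ℕ}

/-- The element `(f, 𝔡_f)` of `G̃'_1`. -/
noncomputable abbrev lineLift (f : k⸨X⸩ˣ) : ACK k 1 := torLift fun _ => f

theorem lineLift_mul (f g : k⸨X⸩ˣ) :
    lineLift f * lineLift g = ACK.smul (lc f ^ (-val g)) (lineLift (f * g)) := by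
  rw [lineLift, lineLift, torLift_mul, pairProd_eq_one fun i j h => absurd h (by omega), mul_one,
    Fin.prod_univ_one]
  rfl

theorem unitDiag_one : unitDiag (1 : Fin r → k⸨X⸩ˣ) = 1 := by
  have := unitDiag_mul (1 : Fin r → k⸨X⸩ˣ) 1
  rwa [mul_one, right_eq_mul] at this

theorem torLift_one : torLift (1 : Fin r → k⸨X⸩ˣ) = 1 := by
  rw [torLift_of_val_eq_zero (t := 1) fun _ => val_one, unitDiag_one, map_one]

/-- The product `𝔡_{t_r} * ⋯ * 𝔡_{t_1}` in `G̃'_1`. -/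
theorem foldr_lineLift (t : Fin r → k⸨X⸩ˣ) :
    (List.ofFn fun i => lineLift (t i)).foldr (fun a acc => acc * a) (ACK.one k 1)
      = ACK.smul (pairProd fun i j => lc (t j) ^ (-val (t i))) (lineLift (∏ i, t i)) := by
  induction r with
  | zero =>
    rw [pairProd_eq_one fun i => i.elim0, ACK.smul_one]
    exact torLift_one.symm
  | succ r ih =>
    rw [List.ofFn_succ, List.foldr_cons, ih, ACK.smul_mul, lineLift_mul, ACK.smul_smul,
      pairProd_succ, Fin.prod_univ_succ, mul_comm (t 0), lc_prod, Finset.prod_zpow,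
      mul_comm (pairProd _)]

/-- The zero-based index i is the first entry of r - 1 - i pairs; this identifies the explicit sign
in δ_t with a factor of `torCoeff`. -/
theorem pairProd_neg_one_zpow (a : Fin r → ℤ) :
    (pairProd fun i _ => (-1 : kˣ) ^ a i) = (-1) ^ ∑ i : Fin r, ((r : ℤ) - 1 - (i : ℤ)) * a i := by
  induction r with
  | zero => simp [pairProd]
  | succ r ih =>
    rw [pairProd_succ, ih, Fin.sum_univ_succ, Finset.prod_const, Finset.card_univ,
      Fintype.card_fin, zpow_add, ← zpow_natCast, ← zpow_mul]
    congr 2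
    · push_cast
      simp only [Fin.val_zero, Nat.cast_zero]
      ring
    · refine Finset.sum_congr rfl fun i _ => ?_
      push_cast [Fin.val_succ]
      ring

/-- The scalar relating the sign and product in the definition of `δ_t` to `𝔡_{det t}`. -/
noncomputable def torCoeff (t : Fin r → k⸨X⸩ˣ) : kˣ :=
  pairProd fun i j => (-1) ^ val (t i) * lc (t j) ^ (-val (t i))

/-- The elements of `GL_r(O)` with determinant in `O^*`. -/
noncomputable def intDet (k : Type u) [Field k] (r : ℕ) : Subgroup (GL (Fin r) k⸨X⸩) where
  carrier := {u | u ∈ intGL k r ∧ detGL1 u ∈ intGL k 1}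
  one_mem' := ⟨one_mem _, by rw [detGL1_one]; exact one_mem _⟩
  mul_mem' h h' := ⟨mul_mem h.1 h'.1, by rw [detGL1_mul]; exact mul_mem h.2 h'.2⟩
  inv_mem' {x} h := ⟨inv_mem h.1, by
    have : detGL1 x⁻¹ = (detGL1 x)⁻¹ :=
      eq_inv_of_mul_eq_one_left (by rw [← detGL1_mul, inv_mul_cancel, detGL1_one])
    rw [this]
    exact inv_mem h.2⟩

/-- The inclusion in `GL_r(O)`. -/
noncomputable def intDetIncl (k : Type u) [Field k] (r : ℕ) : intDet k r →* intGL k r where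
  toFun u := ⟨u.1, u.2.1⟩
  map_one' := rfl
  map_mul' _ _ := rfl

/-- The determinant. -/
noncomputable def intDetDet (k : Type u) [Field k] (r : ℕ) : intDet k r →* intGL k 1 where
  toFun u := ⟨detGL1 u.1, u.2.2⟩
  map_one' := Subtype.ext detGL1_one
  map_mul' u u' := Subtype.ext (detGL1_mul u.1 u'.1)

/-- The homomorphism to `G̃_{r,geo}` given by homomorphisms to `G̃'_1` and `G̃'_r`. -/
noncomputable def Geo.pairHom {G : Type*} [Group G] (f : G →* ACK k 1) (g : G →* ACK k r)
    (h : ∀ x, (f x).g = detGL1 (g x).g) : G →* Geo k r :=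
  MonoidHom.mk' (fun x => Geo.pair (f x) (g x) (h x)) fun x y =>
    (Geo.pair_congr _ (map_mul f x y) (map_mul g x y)).trans (Geo.pair_mul (h x) (h y)).symm

/-- The splitting of `G̃_{r,geo}` over `GL_r(O)`. -/
noncomputable def kapGeo (k : Type u) [Field k] (r : ℕ) : intDet k r →* Geo k r :=
  Geo.pairHom ((kap k 1).comp (intDetDet k r)) ((kap k r).comp (intDetIncl k r)) fun _ => rfl

theorem kapGeo_apply (u : intDet k r) :
    kapGeo k r u = Geo.pair (kap k 1 (intDetDet k r u)) (kap k r (intDetIncl k r u)) rfl := rfl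

theorem det_diagGL (t : Fin r → k⸨X⸩ˣ) :
    Matrix.GeneralLinearGroup.det (diagGL t) = ∏ i, t i :=
  Units.ext ((Matrix.det_diagonal).trans (by simp))

theorem detGL1_diagGL (t : Fin r → k⸨X⸩ˣ) : detGL1 (diagGL t) = diagGL fun _ => ∏ i, t i := by
  rw [detGL1, det_diagGL]

/-- The sign of a permutation, in `F^*`. -/
noncomputable def signUnit (k : Type u) [Field k] (w : Equiv.Perm (Fin r)) : k⸨X⸩ˣ :=
  Units.map (Int.castRingHom k⸨X⸩).toMonoidHom (Equiv.Perm.sign w)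

theorem det_permGL (w : Equiv.Perm (Fin r)) :
    Matrix.GeneralLinearGroup.det (permGL w) = signUnit k w := by
  refine Units.ext ?_
  change (permGL w : GL (Fin r) k⸨X⸩).val.det = _
  have h : (permGL w : GL (Fin r) k⸨X⸩).val = (1 : Matrix (Fin r) (Fin r) k⸨X⸩).submatrix ⇑w⁻¹ id := by
    ext i j
    rw [← mul_one (permGL w : GL (Fin r) k⸨X⸩).val, permGL_mul_apply]
    rfl
  rw [h, Matrix.det_permute, Matrix.det_one, mul_one, Equiv.Perm.sign_inv]
  rfl

theorem signUnit_cases (w : Equiv.Perm (Fin r)) : signUnit k w = 1 ∨ signUnit k w = -1 := by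
  rcases Int.units_eq_one_or (Equiv.Perm.sign w) with h | h
  · left
    rw [signUnit, h, map_one]
  · right
    rw [signUnit, h]
    ext1
    simp

theorem val_signUnit (w : Equiv.Perm (Fin r)) : val (signUnit k w) = 0 := by
  rcases signUnit_cases (k := k) w with h | h
  · rw [h, val_one]
  · rw [h, val_neg, val_one]

theorem permGL_mem_intDet (w : Equiv.Perm (Fin r)) : permGL w ∈ intDet k r :=
  ⟨permGL_mem_intGL w, diagGL_mem_intGL fun _ => by rw [det_permGL, val_signUnit]⟩

theorem diagGL_mem_intDet {t : Fin r → k⸨X⸩ˣ} (ht : ∀ i, val (t i) = 0) :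
    diagGL t ∈ intDet k r :=
  ⟨diagGL_mem_intGL ht, diagGL_mem_intGL fun _ => by
    rw [det_diagGL, val_prod]
    exact Finset.sum_eq_zero fun i _ => ht i⟩

theorem elemGL_mem_intDet {i j : Fin r} (hij : i ≠ j) {a : k⸨X⸩}
    (ha : ∀ n < 0, HahnSeries.coeff a n = 0) : elemGL hij a ∈ intDet k r := by
  refine ⟨elemGL_mem_intGL hij ha, ?_⟩
  have : detGL1 (elemGL hij a) = 1 := by
    have : Matrix.GeneralLinearGroup.det (elemGL hij a) = 1 :=
      Units.ext (Matrix.det_transvection_of_ne i j hij a)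
    rw [detGL1, this]
    exact diagGL_one
  rw [this]
  exact one_mem _

/-- The permutation matrices. -/
noncomputable def permDet (k : Type u) [Field k] (r : ℕ) : Equiv.Perm (Fin r) →* intDet k r where
  toFun w := ⟨permGL w, permGL_mem_intDet w⟩
  map_one' := Subtype.ext permGL_one
  map_mul' w w' := Subtype.ext (permGL_mul w w')

/-- The elements `δ_w` of `G̃_{r,geo}` for permutation matrices `w`. -/
noncomputable def weylGeo (k : Type u) [Field k] (r : ℕ) : Equiv.Perm (Fin r) →* Geo k r :=
  (kapGeo k r).comp (permDet k r)

/-- The element `(t, δ_t)` of `G̃_{r,geo}`. -/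
noncomputable def torGeo (t : Fin r → k⸨X⸩ˣ) : Geo k r :=
  Geo.pair (ACK.smul (torCoeff t) (lineLift (∏ i, t i))) (torLift t) (by
    change (lineLift _).g = _
    rw [torLift_g, torLift_g, detGL1_diagGL])

theorem torGeo_proj (t : Fin r → k⸨X⸩ˣ) : (torGeo t).proj = diagGL t := torLift_g t

theorem weylGeo_proj (w : Equiv.Perm (Fin r)) : (weylGeo k r w).proj = permGL w := rfl

theorem torGeo_of_val_eq_zero {t : Fin r → k⸨X⸩ˣ} (ht : ∀ i, val (t i) = 0) :
    torGeo t = kapGeo k r ⟨diagGL t, diagGL_mem_intDet ht⟩ := by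
  have h1 : torCoeff t = 1 := pairProd_eq_one fun i j _ => by simp [ht]
  have h2 : val (∏ i, t i) = 0 := by
    rw [val_prod]
    exact Finset.sum_eq_zero fun i _ => ht i
  rw [kapGeo_apply, torGeo]
  refine Geo.pair_congr _ ?_ ?_
  · rw [h1, ACK.smul_one, lineLift, torLift_of_val_eq_zero fun _ => h2]
    refine congrArg (kap k 1) (Subtype.ext ?_)
    change diagGL _ = detGL1 _
    simp only [detGL1_diagGL, unitPart_of_val_eq_zero h2]
  · rw [torLift_of_val_eq_zero ht]
    refine congrArg (kap k r) (Subtype.ext ?_)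
    change diagGL _ = diagGL _
    simp only [unitPart_of_val_eq_zero (ht _)]

theorem torGeo_one : torGeo (1 : Fin r → k⸨X⸩ˣ) = 1 := by
  rw [torGeo_of_val_eq_zero (t := 1) fun _ => val_one]
  exact (congrArg (kapGeo k r) (Subtype.ext diagGL_one)).trans (map_one _)

/-- The determinant contributes lc(t_i)^(-v(t'_j)) for all i, j; the terms i = j cancel those of
G̃'_r. For i < j the coboundary of `torCoeff` removes the factor of the pair (j, i) and adds
lc(t'_j)^(v(t_i)). With the sign from G̃'_r this is the inverse tame symbol of (t_i, t'_j). The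
signs in `torCoeff` are multiplicative in t and do not matter here; they do for simple reflections.
-/
theorem torGeo_mul (t t' : Fin r → k⸨X⸩ˣ) :
    torGeo t * torGeo t'
      = Geo.incl k r (pairProd fun i j => (tame (t i) (t' j))⁻¹) * torGeo (t * t') := by
  have e1 : torLift t * torLift t' = ACK.smul ((∏ i, lc (t i) ^ (-val (t' i)))
      * pairProd fun i j => (-1) ^ (val (t i) * val (t' j))) (torLift (t * t')) := torLift_mul t t'
  have e2 : ACK.smul (torCoeff t) (lineLift (∏ i, t i))
      * ACK.smul (torCoeff t') (lineLift (∏ i, t' i))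
      = ACK.smul (torCoeff t * torCoeff t' * (∏ i, ∏ j, lc (t i) ^ (-val (t' j)))
        * (torCoeff (t * t'))⁻¹)
        (ACK.smul (torCoeff (t * t')) (lineLift (∏ i, (t * t') i))) := by
    rw [ACK.smul_mul_smul, lineLift_mul, ACK.smul_smul, ACK.smul_smul, ← Finset.prod_mul_distrib,
      inv_mul_cancel_right]
    congr 2
    rw [lc_prod, val_prod, ← Finset.sum_neg_distrib, ← Finset.prod_zpow]
    simp only [zpow_finset_sum]
  rw [torGeo, torGeo, Geo.pair_mul]
  refine (Geo.pair_congr _ e2 e1).trans ((Geo.pair_smul_smul _ _ _).trans ?_)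
  congr 2
  rw [prod_prod_eq_pairProd, div_eq_iff_eq_mul, mul_inv_eq_iff_eq_mul, torCoeff, torCoeff, torCoeff,
    mul_left_comm _ (∏ i, lc (t i) ^ (-val (t' i))), mul_left_comm _ (∏ i, lc (t i) ^ (-val (t' i))),
    mul_assoc (∏ i, lc (t i) ^ (-val (t' i)))]
  congr 1
  simp only [← pairProd_mul]
  refine pairProd_congr fun i j _ => ?_
  simp only [Pi.mul_apply, lc_mul, val_mul, tame, zpow_neg, zpow_add, mul_zpow, neg_add]
  ext1
  push_cast
  field_simp

theorem torCoeff_swap {l : ℕ} (hl : l + 1 < r) (t : Fin r → k⸨X⸩ˣ) :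
    torCoeff (t ∘ Equiv.swap ⟨l, by omega⟩ ⟨l + 1, hl⟩)
        * ((-1) ^ val (t ⟨l, by omega⟩) * lc (t ⟨l + 1, hl⟩) ^ (-val (t ⟨l, by omega⟩)))
      = torCoeff t
        * ((-1) ^ val (t ⟨l + 1, hl⟩) * lc (t ⟨l, by omega⟩) ^ (-val (t ⟨l + 1, hl⟩))) :=
  pairProd_swap hl fun i j => (-1) ^ val (t i) * lc (t j) ^ (-val (t i))

theorem val_neg_one : val (-1 : k⸨X⸩ˣ) = 0 := by rw [val_neg, val_one]

theorem lc_neg_one : lc (-1 : k⸨X⸩ˣ) = -1 := by rw [lc_neg, lc_one]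

theorem neg_one_zpow_neg (n : ℤ) : (-1 : kˣ) ^ (-n) = (-1) ^ n :=
  neg_one_zpow_congr (by rw [show -n - n = 2 * (-n) by ring]; exact even_two_mul _)

theorem tame_neg_one (f : k⸨X⸩ˣ) : tame (-1 : k⸨X⸩ˣ) f = (-1) ^ val f := by
  rw [tame, val_neg_one, lc_neg_one, zero_mul, zpow_zero, one_mul, zpow_zero, div_one]

theorem kap_permDet_g (w : Equiv.Perm (Fin r)) :
    (kap k 1 (intDetDet k r (permDet k r w))).g = detGL1 (kap k r (permInt k r w)).g := rfl

theorem weylGeo_eq (w : Equiv.Perm (Fin r)) : weylGeo k r w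
    = Geo.pair (kap k 1 (intDetDet k r (permDet k r w))) (kap k r (permInt k r w))
      (kap_permDet_g w) := rfl

theorem torCoeff_smul_lineLift_g (t : Fin r → k⸨X⸩ˣ) :
    (ACK.smul (torCoeff t) (lineLift (∏ i, t i))).g = detGL1 (torLift t).g := by
  change (lineLift _).g = _
  rw [torLift_g, torLift_g, detGL1_diagGL]

theorem torGeo_eq (t : Fin r → k⸨X⸩ˣ) : torGeo t
    = Geo.pair (ACK.smul (torCoeff t) (lineLift (∏ i, t i))) (torLift t)
      (torCoeff_smul_lineLift_g t) := rfl

/-- Three contributions: moving det α = -1 past the lift of det t gives (-1)^(v(det t)); exchanging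
the two blocks of monomials gives (-1)^(v(t_l) v(t_(l+1))); the quotient of the values of `torCoeff`
gives the leading coefficients of the tame symbol and the remaining sign. -/
theorem weylGeo_swap_mul_torGeo {l : ℕ} (hl : l + 1 < r) (t : Fin r → k⸨X⸩ˣ) :
    weylGeo k r (Equiv.swap ⟨l, by omega⟩ ⟨l + 1, hl⟩) * torGeo t
      = Geo.incl k r (tame (t ⟨l, by omega⟩) (t ⟨l + 1, hl⟩)
          * (-1) ^ (val (t ⟨l, by omega⟩) + val (t ⟨l + 1, hl⟩)) * (-1) ^ val (∏ i, t i))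
        * (torGeo (t ∘ Equiv.swap ⟨l, by omega⟩ ⟨l + 1, hl⟩)
          * weylGeo k r (Equiv.swap ⟨l, by omega⟩ ⟨l + 1, hl⟩)) := by
  have hsw := torCoeff_swap hl t
  have e1 := kap_swap_mul_torLift hl t
  have hprod : ∏ i, (t ∘ Equiv.swap ⟨l, by omega⟩ ⟨l + 1, hl⟩) i = ∏ i, t i :=
    Equiv.prod_comp _ t
  have hdet : intDetDet k r (permDet k r (Equiv.swap ⟨l, by omega⟩ ⟨l + 1, hl⟩))
      = unitDiag fun _ => (-1 : k⸨X⸩ˣ) := by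
    refine Subtype.ext ?_
    change detGL1 (permGL _) = diagGL _
    have h : signUnit k (Equiv.swap (⟨l, by omega⟩ : Fin r) ⟨l + 1, hl⟩) = -1 := by
      rw [signUnit, Equiv.Perm.sign_swap (by simp)]
      ext1
      simp
    rw [detGL1, det_permGL, h]
    simp only [unitPart_of_val_eq_zero (val_neg_one (k := k))]
  generalize hα : Equiv.swap (⟨l, by omega⟩ : Fin r) ⟨l + 1, hl⟩ = α at *
  generalize t ⟨l, by omega⟩ = f at *
  generalize t ⟨l + 1, hl⟩ = g at *
  have e2 : kap k 1 (unitDiag fun _ => -1) * lineLift (∏ i, t i)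
      = ACK.smul ((-1) ^ val (∏ i, t i)) (lineLift (∏ i, t i) * kap k 1 (unitDiag fun _ => -1)) := by
    rw [lineLift, torLift, ← mul_assoc, kap_unitDiag_mul_torP, ACK.smul_mul, mul_assoc, mul_assoc,
      ← map_mul, ← map_mul, ← unitDiag_mul, ← unitDiag_mul, Fin.prod_univ_one, lc_neg_one,
      neg_one_zpow_neg, mul_comm (fun _ => (-1 : k⸨X⸩ˣ))]
  have e3 : kap k 1 (intDetDet k r (permDet k r α))
        * ACK.smul (torCoeff t) (lineLift (∏ i, t i))
      = ACK.smul (torCoeff t * (-1) ^ val (∏ i, t i) * (torCoeff (t ∘ α))⁻¹)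
        (ACK.smul (torCoeff (t ∘ α)) (lineLift (∏ i, (t ∘ α) i))
          * kap k 1 (intDetDet k r (permDet k r α))) := by
    rw [hdet, hprod, ACK.mul_smul, e2, ACK.smul_mul, ACK.smul_smul, ACK.smul_smul,
      inv_mul_cancel_right]
  rw [weylGeo_eq, torGeo_eq, Geo.pair_mul, torGeo_eq, Geo.pair_mul]
  refine (Geo.pair_congr _ e3 e1).trans ((Geo.pair_smul_smul _ _ _).trans ?_)
  congr 2
  rw [div_eq_iff_eq_mul, mul_inv_eq_iff_eq_mul]
  -- Here f and g stand for t_l and t_(l+1); only their pair changes its order under α.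
  have h1 : torCoeff t = torCoeff (t ∘ α) * ((-1) ^ val f * lc g ^ (-val f))
      * ((-1) ^ val g * lc f ^ (-val g))⁻¹ := eq_mul_inv_of_mul_eq hsw.symm
  rw [h1, tame, zpow_add]
  have h2 : ((-1 : kˣ) ^ val g)⁻¹ = (-1) ^ val g := by rw [← zpow_neg, neg_one_zpow_neg]
  have h3 := neg_one_zpow_sq (k := k) (val f * val g)
  rw [mul_inv, h2, zpow_neg, zpow_neg, inv_inv]
  generalize (-1 : kˣ) ^ (val f * val g) = s at *
  calc _ = torCoeff (t ∘ α) * ((-1) ^ val f * (lc g ^ val f)⁻¹) * ((-1) ^ val g * lc f ^ val g)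
        * (-1) ^ val (∏ i, t i) * (s * s) := by rw [h3, mul_one]
    _ = _ := by
      rw [div_eq_mul_inv]
      simp only [mul_assoc, mul_comm, mul_left_comm]

theorem rel_sends_cast {U : Type u} [AddCommGroup U] [Module k U] {A B B' M : Submodule k U}
    (h : B = B') {x : Rel A B} {l l' : List U} {c : kˣ} (hx : Rel.Sends x M l l' c) :
    Rel.Sends (Rel.cast h x) M l l' c := by
  subst h
  exact hx

theorem act_mul_intGL (g : GL (Fin r) k⸨X⸩) (u : intGL k r) :
    act g (stdLat k r) = act (g * u.1) (stdLat k r) := by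
  rw [← act_mul, mem_intGL.1 u.2]
  rfl

/-- Multiplication by a canonical lift is transport along an equality of lattices. This translates
the identifications D_(tw) = D_t and D_(det tw) = D_(det t) into the group law. -/
theorem mul_kap_eq (x : ACK k r) (u : intGL k r) :
    x * kap k r u = ⟨x.g * u.1, Rel.cast (act_mul_intGL x.g u) x.v⟩ := by
  obtain ⟨M, l, l', c, hx⟩ := x.exists_frames
  exact ACK.ext_sends rfl (mul_kapFun_sends u hx) (rel_sends_cast (act_mul_intGL x.g u) hx)

theorem eq_mul_kap_iff {x y : ACK k r} (u : intGL k r) (hg : y.g = x.g * u.1) :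
    (∃ h, y.v = Rel.cast h x.v) ↔ y = x * kap k r u := by
  rw [mul_kap_eq]
  obtain ⟨g, v⟩ := y
  obtain rfl : g = x.g * u.1 := hg
  constructor
  · rintro ⟨h, hv⟩
    exact congrArg _ hv
  · intro h
    exact ⟨act_mul_intGL x.g u, eq_of_heq (ACK.mk.inj h).2⟩

theorem isGeoTorusLift_iff {t : Fin r → k⸨X⸩ˣ} {w : Equiv.Perm (Fin r)} {x : Geo k r} :
    IsGeoTorusLift t w x ↔ x = torGeo t * weylGeo k r w := by
  have hd : ∀ d : Fin r → ACK k 1, (∀ i, IsTorusLift (fun _ => t i) 1 (d i)) ↔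
      d = fun i => lineLift (t i) := fun d => by
    simp only [isTorusLift_iff, map_one, mul_one]
    exact funext_iff.symm
  have hD : ACK.smul ((-1 : kˣ) ^ (∑ i : Fin r, ((r : ℤ) - 1 - (i : ℤ)) * val (t i)))
      ((List.ofFn fun i => lineLift (t i)).foldr (fun a acc => acc * a) (ACK.one k 1))
      = ACK.smul (torCoeff t) (lineLift (∏ i, t i)) := by
    rw [foldr_lineLift, ACK.smul_smul, ← pairProd_neg_one_zpow, ← pairProd_mul]
    rfl
  have hW : torGeo t * weylGeo k r w = Geo.pair
      (ACK.smul (torCoeff t) (lineLift (∏ i, t i)) * kap k 1 (intDetDet k r (permDet k r w)))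
      (torLift t * kap k r (permInt k r w)) (by
        rw [ACK.mul_g, ACK.mul_g, detGL1_mul, torCoeff_smul_lineLift_g, kap_permDet_g]) := by
    rw [torGeo_eq, weylGeo_eq, Geo.pair_mul]
  have hg : ∀ p : GeoPre k r, IsTorusLift t w p.1.2 → p.1.1.g
      = (ACK.smul (torCoeff t) (lineLift (∏ i, t i))).g * (intDetDet k r (permDet k r w)).1 := by
    intro p hp
    change _ = (lineLift _).g * _
    rw [p.2, hp.1, torLift_g, detGL1_mul, detGL1_diagGL]
    rfl
  constructor
  · rintro ⟨p, rfl, hp, d, hd', h, hv⟩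
    obtain rfl := (hd d).1 hd'
    have h1 := (eq_mul_kap_iff (intDetDet k r (permDet k r w)) (hg p hp)).1 (by
      rw [← hD]
      exact ⟨h, hv⟩)
    rw [hW]
    exact Geo.pair_congr p.2 h1 (isTorusLift_iff.1 hp)
  · rintro rfl
    rw [hW]
    refine ⟨_, rfl, isTorusLift_iff.2 rfl, fun i => lineLift (t i), (hd _).2 rfl, ?_⟩
    have h1 := (eq_mul_kap_iff (x := ACK.smul (torCoeff t) (lineLift (∏ i, t i)))
      (y := ACK.smul (torCoeff t) (lineLift (∏ i, t i)) * kap k 1 (intDetDet k r (permDet k r w)))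
      (intDetDet k r (permDet k r w)) (by rw [ACK.mul_g, kap_g])).2 rfl
    have key : ∀ z, z = ACK.smul (torCoeff t) (lineLift (∏ i, t i)) → ∃ h : act z.g (stdLat k 1)
        = act (ACK.smul (torCoeff t) (lineLift (∏ i, t i))
          * kap k 1 (intDetDet k r (permDet k r w))).g (stdLat k 1),
        (ACK.smul (torCoeff t) (lineLift (∏ i, t i))
          * kap k 1 (intDetDet k r (permDet k r w))).v = Rel.cast h z.v := by
      rintro z rfl
      exact h1
    exact key _ hD

end GeoTorus

/-! ### The rank one relation in the geometric extension -/

section RankOne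

universe u

variable {k : Type u} [Field k] {r : ℕ}

/-- `unipLift n` is a lift of `n` of `p`-power order. -/
def HasUnipLift (n : GL (Fin r) k⸨X⸩) : Prop := (unipLift n).proj = n ∧ IsPTor k (unipLift n)

theorem val_rankOneTorus {i j : Fin r} {a : k⸨X⸩ˣ} (ha : val a = 0) (x : Fin r) :
    val (rankOneTorus i j a x) = 0 := by
  rw [rankOneTorus]
  split_ifs
  · rw [val_neg, val_inv, ha, neg_zero]
  · exact ha
  · exact val_one

theorem tame_one_right (f : k⸨X⸩ˣ) : tame f 1 = 1 := by simp [tame, val_one, lc_one]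

theorem tame_one_left (f : k⸨X⸩ˣ) : tame 1 f = 1 := by simp [tame, val_one, lc_one]

variable [Finite k]

theorem HasUnipLift.conj {n : GL (Fin r) k⸨X⸩} (hn : HasUnipLift n) (x : Geo k r) :
    HasUnipLift (x.proj * n * x.proj⁻¹) := by
  have h := conj_unipLift x hn.2 hn.1
  refine ⟨?_, h ▸ hn.2.conj x⟩
  rw [← h, Geo.proj_mul, Geo.proj_mul, Geo.proj_inv, hn.1]

theorem HasUnipLift.mul_comm {n : GL (Fin r) k⸨X⸩} (hn : HasUnipLift n) (x : Geo k r) :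
    x * unipLift n = unipLift (x.proj * n * x.proj⁻¹) * x := by
  rw [← conj_unipLift x hn.2 hn.1, inv_mul_cancel_right]

/-- Lower elementary matrices are conjugates of upper ones by transpositions, and conjugation
preserves p-power order. -/
theorem hasUnipLift_elemGL {i j : Fin r} (hij : i ≠ j) (a : k⸨X⸩) :
    HasUnipLift (elemGL hij a) := by
  rcases lt_or_gt_of_ne hij with h | h
  · exact isPTor_unipLift (isUnip_elemGL h a)
  · have h1 : HasUnipLift (elemGL hij.symm a) := isPTor_unipLift (isUnip_elemGL h a)
    have h2 := h1.conj (weylGeo k r (Equiv.swap i j))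
    rw [weylGeo_proj, permGL_conj_elemGL] at h2
    have h3 : elemGL ((Equiv.swap i j).injective.ne hij.symm) a = elemGL hij a := by
      congr 1 <;> simp
    rwa [h3] at h2

theorem torGeo_mul_unipLift {i j : Fin r} (hij : i ≠ j) (a : k⸨X⸩) (t : Fin r → k⸨X⸩ˣ) :
    torGeo t * unipLift (elemGL hij a)
      = unipLift (elemGL hij ((t i : k⸨X⸩) * a * (↑(t j)⁻¹ : k⸨X⸩))) * torGeo t := by
  rw [(hasUnipLift_elemGL hij a).mul_comm, torGeo_proj, diagGL_conj_elemGL]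

/-- The splitting over GL_r(O) is a homomorphism, so it sends an element of p-power order to the
lift of p-power order. -/
theorem kapGeo_elemGL {i j : Fin r} (hij : i ≠ j) {a : k⸨X⸩}
    (ha : ∀ n < 0, HahnSeries.coeff a n = 0) :
    kapGeo k r ⟨_, elemGL_mem_intDet hij ha⟩ = unipLift (elemGL hij a) := by
  refine eq_unipLift (IsPTor.map ?_ (kapGeo k r))
  obtain ⟨s, hs⟩ := (hasUnipLift_elemGL hij a).2.map (Geo.projHom k r)
  refine ⟨s, Subtype.ext ?_⟩
  have h : Geo.projHom k r (unipLift (elemGL hij a)) = elemGL hij a := (hasUnipLift_elemGL hij a).1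
  rw [h] at hs
  exact hs

/-- When a is a unit of O every matrix in the identity is integral, and the splitting homomorphism
carries the identity over. -/
theorem weylGeo_swap_mul_unipLift_of_val_eq_zero {i j : Fin r} (hij : i ≠ j) {a : k⸨X⸩ˣ}
    (ha : val a = 0) :
    weylGeo k r (Equiv.swap i j) * unipLift (elemGL hij (a : k⸨X⸩))
      = unipLift (elemGL hij (↑a⁻¹ : k⸨X⸩)) * torGeo (rankOneTorus i j a)
        * unipLift (elemGL hij.symm (↑a⁻¹ : k⸨X⸩)) := by
  have h1 : ∀ n < 0, HahnSeries.coeff (a : k⸨X⸩) n = 0 := fun n hn =>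
    coeff_eq_zero_of_lt_val a (ha.symm ▸ hn)
  have h2 : ∀ n < 0, HahnSeries.coeff (↑a⁻¹ : k⸨X⸩) n = 0 := fun n hn =>
    coeff_eq_zero_of_lt_val a⁻¹ (by rwa [val_inv, ha, neg_zero])
  rw [← kapGeo_elemGL hij h1, ← kapGeo_elemGL hij h2, ← kapGeo_elemGL hij.symm h2,
    torGeo_of_val_eq_zero (val_rankOneTorus ha)]
  change kapGeo k r _ * _ = _
  rw [← map_mul, ← map_mul, ← map_mul]
  exact congrArg _ (Subtype.ext (swap_mul_elemGL hij a))

theorem weylGeo_swap_mul_unipLift_of_torGeo {p q : Fin r} (hlt : p < q) (hne : p ≠ q)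
    (hT : ∀ t : Fin r → k⸨X⸩ˣ, weylGeo k r (Equiv.swap p q) * torGeo t
      = Geo.incl k r (tame (t p) (t q) * (-1) ^ (val (t p) + val (t q)) * (-1) ^ val (∏ i, t i))
        * (torGeo (t ∘ Equiv.swap p q) * weylGeo k r (Equiv.swap p q))) (a : k⸨X⸩ˣ) :
    weylGeo k r (Equiv.swap p q) * unipLift (elemGL hne (a : k⸨X⸩))
      = unipLift (elemGL hne (↑a⁻¹ : k⸨X⸩)) * torGeo (rankOneTorus p q a)
        * unipLift (elemGL hne.symm (↑a⁻¹ : k⸨X⸩)) := by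
  -- The factor c makes ca a unit of O, for which the relation is known. The torus element with c at
  -- p, moved through each factor, turns the parameter ca back into a and emerges as c at q.
  obtain ⟨c, hc⟩ : ∃ c, c = unif k (-val a) := ⟨_, rfl⟩
  have hval : val (c * a) = 0 := by rw [hc, val_mul, val_unif, neg_add_cancel]
  have key := weylGeo_swap_mul_unipLift_of_val_eq_zero hne hval
  have e1 : torGeo (Pi.mulSingle p c : Fin r → k⸨X⸩ˣ) * unipLift (elemGL hne (a : k⸨X⸩))
      = unipLift (elemGL hne ((c * a : k⸨X⸩ˣ) : k⸨X⸩)) * torGeo (Pi.mulSingle p c : Fin r → k⸨X⸩ˣ) := by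
    rw [torGeo_mul_unipLift, Pi.mulSingle_eq_same, Pi.mulSingle_eq_of_ne hne.symm, inv_one,
      Units.val_one, mul_one, Units.val_mul]
  have e2 : torGeo (Pi.mulSingle q c : Fin r → k⸨X⸩ˣ) * unipLift (elemGL hne (↑a⁻¹ : k⸨X⸩))
      = unipLift (elemGL hne (↑(c * a)⁻¹ : k⸨X⸩)) * torGeo (Pi.mulSingle q c : Fin r → k⸨X⸩ˣ) := by
    rw [torGeo_mul_unipLift, Pi.mulSingle_eq_same, Pi.mulSingle_eq_of_ne hne, Units.val_one,
      one_mul, ← Units.val_mul, mul_inv_rev]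
  have e3 : torGeo (Pi.mulSingle p c : Fin r → k⸨X⸩ˣ) * unipLift (elemGL hne.symm (↑a⁻¹ : k⸨X⸩))
      = unipLift (elemGL hne.symm (↑(c * a)⁻¹ : k⸨X⸩)) * torGeo (Pi.mulSingle p c : Fin r → k⸨X⸩ˣ) := by
    rw [torGeo_mul_unipLift, Pi.mulSingle_eq_same, Pi.mulSingle_eq_of_ne hne.symm, Units.val_one,
      one_mul, ← Units.val_mul, mul_inv_rev]
  -- No scalar appears: the tame symbol has the entry 1, and the two signs are both (-1)^(v(c)).
  have e4 : weylGeo k r (Equiv.swap p q) * torGeo (Pi.mulSingle p c : Fin r → k⸨X⸩ˣ)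
      = torGeo (Pi.mulSingle q c : Fin r → k⸨X⸩ˣ) * weylGeo k r (Equiv.swap p q) := by
    have hs : (Pi.mulSingle p c : Fin r → k⸨X⸩ˣ) ∘ Equiv.swap p q = Pi.mulSingle q c := by
      funext x
      rw [Function.comp_apply, Pi.mulSingle_apply, Pi.mulSingle_apply]
      congr 1
      rw [Equiv.swap_apply_eq_iff, Equiv.swap_apply_left]
    rw [hT, hs, Finset.prod_pi_mulSingle', if_pos (Finset.mem_univ _), Pi.mulSingle_eq_same,
      Pi.mulSingle_eq_of_ne hne.symm, tame_one_right, val_one, add_zero, one_mul, neg_one_zpow_sq,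
      Geo.incl_one, one_mul]
  have e5 : torGeo (rankOneTorus p q (c * a)) * torGeo (Pi.mulSingle p c : Fin r → k⸨X⸩ˣ)
      = torGeo (Pi.mulSingle q c : Fin r → k⸨X⸩ˣ) * torGeo (rankOneTorus p q a) := by
    have h1 : rankOneTorus p q (c * a) * Pi.mulSingle p c
        = Pi.mulSingle q c * rankOneTorus p q a := by
      funext x
      rw [Pi.mul_apply, Pi.mul_apply, rankOneTorus, rankOneTorus, Pi.mulSingle_apply,
        Pi.mulSingle_apply]
      by_cases h1 : x = p
      · subst h1
        rw [if_pos rfl, if_pos rfl, if_pos rfl, if_neg hne, one_mul, mul_inv_rev, neg_mul,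
          inv_mul_cancel_right]
      · rw [if_neg h1, if_neg h1, if_neg h1, mul_one]
        by_cases h2 : x = q
        · rw [if_pos h2, if_pos h2, if_pos h2]
        · rw [if_neg h2, if_neg h2, if_neg h2, one_mul]
    rw [torGeo_mul, torGeo_mul, h1]
    congr 2
    -- Both torus cocycles are trivial. Only pairs with second index p, respectively first index q,
    -- could contribute, and then the other index is less than p, respectively greater than q, where
    -- the rank one torus element has entry 1.
    refine (pairProd_eq_one fun i j hij => ?_).trans (pairProd_eq_one fun i j hij => ?_).symm
    · rw [inv_eq_one]
      by_cases h : j = p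
      · subst h
        rw [rankOneTorus, if_neg hij.ne, if_neg (hij.trans hlt).ne, tame_one_left]
      · rw [Pi.mulSingle_eq_of_ne h, tame_one_right]
    · rw [inv_eq_one]
      by_cases h : i = q
      · subst h
        rw [rankOneTorus, if_neg (hlt.trans hij).ne', if_neg hij.ne', tame_one_right]
      · rw [Pi.mulSingle_eq_of_ne h, tame_one_left]
  rw [← mul_right_inj (torGeo (Pi.mulSingle q c : Fin r → k⸨X⸩ˣ))]
  calc _ = weylGeo k r (Equiv.swap p q)
        * (torGeo (Pi.mulSingle p c : Fin r → k⸨X⸩ˣ) * unipLift (elemGL hne (a : k⸨X⸩))) := by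
        rw [← mul_assoc, ← e4, mul_assoc]
    _ = unipLift (elemGL hne (↑(c * a)⁻¹ : k⸨X⸩)) * torGeo (rankOneTorus p q (c * a))
        * (unipLift (elemGL hne.symm (↑(c * a)⁻¹ : k⸨X⸩)) * torGeo (Pi.mulSingle p c : Fin r → k⸨X⸩ˣ)) := by
        rw [e1, ← mul_assoc, key, mul_assoc]
    _ = unipLift (elemGL hne (↑(c * a)⁻¹ : k⸨X⸩)) * (torGeo (rankOneTorus p q (c * a))
        * torGeo (Pi.mulSingle p c : Fin r → k⸨X⸩ˣ)) * unipLift (elemGL hne.symm (↑a⁻¹ : k⸨X⸩)) := by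
        rw [← e3]
        simp only [mul_assoc]
    _ = _ := by
        rw [e5, ← mul_assoc, ← e2]
        simp only [mul_assoc]

theorem weylGeo_swap_mul_unipLift {l : ℕ} (hl : l + 1 < r)
    (hne : (⟨l, by omega⟩ : Fin r) ≠ ⟨l + 1, hl⟩) (a : k⸨X⸩ˣ) :
    weylGeo k r (Equiv.swap ⟨l, by omega⟩ ⟨l + 1, hl⟩) * unipLift (elemGL hne (a : k⸨X⸩))
      = unipLift (elemGL hne (↑a⁻¹ : k⸨X⸩)) * torGeo (rankOneTorus ⟨l, by omega⟩ ⟨l + 1, hl⟩ a)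
        * unipLift (elemGL hne.symm (↑a⁻¹ : k⸨X⸩)) :=
  weylGeo_swap_mul_unipLift_of_torGeo (by rw [Fin.lt_def]; simp) hne
    (fun t => weylGeo_swap_mul_torGeo hl t) a

end RankOne

/-! ### The section is well defined and equivariant under N_r -/

section GeoSection

universe u

variable {k : Type u} [Field k] [Finite k] {r : ℕ}

theorem isGeoLift_iff {g : GL (Fin r) k⸨X⸩} {x : Geo k r} : IsGeoLift g x ↔
    ∃ n n' t w, IsUnip n ∧ IsUnip n' ∧ g = n * (diagGL t * permGL w) * n' ∧
      x = unipLift n * (torGeo t * weylGeo k r w) * unipLift n' := by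
  constructor
  · rintro ⟨n, n', t, w, x₁, x₀, x₂, hn, hn', hg, h₁, h₀, h₂, rfl⟩
    rw [isGeoUnipLift_iff hn] at h₁
    rw [isGeoUnipLift_iff hn'] at h₂
    rw [isGeoTorusLift_iff] at h₀
    subst h₀ h₁ h₂
    exact ⟨n, n', t, w, hn, hn', hg, rfl⟩
  · rintro ⟨n, n', t, w, hn, hn', hg, rfl⟩
    exact ⟨n, n', t, w, _, _, _, hn, hn', hg, (isGeoUnipLift_iff hn).2 rfl,
      isGeoTorusLift_iff.2 rfl, (isGeoUnipLift_iff hn').2 rfl, rfl⟩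

/-- The monomial part is unique, so two decompositions differ by a unipotent element v moved through
it. Since `unipLift` is compatible with conjugation and multiplicative on N_r, its lift moves in the
same way. -/
theorem IsGeoLift.unique {g : GL (Fin r) k⸨X⸩} {x y : Geo k r} (hx : IsGeoLift g x)
    (hy : IsGeoLift g y) : x = y := by
  rw [isGeoLift_iff] at hx hy
  obtain ⟨n₁, n₁', t, w, hn₁, hn₁', hg, rfl⟩ := hx
  obtain ⟨n₂, n₂', t', w', hn₂, hn₂', hg', rfl⟩ := hy
  obtain ⟨rfl, rfl⟩ := mono_injective
    (IsBruhat.unique ⟨⟨t, w, rfl⟩, n₁, n₁', hn₁, hn₁', hg⟩ ⟨⟨t', w', rfl⟩, n₂, n₂', hn₂, hn₂', hg'⟩)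
  obtain ⟨v, hv⟩ : ∃ v, v = n₂' * n₁'⁻¹ := ⟨_, rfl⟩
  have hvu : IsUnip v := hv ▸ hn₂'.mul hn₁'.inv
  have e1 : n₂' = v * n₁' := by rw [hv, inv_mul_cancel_right]
  have e2 : n₁ = n₂ * (n₂⁻¹ * n₁) := by rw [mul_inv_cancel_left]
  have e3 : (torGeo t * weylGeo k r w).proj * v * (torGeo t * weylGeo k r w).proj⁻¹
      = n₂⁻¹ * n₁ := by
    rw [Geo.proj_mul, torGeo_proj, weylGeo_proj, hv]
    rw [hg'] at hg
    generalize diagGL t * permGL w = m at *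
    rw [eq_inv_mul_iff_mul_eq, ← mul_assoc, mul_inv_eq_iff_eq_mul, ← mul_assoc, ← mul_assoc,
      mul_inv_eq_iff_eq_mul, hg]
  have h1 := HasUnipLift.mul_comm (isPTor_unipLift hvu) (torGeo t * weylGeo k r w)
  rw [e3] at h1
  rw [e1, unipLift_mul hvu hn₁', ← mul_assoc (_ * _) (unipLift v), mul_assoc (unipLift n₂) _ (unipLift v), h1]
  conv_lhs => rw [e2, unipLift_mul hn₂ (hn₂.inv.mul hn₁)]
  simp only [mul_assoc]

theorem exists_isGeoLift (g : GL (Fin r) k⸨X⸩) : ∃ x, IsGeoLift g x := by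
  obtain ⟨m, ⟨t, w, rfl⟩, n, n', hn, hn', hg⟩ := exists_isBruhat g
  exact ⟨_, isGeoLift_iff.2 ⟨n, n', t, w, hn, hn', hg, rfl⟩⟩

theorem isGeoLift_iff_eq_sGeo (g : GL (Fin r) k⸨X⸩) (x : Geo k r) :
    IsGeoLift g x ↔ x = sGeo g := by
  have h : IsGeoLift g (sGeo g) := Classical.epsilon_spec (exists_isGeoLift g)
  exact ⟨fun hx => hx.unique h, fun hx => hx ▸ h⟩

theorem sGeo_eq {n n' : GL (Fin r) k⸨X⸩} (hn : IsUnip n) (hn' : IsUnip n') (t : Fin r → k⸨X⸩ˣ)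
    (w : Equiv.Perm (Fin r)) : sGeo (n * (diagGL t * permGL w) * n')
      = unipLift n * (torGeo t * weylGeo k r w) * unipLift n' :=
  ((isGeoLift_iff_eq_sGeo _ _).1 (isGeoLift_iff.2 ⟨n, n', t, w, hn, hn', rfl, rfl⟩)).symm

theorem unipLift_one : unipLift (1 : GL (Fin r) k⸨X⸩) = (1 : Geo k r) := by
  have h : (1 : Geo k r) = unipLift (1 : Geo k r).proj := eq_unipLift isPTor_one
  exact h.symm

theorem sGeo_mono (t : Fin r → k⸨X⸩ˣ) (w : Equiv.Perm (Fin r)) :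
    sGeo (diagGL t * permGL w) = torGeo t * weylGeo k r w := by
  have := sGeo_eq (k := k) .one .one t w
  rwa [one_mul, mul_one, unipLift_one, one_mul, mul_one] at this

theorem sGeo_diagGL (t : Fin r → k⸨X⸩ˣ) : sGeo (diagGL t) = torGeo t := by
  have := sGeo_mono t 1
  rwa [permGL_one, mul_one, map_one, mul_one] at this

theorem sGeo_permGL (w : Equiv.Perm (Fin r)) : sGeo (permGL w) = weylGeo k r w := by
  have := sGeo_mono (1 : Fin r → k⸨X⸩ˣ) w
  rwa [diagGL_one, one_mul, torGeo_one, one_mul] at this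

theorem sGeo_unip_mul {n : GL (Fin r) k⸨X⸩} (hn : IsUnip n) (g : GL (Fin r) k⸨X⸩) :
    sGeo (n * g) = unipLift n * sGeo g := by
  obtain ⟨m, ⟨t, w, rfl⟩, n₁, n₂, hn₁, hn₂, rfl⟩ := exists_isBruhat g
  rw [← mul_assoc, ← mul_assoc, sGeo_eq (hn.mul hn₁) hn₂, sGeo_eq hn₁ hn₂, unipLift_mul hn hn₁]
  simp only [mul_assoc]

theorem sGeo_mul_unip {n : GL (Fin r) k⸨X⸩} (hn : IsUnip n) (g : GL (Fin r) k⸨X⸩) :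
    sGeo (g * n) = sGeo g * unipLift n := by
  obtain ⟨m, ⟨t, w, rfl⟩, n₁, n₂, hn₁, hn₂, rfl⟩ := exists_isBruhat g
  rw [mul_assoc, sGeo_eq hn₁ (hn₂.mul hn), sGeo_eq hn₁ hn₂, unipLift_mul hn₂ hn]
  simp only [mul_assoc]

theorem sGeo_proj (g : GL (Fin r) k⸨X⸩) : (sGeo g).proj = g := by
  obtain ⟨m, ⟨t, w, rfl⟩, n₁, n₂, hn₁, hn₂, rfl⟩ := exists_isBruhat g
  rw [sGeo_eq hn₁ hn₂, Geo.proj_mul, Geo.proj_mul, Geo.proj_mul, (isPTor_unipLift hn₁).1,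
    (isPTor_unipLift hn₂).1, torGeo_proj, weylGeo_proj]

theorem sGeo_mul_unipLift {v : GL (Fin r) k⸨X⸩} (hv : HasUnipLift v) (g : GL (Fin r) k⸨X⸩) :
    sGeo g * unipLift v = unipLift (g * v * g⁻¹) * sGeo g := by
  rw [hv.mul_comm, sGeo_proj]

theorem unipLift_mul_sGeo {v : GL (Fin r) k⸨X⸩} (g : GL (Fin r) k⸨X⸩) (hv : HasUnipLift v) :
    unipLift v * sGeo g = sGeo g * unipLift (g⁻¹ * v * g) := by
  have h := hv.conj (sGeo g)⁻¹
  rw [Geo.proj_inv, sGeo_proj, inv_inv] at h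
  rw [sGeo_mul_unipLift h]
  congr 2
  group

end GeoSection

/-! ### The Kazhdan–Patterson properties of the geometric cocycle -/

section GeoCocycle

universe u

variable {k : Type u} [Field k] [Finite k] {r : ℕ}

theorem exists_chiGeo : ∃ χ : GL (Fin r) k⸨X⸩ → GL (Fin r) k⸨X⸩ → kˣ,
    ∀ g g', sGeo g * sGeo g' = Geo.incl k r (χ g g') * sGeo (g * g') := by
  have h : ∀ g g' : GL (Fin r) k⸨X⸩, ∃ c : kˣ,
      sGeo g * sGeo g' = Geo.incl k r c * sGeo (g * g') := fun g g' =>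
    Geo.exists_incl_mul (by rw [Geo.proj_mul, sGeo_proj, sGeo_proj, sGeo_proj])
  choose χ hχ using h
  exact ⟨χ, hχ⟩

/-- The matrix manipulations behind the Bruhat decomposition of αg lift to the extension without
scalars, because conjugation permutes the lifts of p-power order. What is left is the product of the
sections at m' m⁻¹ and m. -/
theorem sGeo_refl_bruhat {χ : GL (Fin r) k⸨X⸩ → GL (Fin r) k⸨X⸩ → kˣ}
    (hχ : ∀ g g', sGeo g * sGeo g' = Geo.incl k r (χ g g') * sGeo (g * g')) {p q : Fin r}
    (hne : p ≠ q) (hpq : (q : ℕ) = p + 1)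
    (hrank : ∀ a : k⸨X⸩ˣ, weylGeo k r (Equiv.swap p q) * unipLift (elemGL hne (a : k⸨X⸩))
      = unipLift (elemGL hne (↑a⁻¹ : k⸨X⸩)) * torGeo (rankOneTorus p q a)
        * unipLift (elemGL hne.symm (↑a⁻¹ : k⸨X⸩)))
    {g m m' : GL (Fin r) k⸨X⸩} (hm : IsBruhat g m)
    (hm' : IsBruhat (permGL (Equiv.swap p q) * g) m') :
    χ (permGL (Equiv.swap p q)) g = χ (m' * m⁻¹) m := by
  obtain ⟨⟨t, w, rfl⟩, n, n', hn, hn', rfl⟩ := hm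
  have eq : ∀ {g g' c}, sGeo g * sGeo g' = Geo.incl k r c * sGeo (g * g') → χ g g' = c := by
    intro g g' c h
    rw [hχ] at h
    exact Geo.incl_injective (mul_right_cancel h)
  have hc : ∀ z (x : Geo k r), x * Geo.incl k r z = Geo.incl k r z * x := fun z x =>
    (Geo.incl_mul_comm z x).symm
  obtain ⟨n₁, a, hn₁, hα, rfl, hcase⟩ := swap_mul_cases hpq hn t w hne
  have hswap := fun a => swap_mul_elemGL (R := k⸨X⸩) hne a
  have hlt : p < q := by rw [Fin.lt_def]; omega
  simp only [← sGeo_permGL] at hrank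
  generalize Equiv.swap p q = α at *
  have hmono : ∀ t', ∃ t'' w'', diagGL t' * (diagGL t * permGL w) = diagGL t'' * permGL w'' :=
    fun t' => ⟨t' * t, w, by rw [diagGL_mul', mul_assoc]⟩
  have hmonow : ∃ t'' w'', permGL α * (diagGL t * permGL w) = diagGL t'' * permGL w'' :=
    ⟨_, _, by rw [← mul_assoc, permGL_mul_diagGL, mul_assoc, ← permGL_mul]⟩
  generalize diagGL t * permGL w = m at *
  have hx : IsUnip (elemGL hne a) := isUnip_elemGL hlt a
  have e0 : sGeo (permGL α) * sGeo (n₁ * elemGL hne a * m * n')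
      = unipLift (permGL α * n₁ * (permGL α)⁻¹)
        * (sGeo (permGL α) * unipLift (elemGL hne a) * sGeo m) * unipLift n' := by
    rw [sGeo_mul_unip hn', mul_assoc n₁, sGeo_unip_mul hn₁, sGeo_unip_mul hx, ← mul_assoc,
      ← mul_assoc, sGeo_mul_unipLift (isPTor_unipLift hn₁)]
    simp only [mul_assoc]
  rcases hcase with h | ⟨u, rfl, h⟩
  · have e1 : permGL α * (n₁ * elemGL hne a * m * n') = permGL α * n₁ * (permGL α)⁻¹
        * (permGL α * m) * (m⁻¹ * elemGL hne a * m * n') := by group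
    have e2 : m' = permGL α * m :=
      hm'.unique ⟨hmonow, _, _, hα, h.mul hn', e1⟩
    rw [e2, mul_inv_cancel_right]
    refine eq ?_
    rw [e0, e1, sGeo_mul_unip (h.mul hn'), sGeo_unip_mul hα, unipLift_mul h hn',
      mul_assoc (sGeo _), unipLift_mul_sGeo m (isPTor_unipLift hx), ← mul_assoc (sGeo _), hχ]
    simp only [← mul_assoc, hc]
  -- The reflection is absorbed here by the rank one relation, and a torus element takes its place
  -- in front of m.
  · have e1 : permGL α * (n₁ * elemGL hne (u : k⸨X⸩) * m * n')
        = (permGL α * n₁ * (permGL α)⁻¹ * elemGL hne (↑u⁻¹ : k⸨X⸩))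
          * (diagGL (rankOneTorus p q u) * m)
          * (m⁻¹ * elemGL hne.symm (↑u⁻¹ : k⸨X⸩) * m * n') := by
      have h1 : permGL α * (n₁ * elemGL hne (u : k⸨X⸩) * m * n')
          = permGL α * n₁ * (permGL α)⁻¹ * (permGL α * elemGL hne (u : k⸨X⸩)) * m * n' := by group
      rw [h1, hswap]
      group
    have hx' : IsUnip (elemGL hne (↑u⁻¹ : k⸨X⸩)) := isUnip_elemGL hlt _
    have e2 := hm'.unique ⟨hmono _, _, _, hα.mul hx', h.mul hn', e1⟩
    rw [e2, mul_inv_cancel_right]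
    refine eq ?_
    rw [e0, e1, sGeo_mul_unip (h.mul hn'), sGeo_unip_mul (hα.mul hx'), unipLift_mul h hn',
      unipLift_mul hα hx', hrank, mul_assoc _ (unipLift (elemGL hne.symm _)),
      unipLift_mul_sGeo m (hasUnipLift_elemGL _ _), ← sGeo_diagGL,
      mul_assoc (unipLift (elemGL hne _)), ← mul_assoc (sGeo (diagGL _)), hχ]
    simp only [← mul_assoc, hc]

theorem isKPCocycle_of_sGeo {χ : GL (Fin r) k⸨X⸩ → GL (Fin r) k⸨X⸩ → kˣ}
    (hχ : ∀ g g', sGeo g * sGeo g' = Geo.incl k r (χ g g') * sGeo (g * g')) :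
    IsKPCocycle (fun f g => (tame f g)⁻¹) χ := by
  have eq : ∀ {g g' c}, sGeo g * sGeo g' = Geo.incl k r c * sGeo (g * g') → χ g g' = c := by
    intro g g' c h
    rw [hχ] at h
    exact Geo.incl_injective (mul_right_cancel h)
  have hc : ∀ z (x : Geo k r), x * Geo.incl k r z = Geo.incl k r z * x := fun z x =>
    (Geo.incl_mul_comm z x).symm
  constructor
  · intro g g' g''
    have h1 : sGeo g * sGeo g' * sGeo g''
        = Geo.incl k r (χ g g' * χ (g * g') g'') * sGeo (g * g' * g'') := by
      rw [hχ, mul_assoc, hχ, Geo.incl_mul, ← mul_assoc]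
    have h2 : sGeo g * (sGeo g' * sGeo g'')
        = Geo.incl k r (χ g' g'' * χ g (g' * g'')) * sGeo (g * (g' * g'')) := by
      rw [hχ, ← mul_assoc, hc, mul_assoc, hχ, Geo.incl_mul, mul_assoc]
    rw [← mul_assoc, h1, ← mul_assoc] at h2
    have h3 := Geo.incl_injective (mul_right_cancel h2)
    rw [mul_right_comm _ _ (χ g _), ← h3, mul_inv_cancel_right, mul_inv_cancel]
  · intro t t'
    refine eq ?_
    rw [← diagGL_mul', sGeo_diagGL, sGeo_diagGL, sGeo_diagGL, torGeo_mul]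
    rfl
  · intro w w'
    refine eq ?_
    rw [← permGL_mul, sGeo_permGL, sGeo_permGL, sGeo_permGL, map_mul, Geo.incl_one, one_mul]
  · intro t w
    refine eq ?_
    rw [sGeo_mono, sGeo_diagGL, sGeo_permGL, Geo.incl_one, one_mul]
  · intro l hl t
    refine eq ?_
    rw [permGL_mul_diagGL, sGeo_permGL, sGeo_diagGL, sGeo_mono, weylGeo_swap_mul_torGeo hl,
      Equiv.swap_inv]
    congr 2
    -- Symbols with entry -1 are signs, so the inverses have no effect on them, and a difference of
    -- valuations may be replaced by their sum.
    rw [inv_inv, tame_neg_one, tame_neg_one, ← zpow_neg, neg_one_zpow_neg, ← zpow_neg,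
      neg_one_zpow_neg, val_div]
    congr 2
    refine neg_one_zpow_congr ?_
    rw [add_sub_sub_cancel]
    exact Even.add_self _
  · intro n n' hn hn' g g'
    refine eq ?_
    have : n * g * (g' * n') = n * (g * g') * n' := by group
    rw [this, sGeo_mul_unip hn', sGeo_unip_mul hn, sGeo_mul_unip hn', sGeo_unip_mul hn, ← mul_assoc,
      mul_assoc (unipLift n), hχ, ← mul_assoc, hc, ← mul_assoc, ← mul_assoc]
  · rintro t g m ⟨-, n, n', hn, hn', rfl⟩
    refine eq ?_
    have : diagGL t * (n * m * n') = (diagGL t * n * (diagGL t)⁻¹) * (diagGL t * m) * n' := by group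
    rw [this, sGeo_mul_unip hn', sGeo_unip_mul hn, sGeo_mul_unip hn', sGeo_unip_mul (hn.conj_diag t),
      ← mul_assoc, ← mul_assoc, sGeo_mul_unipLift (isPTor_unipLift hn), mul_assoc (unipLift _), hχ,
      ← mul_assoc, hc, ← mul_assoc, ← mul_assoc]
  · intro l hl g m m' hm hm'
    exact sGeo_refl_bruhat hχ (by simp) rfl (weylGeo_swap_mul_unipLift hl _) hm hm'

end GeoCocycle

/-! ### The central extension of a normalised cocycle -/

section Twisted

variable {A G : Type*} [CommGroup A] [Group G] {χ : G → G → A}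

theorem Twisted.isCentralExtension
    (hχ : ∀ g g' g'', χ g' g'' * (χ (g * g') g'')⁻¹ * χ g (g' * g'') * (χ g g')⁻¹ = 1)
    (h1 : χ 1 1 = 1) : IsCentralExtension (Twisted.incl χ) (Twisted.g : Twisted χ → G) := by
  have hc : ∀ g g' g'', χ g g' * χ (g * g') g'' = χ g' g'' * χ g (g' * g'') := by
    intro g g' g''
    have h := hχ g g' g''
    rw [mul_right_comm _ _ (χ g (g' * g'')), mul_assoc, ← mul_inv, mul_inv_eq_one] at h
    rw [h, _root_.mul_comm]
  have hl : ∀ g, χ 1 g = 1 := by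
    intro g
    have h := hc 1 1 g
    rwa [_root_.one_mul, h1, _root_.one_mul, _root_.one_mul, left_eq_mul] at h
  have hr : ∀ g, χ g 1 = 1 := by
    intro g
    have h := hc g 1 1
    rwa [_root_.mul_one, h1, _root_.one_mul, _root_.mul_one, mul_eq_right] at h
  have hm : ∀ x y : Twisted χ, x * y = ⟨x.g * y.g, x.z * y.z * χ x.g y.g⟩ := fun _ _ => rfl
  refine ⟨fun x y z => ?_, fun x => ?_, fun x => ?_, fun a b => ?_, fun a b h => ?_, fun a x => ?_,
    fun _ _ => rfl, fun g => ⟨⟨g, 1⟩, rfl⟩, fun x => ⟨fun h => ⟨x.z, Twisted.ext h rfl⟩, ?_⟩⟩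
  · refine Twisted.ext (mul_assoc _ _ _) ?_
    have h := hc x.g y.g z.g
    change x.z * y.z * χ x.g y.g * z.z * χ (x.g * y.g) z.g
      = x.z * (y.z * z.z * χ y.g z.g) * χ x.g (y.g * z.g)
    calc _ = x.z * y.z * z.z * (χ x.g y.g * χ (x.g * y.g) z.g) := by
          rw [mul_right_comm _ (χ _ _) z.z, mul_assoc]
      _ = _ := by
          rw [h]
          simp only [mul_assoc]
  · refine Twisted.ext (_root_.one_mul _) ?_
    change 1 * x.z * χ 1 x.g = x.z
    rw [hl, _root_.one_mul, _root_.mul_one]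
  · refine ⟨⟨x.g⁻¹, x.z⁻¹ * (χ x.g⁻¹ x.g)⁻¹⟩, Twisted.ext (inv_mul_cancel _) ?_⟩
    change x.z⁻¹ * (χ x.g⁻¹ x.g)⁻¹ * x.z * χ x.g⁻¹ x.g = 1
    rw [mul_right_comm, inv_mul_cancel_right, inv_mul_cancel]
  · refine Twisted.ext (_root_.one_mul 1).symm ?_
    change a * b = a * b * χ 1 1
    rw [h1, _root_.mul_one]
  · exact congrArg Twisted.z h
  · refine Twisted.ext ((_root_.one_mul _).trans (_root_.mul_one _).symm) ?_
    change a * x.z * χ 1 x.g = x.z * a * χ x.g 1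
    rw [hl, hr, _root_.mul_comm a]
  · rintro ⟨a, rfl⟩
    rfl

theorem IsKPCocycle.isCentralExtension {R : Type*} [Field R] {r : ℕ} {A : Type*} [CommGroup A]
    {sym : Rˣ → Rˣ → A} {χ : GL (Fin r) R → GL (Fin r) R → A} (h : IsKPCocycle sym χ) :
    IsCentralExtension (Twisted.incl χ) (Twisted.g : Twisted χ → GL (Fin r) R) := by
  refine Twisted.isCentralExtension h.cocycle ?_
  have := h.weyl_weyl 1 1
  rwa [permGL_one] at this

end Twisted

/-! ### Comparison of the cocycle extensions with the geometric extension -/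

section Comparison

universe u

variable {k : Type u} [Field k] {r : ℕ}

theorem incl_mul_sGeo_mul {χ : GL (Fin r) k⸨X⸩ → GL (Fin r) k⸨X⸩ → kˣ}
    (hχ : ∀ g g', sGeo g * sGeo g' = Geo.incl k r (χ g g') * sGeo (g * g')) (z z' : kˣ)
    (g g' : GL (Fin r) k⸨X⸩) : Geo.incl k r z * sGeo g * (Geo.incl k r z' * sGeo g')
      = Geo.incl k r (z * z' * χ g g') * sGeo (g * g') := by
  rw [mul_assoc, ← mul_assoc (sGeo g), ← Geo.incl_mul_comm, mul_assoc, hχ, ← mul_assoc, ← mul_assoc,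
    ← Geo.incl_mul, ← Geo.incl_mul, mul_assoc]

variable [Finite k]

theorem exists_eq_incl_mul_sGeo (x : Geo k r) :
    ∃ z, x = Geo.incl k r z * sGeo x.proj :=
  Geo.exists_incl_mul (sGeo_proj x.proj)

theorem incl_mul_sGeo_proj (z : kˣ) (g : GL (Fin r) k⸨X⸩) :
    (Geo.incl k r z * sGeo g).proj = g := by
  rw [Geo.proj_mul, Geo.proj_incl, one_mul, sGeo_proj]

theorem incl_mul_sGeo_injective {z z' : kˣ} {g g' : GL (Fin r) k⸨X⸩}
    (h : Geo.incl k r z * sGeo g = Geo.incl k r z' * sGeo g') : z = z' ∧ g = g' := by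
  have h1 := congrArg Geo.proj h
  rw [incl_mul_sGeo_proj, incl_mul_sGeo_proj] at h1
  subst h1
  exact ⟨Geo.incl_injective (mul_right_cancel h), rfl⟩

/-- The map is (g, z) ↦ z⁻¹ s(g). The inversion on k^* is forced because the section has cocycle
χ⁻¹. -/
theorem exists_twistedEquiv {χ : GL (Fin r) k⸨X⸩ → GL (Fin r) k⸨X⸩ → kˣ}
    (hχ : ∀ g g', sGeo g * sGeo g' = Geo.incl k r (χ g g')⁻¹ * sGeo (g * g'))
    (h1 : sGeo (1 : GL (Fin r) k⸨X⸩) = 1) :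
    ∃ Φ : Twisted χ ≃* Geo k r, (∀ x, (Φ x).proj = x.g) ∧
      (∀ z, Φ (Twisted.incl χ z) = Geo.incl k r z⁻¹) ∧ ∀ g, Φ ⟨g, 1⟩ = sGeo g := by
  have hbij : Function.Bijective fun x : Twisted χ => Geo.incl k r x.z⁻¹ * sGeo x.g := by
    constructor
    · intro x y h
      obtain ⟨h2, h3⟩ := incl_mul_sGeo_injective h
      exact Twisted.ext h3 (inv_injective h2)
    · intro x
      obtain ⟨z, hz⟩ := exists_eq_incl_mul_sGeo x
      refine ⟨⟨x.proj, z⁻¹⟩, ?_⟩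
      change Geo.incl k r z⁻¹⁻¹ * sGeo x.proj = x
      rw [inv_inv, ← hz]
  refine ⟨⟨Equiv.ofBijective _ hbij, fun x y => ?_⟩, fun x => incl_mul_sGeo_proj _ _, fun z => ?_,
    fun g => ?_⟩
  · change Geo.incl k r (x.z * y.z * χ x.g y.g)⁻¹ * sGeo (x.g * y.g)
      = Geo.incl k r x.z⁻¹ * sGeo x.g * (Geo.incl k r y.z⁻¹ * sGeo y.g)
    rw [incl_mul_sGeo_mul hχ, mul_inv, mul_inv]
  · change Geo.incl k r z⁻¹ * sGeo 1 = _
    rw [h1, mul_one]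
  · change Geo.incl k r 1⁻¹ * sGeo g = _
    rw [inv_one, Geo.incl_one, one_mul]

/-- Each x is uniquely c(x) s(π(x)) with c(x) in k^*. The pushout map is (x, a) ↦ (π(x), f(c(x)) a).
-/
theorem isPushout_sGeo {A : Type*} [CommGroup A] (f : kˣ →* A)
    {χ : GL (Fin r) k⸨X⸩ → GL (Fin r) k⸨X⸩ → kˣ}
    (hχ : ∀ g g', sGeo g * sGeo g' = Geo.incl k r (χ g g') * sGeo (g * g'))
    (h1 : sGeo (1 : GL (Fin r) k⸨X⸩) = 1)
    {χ' : GL (Fin r) k⸨X⸩ → GL (Fin r) k⸨X⸩ → A} (hχ' : ∀ g g', χ' g g' = f (χ g g')) :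
    IsPushout f (Geo.incl k r) (Geo.proj : Geo k r → _) (Twisted.incl χ')
      (Twisted.g : Twisted χ' → _) := by
  choose c hc using exists_eq_incl_mul_sGeo (k := k) (r := r)
  have hcz : ∀ z g, c (Geo.incl k r z * sGeo g) = z := fun z g => by
    have h := hc (Geo.incl k r z * sGeo g)
    exact (incl_mul_sGeo_injective h).1.symm
  have hmul : ∀ x y, c (x * y) = c x * c y * χ x.proj y.proj := by
    intro x y
    conv_lhs => rw [hc x, hc y]
    rw [incl_mul_sGeo_mul hχ, hcz]
  have hincl : ∀ z x, c (Geo.incl k r z * x) = z * c x := by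
    intro z x
    conv_lhs => rw [hc x]
    rw [← mul_assoc, ← Geo.incl_mul, hcz]
  refine ⟨⟨fun p => ⟨p.1.proj, f (c p.1) * p.2⟩, fun p q => ?_⟩, fun y => ?_, fun x y a b => ?_,
    fun a => ?_, fun _ _ => rfl⟩
  · refine Twisted.ext (Geo.proj_mul _ _) ?_
    change f (c (p.1 * q.1)) * (p.2 * q.2)
      = f (c p.1) * p.2 * (f (c q.1) * q.2) * χ' p.1.proj q.1.proj
    rw [hmul, map_mul, map_mul, hχ', mul_right_comm, mul_mul_mul_comm]
  · refine ⟨(sGeo y.g, y.z), Twisted.ext (sGeo_proj _) ?_⟩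
    have h := hcz 1 y.g
    rw [Geo.incl_one, one_mul] at h
    change f (c (sGeo y.g)) * y.z = y.z
    rw [h, map_one, one_mul]
  · constructor
    · intro h
      have h2 : x.proj = y.proj := congrArg Twisted.g h
      have h3 : f (c x) * a = f (c y) * b := congrArg Twisted.z h
      refine ⟨c y * (c x)⁻¹, ?_, ?_⟩
      · calc y = Geo.incl k r (c y) * sGeo x.proj := by rw [h2, ← hc]
          _ = Geo.incl k r (c y * (c x)⁻¹) * (Geo.incl k r (c x) * sGeo x.proj) := by
            rw [← mul_assoc, ← Geo.incl_mul, inv_mul_cancel_right]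
          _ = _ := by rw [← hc]
      · rw [map_mul, map_inv, mul_right_comm, ← h3, mul_right_comm, mul_inv_cancel, one_mul]
    · rintro ⟨z, rfl, rfl⟩
      refine Twisted.ext ?_ ?_
      · change x.proj = (Geo.incl k r z * x).proj
        rw [Geo.proj_mul, Geo.proj_incl, one_mul]
      · change f (c x) * (f z * b) = f (c (Geo.incl k r z * x)) * b
        rw [hincl, map_mul, mul_left_comm, mul_assoc]
  · refine Twisted.ext (Geo.proj_incl 1) ?_
    change f (c (Geo.incl k r 1)) * a = a
    have h := hcz 1 1
    rw [h1, mul_one] at h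
    rw [h, map_one, one_mul]

end Comparison

end KPGeo

theorem mainTheorem7 {k : Type*} [Field k] [Fintype k] [DecidableEq k] (hk : ringChar k ≠ 2)
    (r : ℕ) :
    -- the extension of Arbarello, De Concini and Kac, and the geometric extension
    (∀ s : ℕ, KPGeo.IsCentralExtension (KPGeo.ACK.incl k s)
      (KPGeo.ACK.g : KPGeo.ACK k s → GL (Fin s) k⸨X⸩)) ∧
    KPGeo.IsCentralExtension (KPGeo.Geo.incl k r) (KPGeo.Geo.proj : KPGeo.Geo k r → _) ∧
    -- the section `s_geo` is well defined by the Bruhat decomposition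
    (∀ (g : GL (Fin r) k⸨X⸩) (x : KPGeo.Geo k r), KPGeo.IsGeoLift g x ↔ x = KPGeo.sGeo g) ∧
    (∀ g : GL (Fin r) k⸨X⸩, (KPGeo.sGeo g).proj = g) ∧
    -- the cocycle of `s_geo`, and the Kazhdan–Patterson cocycle of the tame symbol
    ∃ χgeo χ : GL (Fin r) k⸨X⸩ → GL (Fin r) k⸨X⸩ → kˣ,
      (∀ g g', KPGeo.sGeo g * KPGeo.sGeo g'
        = KPGeo.Geo.incl k r (χgeo g g') * KPGeo.sGeo (g * g')) ∧
      KPGeo.IsKPCocycle KPGeo.tame χ ∧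
      (∀ χ', KPGeo.IsKPCocycle KPGeo.tame χ' → χ' = χ) ∧
      KPGeo.IsKPCocycle (fun f g => (KPGeo.tame f g)⁻¹) χgeo ∧
      (∀ g g', χgeo g g' = (χ g g')⁻¹) ∧
      -- the isomorphism of the Kazhdan–Patterson group with the geometric one
      KPGeo.IsCentralExtension (KPGeo.Twisted.incl χ) KPGeo.Twisted.g ∧
      (∃ Φ : KPGeo.Twisted χ ≃* KPGeo.Geo k r,
        (∀ x, (Φ x).proj = x.g) ∧
        (∀ z, Φ (KPGeo.Twisted.incl χ z) = KPGeo.Geo.incl k r z⁻¹) ∧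
        ∀ g, Φ ⟨g, 1⟩ = KPGeo.sGeo g) ∧
      -- the cover by `{±1}` is the pushout of the geometric extension by `ζ`
      ∃ χ₂ : GL (Fin r) k⸨X⸩ → GL (Fin r) k⸨X⸩ → ℤˣ,
        KPGeo.IsKPCocycle KPGeo.hilbert χ₂ ∧
        (∀ χ', KPGeo.IsKPCocycle KPGeo.hilbert χ' → χ' = χ₂) ∧
        (∀ g g', χ₂ g g' = (quadraticChar k).toUnitHom (χgeo g g')) ∧
        KPGeo.IsCentralExtension (KPGeo.Twisted.incl χ₂) KPGeo.Twisted.g ∧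
        KPGeo.IsPushout (quadraticChar k).toUnitHom (KPGeo.Geo.incl k r) KPGeo.Geo.proj
          (KPGeo.Twisted.incl χ₂) KPGeo.Twisted.g := by
  obtain ⟨χ, hχ⟩ := KPGeo.exists_chiGeo (k := k) (r := r)
  have hgeo := KPGeo.isKPCocycle_of_sGeo hχ
  -- Existence of the cocycle of the tame symbol comes from geometry, by inverting the values of the
  -- geometric cocycle.
  have htame : KPGeo.IsKPCocycle (KPGeo.tame (k := k)) fun g g' => (χ g g')⁻¹ := by
    have h := hgeo.map (invMonoidHom : kˣ →* kˣ)
    simpa only [invMonoidHom_apply, inv_inv] using h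
  have hhilb : KPGeo.IsKPCocycle (KPGeo.hilbert (k := k))
      fun g g' => (quadraticChar k).toUnitHom (χ g g') := by
    have h := hgeo.map (quadraticChar k).toUnitHom
    have he : (fun f g : k⸨X⸩ˣ => (quadraticChar k).toUnitHom (KPGeo.tame f g)⁻¹) = KPGeo.hilbert := by
      funext f g
      -- ζ takes values in ±1, so it does not distinguish the tame symbol from its inverse.
      rw [KPGeo.hilbert_eq hk, map_inv, Int.units_inv_eq_self]
    rwa [he] at h
  have h1 : KPGeo.sGeo (1 : GL (Fin r) k⸨X⸩) = 1 := by
    have h := KPGeo.sGeo_permGL (k := k) (r := r) 1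
    rwa [KPGeo.permGL_one, map_one] at h
  refine ⟨fun s => KPGeo.ACK.isCentralExtension k s, KPGeo.Geo.isCentralExtension k r, KPGeo.isGeoLift_iff_eq_sGeo,
    KPGeo.sGeo_proj, χ, _, hχ, htame, fun χ' h => h.unique htame, hgeo, fun g g' => (inv_inv _).symm,
    htame.isCentralExtension, KPGeo.exists_twistedEquiv (fun g g' => ?_) h1, _, hhilb,
    fun χ' h => h.unique hhilb, fun _ _ => rfl, hhilb.isCentralExtension,
    KPGeo.isPushout_sGeo _ hχ h1 fun _ _ => rfl⟩
  rw [inv_inv, hχ]
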